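/- Let $d\ge 1$ and let $\mathcal F=\bigoplus_{k\ge 0}(\mathbb C^d)^{\otimes k}$ be the full Fock space, with creation operators $S_i\xi=e_i\otimes\xi$ $(1\le i\le d)$. Let $Z=\{Z_k\}_{k\ge0}$ be a weight sequence, i.e. $Z_k\in B((\mathbb C^d)^{\otimes k})$, $Z_0=I$, $\sup_k\|Z_k\|<\infty$, and there is $\epsilon>0$ with $|Z_k|\ge\epsilon I$ for all $k\ge1$; write also $Z=\mathrm{diag}(Z_0,Z_1,\dots)\in B(\mathcal F)$. Let $q:B(\mathcal F)\to B(\mathcal F)/\mathcal K(\mathcal F)$ be the quotient map onto the Calkin algebra, $u_i=q(S_i)$, $z=q(Z)$, and $u_\alpha=u_{\alpha_1}\cdots u_{\alpha_n}$ for a word $\alpha=\alpha_1\cdots\alpha_n$ in $\{1,\dots,d\}$ (with $u_\emptyset=1$). For a $C^*$-subalgebra $\mathcal T\subseteq B(\mathcal F)$ let $\mathcal D(\mathcal T)=\{X\in\mathcal T:\ W_tXW_t^*=X\ \text{for all } t\in\mathbb R\}$, where $W_t$ is multiplication by $e^{int}$ on $(\mathbb C^d)^{\otimes n}$. Let $p\ge1$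 and assume Condition A(p): $\lim_{k\to\infty}\|I_p\otimes Z_k-Z_{k+p}\|=0$, where $I_p$ is the identity of $(\mathbb C^d)^{\otimes p}$. Let $\mathcal C_0$ be the $C^*$-algebra generated by $\{u_\alpha z^l u_\beta^*:\ l\ge0,\ 0\le|\alpha|=|\beta|<p\}$ and let $\mathcal C_{00}=e\,\mathcal C_0\,e$ with $e=u_1^{p-1}(u_1^{p-1})^*$. Let $M_{d^\infty}$ be the UHF algebra $\varinjlim M_{d^n}(\mathbb C)$ (connecting maps $a\mapsto a\otimes 1$), and let $\otimes$ be the $C^*$-tensor product (unambiguous, since $M_{d^\infty}$ is nuclear). Then: 1. If every $Z_k$ is a positive operator and $\mathcal T=\mathcal T(\mathbb C^d,Z)$ is the $C^*$-algebra generated by the weighted shifts $W_i=ZS_i$, $1\le i\le d$, then $q(\mathcal D(\mathcal T))\cong M_{d^\infty}\otimes\mathcal C_{00}$ as $C^*$-algebras. 2. Without the positivity assumption, the same holds for the $C^*$-algebra $\mathcal T$ generated by $I,Z,S_1,\dots,S_d$: $q(\mathcal D(\mathcal T))\cong M_{d^\infty}\otimes\mathcal C_{00}$. -/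

import Mathlib

noncomputable section

open scoped TensorProduct Kronecker ComplexOrder
open UniformSpace Filter Topology

namespace WeightedCuntz

/-! ### C⋆-seminorms and enveloping completions -/

/-- A C⋆-seminorm on a complex `*`-algebra. -/
structure CStarSeminorm (X : Type*) [NonUnitalRing X] [StarRing X] [Module ℂ X] extends
    Seminorm ℂ X where
  mul_le' : ∀ x y, toFun (x * y) ≤ toFun x * toFun y
  star_mul_self' : ∀ x, toFun (star x * x) = toFun x * toFun x

namespace CStarSeminorm

section Basic

variable {X : Type*} [NonUnitalRing X] [StarRing X] [Module ℂ X]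

instance : FunLike (CStarSeminorm X) X ℝ where
  coe N := N.toSeminorm
  coe_injective N M h := by
    rcases N with ⟨N, _, _⟩
    rcases M with ⟨M, _, _⟩
    obtain rfl : N = M := DFunLike.coe_injective h
    rfl

instance : SeminormClass (CStarSeminorm X) ℂ X where
  map_add_le_add N := map_add_le_add N.toSeminorm
  map_zero N := map_zero N.toSeminorm
  map_neg_eq_map N := map_neg_eq_map N.toSeminorm
  map_smul_eq_mul N := map_smul_eq_mul N.toSeminorm

lemma mul_le (N : CStarSeminorm X) (x y : X) : N (x * y) ≤ N x * N y := N.mul_le' x y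

lemma star_mul_self (N : CStarSeminorm X) (x : X) : N (star x * x) = N x * N x :=
  N.star_mul_self' x

lemma le_star (N : CStarSeminorm X) (x : X) : N x ≤ N (star x) := by
  rcases (apply_nonneg N x).eq_or_lt with h | h
  · rw [← h]; exact apply_nonneg N _
  · have := (N.star_mul_self x).symm.le.trans (N.mul_le (star x) x)
    exact le_of_mul_le_mul_right this h

lemma map_star (N : CStarSeminorm X) (x : X) : N (star x) = N x :=
  le_antisymm (by simpa using N.le_star (star x)) (N.le_star x)

/-- The zero C⋆-seminorm. -/
instance : Inhabited (CStarSeminorm X) :=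
  ⟨{ (0 : Seminorm ℂ X) with
      mul_le' := fun _ _ => (mul_zero (0 : ℝ)).ge
      star_mul_self' := fun _ => (mul_zero (0 : ℝ)).symm }⟩

lemma default_apply (x : X) : (default : CStarSeminorm X) x = 0 := rfl

/-- The `*`-algebra `X`, regarded as a seminormed `*`-algebra through `N`. -/
def Carrier (_N : CStarSeminorm X) : Type _ := X

instance (N : CStarSeminorm X) : NonUnitalSeminormedRing N.Carrier where
  __ := (inferInstanceAs (NonUnitalRing X) : NonUnitalRing N.Carrier)
  __ := @AddGroupSeminorm.toSeminormedAddCommGroup N.Carrier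
    (inferInstanceAs (AddCommGroup X)) N.toSeminorm.toAddGroupSeminorm
  norm_mul_le := N.mul_le

lemma norm_def (N : CStarSeminorm X) (x : N.Carrier) : ‖x‖ = N (show X from x) := rfl

instance (N : CStarSeminorm X) : StarRing N.Carrier := inferInstanceAs (StarRing X)

instance (N : CStarSeminorm X) : NormedSpace ℂ N.Carrier where
  __ := (inferInstanceAs (Module ℂ X) : Module ℂ N.Carrier)
  norm_smul_le c x := (map_smul_eq_mul N c (show X from x)).le

instance (N : CStarSeminorm X) : NormedStarGroup N.Carrier where
  norm_star_le x := (N.map_star (show X from x)).le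

/-- The separated completion of `X` with respect to the C⋆-seminorm `N`. -/
def Completion (N : CStarSeminorm X) : Type _ := UniformSpace.Completion N.Carrier

end Basic

namespace Completion

variable {X : Type*} [NonUnitalRing X] [StarRing X] [Module ℂ X] (N : CStarSeminorm X)

instance : NormedAddCommGroup N.Completion :=
  inferInstanceAs (NormedAddCommGroup (UniformSpace.Completion N.Carrier))
instance : NormedSpace ℂ N.Completion :=
  inferInstanceAs (NormedSpace ℂ (UniformSpace.Completion N.Carrier))
instance : CompleteSpace N.Completion :=
  inferInstanceAs (CompleteSpace (UniformSpace.Completion N.Carrier))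

/-- The canonical map of `X` into its completion. -/
def of (x : X) : N.Completion := ((show N.Carrier from x : N.Carrier) : UniformSpace.Completion _)

lemma norm_of (x : X) : ‖of N x‖ = N x := UniformSpace.Completion.norm_coe (E := N.Carrier) x

lemma of_add (x y : X) : of N (x + y) = of N x + of N y :=
  UniformSpace.Completion.coe_add (α := N.Carrier) x y

lemma of_zero : of N 0 = 0 := UniformSpace.Completion.coe_zero (α := N.Carrier)

lemma of_smul (c : ℂ) (x : X) : of N (c • x) = c • of N x :=
  UniformSpace.Completion.coe_smul (X := N.Carrier) c x

lemma isDenseInducing_of :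
    IsDenseInducing (fun x : N.Carrier => of N x) :=
  UniformSpace.Completion.isDenseInducing_coe

variable {N} in
@[elab_as_elim]
lemma induction_on {p : N.Completion → Prop} (a : N.Completion)
    (hp : IsClosed {a | p a}) (ih : ∀ x : X, p (of N x)) : p a :=
  UniformSpace.Completion.induction_on (α := N.Carrier) a hp ih

variable {N} in
@[elab_as_elim]
lemma induction_on₂ {p : N.Completion → N.Completion → Prop} (a b : N.Completion)
    (hp : IsClosed {x : N.Completion × N.Completion | p x.1 x.2})
    (ih : ∀ x y : X, p (of N x) (of N y)) : p a b :=
  UniformSpace.Completion.induction_on₂ (α := N.Carrier) (β := N.Carrier) a b hp ih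

variable {N} in
@[elab_as_elim]
lemma induction_on₃ {p : N.Completion → N.Completion → N.Completion → Prop}
    (a b c : N.Completion)
    (hp : IsClosed {x : N.Completion × N.Completion × N.Completion | p x.1 x.2.1 x.2.2})
    (ih : ∀ x y z : X, p (of N x) (of N y) (of N z)) : p a b c :=
  UniformSpace.Completion.induction_on₃ (α := N.Carrier) (β := N.Carrier) (γ := N.Carrier)
    a b c hp ih

/-- The continuous extension of the multiplication of `X`. -/
instance : Mul N.Completion :=
  ⟨Function.curry <| ((isDenseInducing_of N).prodMap (isDenseInducing_of N)).extend
    (fun x : N.Carrier × N.Carrier => of N (x.1 * x.2 : N.Carrier))⟩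

lemma continuous_of : Continuous (fun x : N.Carrier => of N x) :=
  UniformSpace.Completion.continuous_coe N.Carrier

lemma of_mul (x y : X) : of N (x * y) = of N x * of N y :=
  (((isDenseInducing_of N).prodMap (isDenseInducing_of N)).extend_eq
    (f := fun x : N.Carrier × N.Carrier => of N (x.1 * x.2 : N.Carrier))
    ((continuous_of N).comp (@continuous_mul N.Carrier _ _ _)) (x, y)).symm

instance : ContinuousMul N.Completion where
  continuous_mul := by
    let m := (AddMonoidHom.mul : N.Carrier →+ N.Carrier →+ N.Carrier).compr₂
      UniformSpace.Completion.toCompl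
    have : Continuous fun p : N.Carrier × N.Carrier => m p.1 p.2 :=
      (UniformSpace.Completion.continuous_coe N.Carrier).comp continuous_mul
    have di : IsDenseInducing
      (UniformSpace.Completion.toCompl : N.Carrier → UniformSpace.Completion N.Carrier) :=
        UniformSpace.Completion.isDenseInducing_coe
    exact (di.extend_Z_bilin di this :)

/-- The continuous extension of the involution of `X`. -/
instance : Star N.Completion :=
  ⟨UniformSpace.Completion.map (fun x : N.Carrier => star x)⟩

lemma of_star (x : X) : of N (star x) = star (of N x) :=
  (UniformSpace.Completion.map_coe (f := fun x : N.Carrier => star x)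
    star_isometry.uniformContinuous x).symm

lemma continuous_star' : Continuous (fun a : N.Completion => star a) :=
  UniformSpace.Completion.continuous_map

instance : NonUnitalNormedRing N.Completion where
  __ : NormedAddCommGroup N.Completion := inferInstance
  zero_mul a := induction_on a
    (isClosed_eq (continuous_const.mul continuous_id) continuous_const)
    fun x => by rw [← of_zero, ← of_mul, zero_mul]
  mul_zero a := induction_on a
    (isClosed_eq (continuous_id.mul continuous_const) continuous_const)
    fun x => by rw [← of_zero, ← of_mul, mul_zero]
  left_distrib a b c := induction_on₃ a b c
    (isClosed_eq (by fun_prop) (by fun_prop))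
    fun x y z => by rw [← of_add, ← of_mul, ← of_mul, ← of_mul, ← of_add, mul_add]
  right_distrib a b c := induction_on₃ a b c
    (isClosed_eq (by fun_prop) (by fun_prop))
    fun x y z => by rw [← of_add, ← of_mul, ← of_mul, ← of_mul, ← of_add, add_mul]
  mul_assoc a b c := induction_on₃ a b c
    (isClosed_eq (by fun_prop) (by fun_prop))
    fun x y z => by rw [← of_mul, ← of_mul, ← of_mul, ← of_mul, mul_assoc]
  norm_mul_le a b := induction_on₂ a b
    (isClosed_le (by fun_prop) (by fun_prop))
    fun x y => by rw [← of_mul, norm_of, norm_of, norm_of]; exact N.mul_le x y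

instance : StarRing N.Completion where
  star_involutive a := induction_on a
    (isClosed_eq ((continuous_star' N).comp (continuous_star' N)) continuous_id)
    fun x => by rw [← of_star, ← of_star, star_star]
  star_mul a b := induction_on₂ a b
    (isClosed_eq ((continuous_star' N).comp (by fun_prop))
      (((continuous_star' N).comp continuous_snd).mul ((continuous_star' N).comp continuous_fst)))
    fun x y => by rw [← of_mul, ← of_star, ← of_star, ← of_star, ← of_mul, star_mul]
  star_add a b := induction_on₂ a b
    (isClosed_eq ((continuous_star' N).comp (by fun_prop))
      (((continuous_star' N).comp continuous_fst).add ((continuous_star' N).comp continuous_snd)))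
    fun x y => by rw [← of_add, ← of_star, ← of_star, ← of_star, ← of_add, star_add]

/-- The completion of a `*`-algebra with respect to a C⋆-seminorm is a C⋆-algebra. -/
instance [IsScalarTower ℂ X X] [SMulCommClass ℂ X X] [StarModule ℂ X] :
    NonUnitalCStarAlgebra N.Completion where
  norm_mul_self_le a := induction_on a
    (isClosed_le (by fun_prop) (((continuous_star' N).mul continuous_id).norm))
    fun x => by
      rw [← of_star, ← of_mul, norm_of, norm_of]
      exact (N.star_mul_self x).ge
  smul_assoc c a b := induction_on₂ a b
    (isClosed_eq ((continuous_fst.const_smul c).mul continuous_snd)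
      ((continuous_fst.mul continuous_snd).const_smul c))
    fun x y => by
      simp only [smul_eq_mul]
      rw [← of_smul, ← of_mul, ← of_mul, ← of_smul, smul_mul_assoc]
  smul_comm c a b := induction_on₂ a b
    (isClosed_eq ((continuous_fst.mul continuous_snd).const_smul c)
      (continuous_fst.mul (continuous_snd.const_smul c)))
    fun x y => by
      simp only [smul_eq_mul]
      rw [← of_smul, ← of_mul, ← of_mul, ← of_smul, mul_smul_comm]
  star_smul c a := induction_on a
    (isClosed_eq ((continuous_star' N).comp (continuous_id.const_smul c))
      ((continuous_star' N).const_smul (star c)))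
    fun x => by rw [← of_smul, ← of_star, ← of_star, ← of_smul, star_smul]

end Completion
end CStarSeminorm

/-! ### The tensor product of C⋆-algebras -/

section Tensor

variable (A B : Type*) [NonUnitalCStarAlgebra A] [NonUnitalCStarAlgebra B]

instance instStarRingTensor : StarRing (A ⊗[ℂ] B) where
  star_add := star_add
  star_mul x y := by
    induction x with
    | zero => simp
    | add x₁ x₂ h₁ h₂ => rw [add_mul, star_add, h₁, h₂, star_add, mul_add]
    | tmul a b =>
      induction y with
      | zero => simp
      | add y₁ y₂ h₁ h₂ => rw [mul_add, star_add, h₁, h₂, star_add, add_mul]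
      | tmul c e => simp [Algebra.TensorProduct.tmul_mul_tmul]

/-- The C⋆-seminorms `N` on the algebraic tensor product `A ⊗ B`.  The bound
`N (a ⊗ b) ≤ ‖a‖ ‖b‖` holds for every C⋆-seminorm; it is recorded here so that the supremum over
all of them is visibly finite. -/
def TensorSeminorm : Type _ :=
  {N : CStarSeminorm (A ⊗[ℂ] B) // ∀ (a : A) (b : B), N (a ⊗ₜ[ℂ] b) ≤ ‖a‖ * ‖b‖}

instance : Nonempty (TensorSeminorm A B) :=
  ⟨⟨default, fun a b => by rw [CStarSeminorm.default_apply]; positivity⟩⟩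

variable {A B} in
lemma TensorSeminorm.bddAbove (x : A ⊗[ℂ] B) :
    BddAbove (Set.range fun N : TensorSeminorm A B => N.1 x) := by
  induction x with
  | zero => exact ⟨0, by rintro _ ⟨N, rfl⟩; simp⟩
  | tmul a b => exact ⟨‖a‖ * ‖b‖, by rintro _ ⟨N, rfl⟩; exact N.2 a b⟩
  | add x y hx hy =>
    obtain ⟨C, hC⟩ := hx
    obtain ⟨D, hD⟩ := hy
    refine ⟨C + D, ?_⟩
    rintro _ ⟨N, rfl⟩
    exact (map_add_le_add N.1 x y).trans (add_le_add (hC ⟨N, rfl⟩) (hD ⟨N, rfl⟩))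

/-- The maximal C⋆-norm on the algebraic tensor product `A ⊗ B`. -/
def maxCStarSeminorm : CStarSeminorm (A ⊗[ℂ] B) where
  toSeminorm := Seminorm.of (fun x => ⨆ N : TensorSeminorm A B, N.1 x)
    (fun x y => ciSup_le fun N => (map_add_le_add N.1 x y).trans
      (add_le_add (le_ciSup (TensorSeminorm.bddAbove x) N)
        (le_ciSup (TensorSeminorm.bddAbove y) N)))
    (fun c x => by
      simp only [map_smul_eq_mul]
      exact (Real.mul_iSup_of_nonneg (norm_nonneg c) _).symm)
  mul_le' x y := ciSup_le fun N => (N.1.mul_le x y).trans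
    (mul_le_mul (le_ciSup (TensorSeminorm.bddAbove x) N)
      (le_ciSup (TensorSeminorm.bddAbove y) N) (apply_nonneg N.1 y)
      (Real.iSup_nonneg fun N => apply_nonneg N.1 x))
  star_mul_self' x := by
    have h0 : 0 ≤ ⨆ N : TensorSeminorm A B, N.1 x := Real.iSup_nonneg fun N => apply_nonneg N.1 x
    refine le_antisymm (ciSup_le fun N => ?_) ?_
    · rw [N.1.star_mul_self]
      exact mul_self_le_mul_self (apply_nonneg N.1 x) (le_ciSup (TensorSeminorm.bddAbove x) N)
    · change (⨆ N : TensorSeminorm A B, N.1 x) * (⨆ N : TensorSeminorm A B, N.1 x) ≤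
        ⨆ N : TensorSeminorm A B, N.1 (star x * x)
      have h : (⨆ N : TensorSeminorm A B, N.1 x) ≤
          √(⨆ N : TensorSeminorm A B, N.1 (star x * x)) := ciSup_le fun N => by
        refine Real.le_sqrt_of_sq_le ?_
        rw [sq, ← N.1.star_mul_self]
        exact le_ciSup (TensorSeminorm.bddAbove (star x * x)) N
      refine (mul_self_le_mul_self h0 h).trans_eq (Real.mul_self_sqrt ?_)
      exact Real.iSup_nonneg fun N => apply_nonneg N.1 _

/-- The (maximal) C⋆-algebra tensor product: the completion of the algebraic tensor product with
respect to the largest C⋆-norm.  If one of the factors is nuclear, in particular if it is a UHF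
algebra, this is the only C⋆-completion of the algebraic tensor product. -/
abbrev CStarTensor : Type _ := (maxCStarSeminorm A B).Completion

end Tensor

/-! ### Inductive limits of C⋆-algebras -/

section InductiveLimit

variable {A : ℕ → Type*} [∀ n, CStarAlgebra (A n)] (φ : ∀ n, A n →⋆ₐ[ℂ] A (n + 1))

/-- The `*`-algebra of sequences `(aₙ)` with `aₙ₊₁ = φₙ(aₙ)` for all large `n`. -/
def eventuallyCoherent : NonUnitalStarSubalgebra ℂ (∀ n, A n) where
  carrier := {a | ∃ N, ∀ n ≥ N, a (n + 1) = φ n (a n)}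
  add_mem' := by
    rintro a b ⟨N, hN⟩ ⟨M, hM⟩
    exact ⟨max N M, fun n hn => by
      simp [hN n (le_of_max_le_left hn), hM n (le_of_max_le_right hn)]⟩
  zero_mem' := ⟨0, fun n _ => by simp⟩
  mul_mem' := by
    rintro a b ⟨N, hN⟩ ⟨M, hM⟩
    exact ⟨max N M, fun n hn => by
      simp [hN n (le_of_max_le_left hn), hM n (le_of_max_le_right hn)]⟩
  smul_mem' := by
    rintro c a ⟨N, hN⟩
    exact ⟨N, fun n hn => by simp [hN n hn]⟩
  star_mem' := by
    rintro a ⟨N, hN⟩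
    exact ⟨N, fun n hn => by simp [hN n hn, map_star]⟩

/-- For an eventually coherent sequence the norms `‖aₙ‖` are eventually decreasing, so that they
converge. -/
lemma tendsto_norm_eventuallyCoherent (a : eventuallyCoherent φ) :
    Tendsto (fun n => ‖(a : ∀ n, A n) n‖) atTop
      (𝓝 (limUnder atTop fun n => ‖(a : ∀ n, A n) n‖)) := by
  refine tendsto_nhds_limUnder ?_
  obtain ⟨N, hN⟩ := a.2
  have h : Antitone fun n => ‖(a : ∀ n, A n) (n + N)‖ := antitone_nat_of_succ_le fun n => by
    have := hN (n + N) (by omega)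
    rw [show n + 1 + N = n + N + 1 by omega, this]
    exact NonUnitalStarAlgHom.norm_apply_le _ _
  exact ⟨_, (tendsto_add_atTop_iff_nat N).1
    (tendsto_atTop_ciInf h ⟨0, by rintro _ ⟨n, rfl⟩; exact norm_nonneg _⟩)⟩

/-- The C⋆-seminorm `(aₙ) ↦ lim ‖aₙ‖`. -/
def limitSeminorm : CStarSeminorm (eventuallyCoherent φ) where
  toSeminorm := Seminorm.of (fun a => limUnder atTop fun n => ‖(a : ∀ n, A n) n‖)
    (fun a b => le_of_tendsto_of_tendsto' (tendsto_norm_eventuallyCoherent φ (a + b))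
      ((tendsto_norm_eventuallyCoherent φ a).add (tendsto_norm_eventuallyCoherent φ b))
      fun n => norm_add_le _ _)
    (fun c a => tendsto_nhds_unique (tendsto_norm_eventuallyCoherent φ (c • a))
      (by simpa [norm_smul] using (tendsto_norm_eventuallyCoherent φ a).const_mul ‖c‖))
  mul_le' a b := le_of_tendsto_of_tendsto' (tendsto_norm_eventuallyCoherent φ (a * b))
    ((tendsto_norm_eventuallyCoherent φ a).mul (tendsto_norm_eventuallyCoherent φ b))
    fun n => norm_mul_le _ _
  star_mul_self' a := tendsto_nhds_unique (tendsto_norm_eventuallyCoherent φ (star a * a))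
    (((tendsto_norm_eventuallyCoherent φ a).mul (tendsto_norm_eventuallyCoherent φ a)).congr
      fun n => (CStarRing.norm_star_mul_self (x := (a : ∀ n, A n) n)).symm)

/-- The inductive limit (in the category of C⋆-algebras) of the sequence
`A 0 → A 1 → A 2 → ⋯` with connecting maps `φ n`. -/
abbrev CStarInductiveLimit : Type _ := (limitSeminorm φ).Completion

end InductiveLimit

/-! ### The UHF algebra of type `d^∞` -/

/-- Words of length `n` in the letters `0, …, d - 1`. -/
abbrev Word (d n : ℕ) : Type := Fin n → Fin d

/-- The map `a ↦ a ⊗ 1` from `M_{dⁿ}` to `M_{dⁿ⁺¹}`; rows and columns are indexed by words. -/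
def tensorOne (d n : ℕ) : Matrix (Word d n) (Word d n) ℂ →⋆ₐ[ℂ]
    Matrix (Word d (n + 1)) (Word d (n + 1)) ℂ where
  toFun a := Matrix.reindex (Fin.appendEquiv n 1) (Fin.appendEquiv n 1)
    (a ⊗ₖ (1 : Matrix (Word d 1) (Word d 1) ℂ))
  map_one' := by simp
  map_mul' a b := by
    rw [Matrix.reindex_apply, Matrix.reindex_apply, Matrix.reindex_apply,
      Matrix.submatrix_mul_equiv,
      ← Matrix.mul_kronecker_mul, mul_one]
  map_zero' := by simp
  map_add' a b := by
    rw [Matrix.add_kronecker]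
    rfl
  commutes' c := by
    rw [Algebra.algebraMap_eq_smul_one, Algebra.algebraMap_eq_smul_one,
      Matrix.smul_kronecker]
    simp [Matrix.submatrix_smul]
  map_star' a := by
    rw [Matrix.star_eq_conjTranspose, Matrix.star_eq_conjTranspose, Matrix.conjTranspose_reindex,
      Matrix.conjTranspose_kronecker, Matrix.conjTranspose_one]

/-- The map `a ↦ a ⊗ 1` between the C⋆-algebras `M_{dⁿ}` and `M_{dⁿ⁺¹}`. -/
def uhfMap (d n : ℕ) : CStarMatrix (Word d n) (Word d n) ℂ →⋆ₐ[ℂ]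
    CStarMatrix (Word d (n + 1)) (Word d (n + 1)) ℂ :=
  (CStarMatrix.ofMatrixStarAlgEquiv : Matrix _ _ ℂ ≃⋆ₐ[ℂ] CStarMatrix _ _ ℂ).toStarAlgHom.comp
    ((tensorOne d n).comp
      (CStarMatrix.ofMatrixStarAlgEquiv : Matrix _ _ ℂ ≃⋆ₐ[ℂ] CStarMatrix _ _ ℂ).symm.toStarAlgHom)

/-- The UHF algebra `M_{d^∞}`, the inductive limit of `M_{dⁿ}(ℂ)` along `a ↦ a ⊗ 1`. -/
abbrev UHF (d : ℕ) : Type := CStarInductiveLimit (uhfMap d)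

/-! ### The Calkin algebra -/

section Calkin

variable (H : Type*) [NormedAddCommGroup H] [InnerProductSpace ℂ H] [CompleteSpace H]

/-- The two-sided ideal of compact operators on `H`. -/
def compactIdeal : Ideal (H →L[ℂ] H) where
  carrier := {T | IsCompactOperator T}
  add_mem' hS hT := hS.add hT
  zero_mem' := isCompactOperator_zero
  smul_mem' S _ hT := hT.clm_comp S

instance : (compactIdeal H).IsTwoSided where
  mul_mem_of_left {T} S hT := IsCompactOperator.comp_clm (f := T) hT S

instance isClosed_compactIdeal : IsClosed (compactIdeal H : Set (H →L[ℂ] H)) :=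
  isClosed_setOfPred_isCompactOperator

variable {H} in
lemma exists_projection_approx {T : H →L[ℂ] H} (hT : IsCompactOperator T) {ε : ℝ} (hε : 0 < ε) :
    ∃ P : H →L[ℂ] H, IsCompactOperator P ∧ star P = P ∧ ‖1 - P‖ ≤ 1 ∧ ‖(1 - P) * T‖ ≤ ε := by
  have hb : TotallyBounded (T '' Metric.closedBall 0 1) :=
    (hT.isCompact_closure_image_closedBall (f := (T : H →ₗ[ℂ] H)) 1).totallyBounded.subset
      subset_closure
  obtain ⟨t, ht, hcov⟩ := Metric.totallyBounded_iff.1 hb ε hε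
  let V : Submodule ℂ H := Submodule.span ℂ t
  have : FiniteDimensional ℂ V := FiniteDimensional.span_of_finite ℂ ht
  have h1 : 1 - V.starProjection = Vᗮ.starProjection := by
    rw [Submodule.starProjection_orthogonal]; rfl
  have hn : ‖1 - V.starProjection‖ ≤ 1 := by
    rw [h1]; exact Submodule.starProjection_norm_le _
  refine ⟨V.starProjection, ?_, (isSelfAdjoint_starProjection V), hn, ?_⟩
  · have : IsCompactOperator V.subtypeL := by
      have : ProperSpace V := FiniteDimensional.proper ℂ V
      exact isCompactOperator_of_locallyCompactSpace_rng V.subtypeL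
    exact this.comp_clm V.orthogonalProjectionOnto
  · refine ContinuousLinearMap.opNorm_le_of_unit_norm hε.le fun x hx => ?_
    obtain ⟨y, hy, hxy⟩ := Set.mem_iUnion₂.1 (hcov ⟨x, by simp [hx], rfl⟩)
    have hyV : V.starProjection y = y :=
      Submodule.starProjection_eq_self_iff.2 (Submodule.subset_span hy)
    have : ((1 - V.starProjection) * T) x = (1 - V.starProjection) (T x - y) := by
      simp [map_sub, hyV]
    rw [this]
    refine (ContinuousLinearMap.le_opNorm _ _).trans ?_
    have h2 : ‖T x - y‖ ≤ ε := by rw [← dist_eq_norm]; exact (Metric.mem_ball.1 hxy).le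
    calc ‖1 - V.starProjection‖ * ‖T x - y‖ ≤ 1 * ε := by gcongr
      _ = ε := one_mul ε

variable {H} in
lemma star_mem_compactIdeal {T : H →L[ℂ] H} (hT : T ∈ compactIdeal H) :
    star T ∈ compactIdeal H := by
  have : star T ∈ closure (compactIdeal H : Set (H →L[ℂ] H)) := by
    refine Metric.mem_closure_iff.2 fun ε hε => ?_
    obtain ⟨P, hP, hPs, -, hPT⟩ := exists_projection_approx hT (half_pos hε)
    refine ⟨star T * P, (compactIdeal H).mul_mem_left _ hP, ?_⟩
    have h : star T - star T * P = star ((1 - P) * T) := by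
      simp [hPs, mul_sub]
    rw [dist_eq_norm, h, norm_star]
    linarith
  rwa [(isClosed_compactIdeal H).closure_eq] at this

/-- The Calkin algebra `B(H) / K(H)`. -/
def Calkin : Type _ := (H →L[ℂ] H) ⧸ compactIdeal H

namespace Calkin

variable {H} in
lemma exists_lift_norm_lt (x : Calkin H) {ε : ℝ} (hε : 0 < ε) :
    ∃ T : H →L[ℂ] H, Ideal.Quotient.mk (compactIdeal H) T = x ∧
      ‖T‖ < (Submodule.Quotient.normedAddCommGroup (compactIdeal H)).norm x + ε :=
  Submodule.Quotient.norm_mk_lt x hε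

variable {H} in
lemma norm_mk_le (T : H →L[ℂ] H) :
    (Submodule.Quotient.normedAddCommGroup (compactIdeal H)).norm
      (Ideal.Quotient.mk (compactIdeal H) T) ≤ ‖T‖ :=
  Submodule.Quotient.norm_mk_le (compactIdeal H) T

instance : NormedRing (Calkin H) where
  __ := (Submodule.Quotient.normedAddCommGroup (compactIdeal H) : NormedAddCommGroup (Calkin H))
  __ := Ideal.Quotient.ring (compactIdeal H)
  norm_mul_le x y := by
    let _ : Norm (Calkin H) := (Submodule.Quotient.normedAddCommGroup (compactIdeal H)).toNorm
    have hlim : Tendsto (fun ε : ℝ => (‖x‖ + ε) * (‖y‖ + ε)) (𝓝[>] 0) (𝓝 (‖x‖ * ‖y‖)) := by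
      have : Tendsto (fun ε : ℝ => (‖x‖ + ε) * (‖y‖ + ε)) (𝓝 0)
          (𝓝 ((‖x‖ + 0) * (‖y‖ + 0))) :=
        (by fun_prop : Continuous fun ε : ℝ => (‖x‖ + ε) * (‖y‖ + ε)).tendsto 0
      simpa using this.mono_left nhdsWithin_le_nhds
    refine ge_of_tendsto hlim (eventually_nhdsWithin_of_forall fun ε (hε : 0 < ε) => ?_)
    obtain ⟨S, rfl, hS⟩ := exists_lift_norm_lt x hε
    obtain ⟨T, rfl, hT⟩ := exists_lift_norm_lt y hε
    refine (norm_mk_le (S * T)).trans ((norm_mul_le S T).trans ?_)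
    exact mul_le_mul hS.le hT.le (norm_nonneg _) ((norm_nonneg _).trans hS.le)

instance : CompleteSpace (Calkin H) := Submodule.Quotient.completeSpace (compactIdeal H)

instance : NormedAlgebra ℂ (Calkin H) where
  __ := (Ideal.Quotient.algebra ℂ : Algebra ℂ (Calkin H))
  norm_smul_le c x := (Submodule.Quotient.normedSpace (compactIdeal H) ℂ).norm_smul_le c x

/-- The involution of the Calkin algebra. -/
instance : StarRing (Calkin H) where
  star := Quotient.map' star fun S T h => by
    rw [Submodule.quotientRel_def] at h ⊢
    rw [← star_sub]
    exact star_mem_compactIdeal h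
  star_involutive := by
    rintro ⟨T⟩
    exact congrArg (Ideal.Quotient.mk (compactIdeal H)) (star_star T)
  star_mul := by
    rintro ⟨S⟩ ⟨T⟩
    exact congrArg (Ideal.Quotient.mk (compactIdeal H)) (star_mul S T)
  star_add := by
    rintro ⟨S⟩ ⟨T⟩
    exact congrArg (Ideal.Quotient.mk (compactIdeal H)) (star_add S T)

instance : StarModule ℂ (Calkin H) where
  star_smul c := by
    rintro ⟨T⟩
    exact congrArg (Ideal.Quotient.mk (compactIdeal H)) (star_smul c T)

/-- The quotient map `q : B(H) → B(H) / K(H)`. -/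
def mk : (H →L[ℂ] H) →⋆ₐ[ℂ] Calkin H where
  __ := Ideal.Quotient.mkₐ ℂ (compactIdeal H)
  map_star' _ := rfl

variable {H} in
lemma mk_surjective : Function.Surjective (mk H) := Ideal.Quotient.mk_surjective

variable {H} in
lemma mk_eq_zero {T : H →L[ℂ] H} : mk H T = 0 ↔ IsCompactOperator T :=
  Ideal.Quotient.eq_zero_iff_mem

variable {H} in
lemma norm_sq_le (T : H →L[ℂ] H) : ‖mk H T‖ * ‖mk H T‖ ≤ ‖mk H (T * star T)‖ := by
  refine le_of_forall_pos_le_add fun ε hε => ?_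
  obtain ⟨S, hS, hSn⟩ := exists_lift_norm_lt (mk H (T * star T)) (half_pos hε)
  have hK : IsCompactOperator (T * star T - S : H →L[ℂ] H) := by
    rw [← mk_eq_zero, map_sub, sub_eq_zero]; exact hS.symm
  obtain ⟨P, hP, hPs, hP1, hPK⟩ := exists_projection_approx hK (half_pos hε)
  have h1 : mk H T = mk H ((1 - P) * T) := by
    rw [sub_mul, map_sub, one_mul, map_mul (mk H) P T, mk_eq_zero.2 hP, zero_mul, sub_zero]
  have h2 : ‖mk H T‖ ≤ ‖(1 - P) * T‖ := by rw [h1]; exact norm_mk_le _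
  have h3 : ((1 - P) * T) * star ((1 - P) * T) =
      (1 - P) * (T * star T - S) * (1 - P) + (1 - P) * S * (1 - P) := by
    rw [star_mul, star_sub, star_one, hPs]; noncomm_ring
  have hS' : ‖S‖ < ‖mk H (T * star T)‖ + ε / 2 := hSn
  calc ‖mk H T‖ * ‖mk H T‖ ≤ ‖(1 - P) * T‖ * ‖(1 - P) * T‖ :=
        mul_self_le_mul_self (norm_nonneg _) h2
    _ = ‖((1 - P) * T) * star ((1 - P) * T)‖ := (CStarRing.norm_self_mul_star).symm
    _ ≤ ‖(1 - P) * (T * star T - S) * (1 - P)‖ + ‖(1 - P) * S * (1 - P)‖ := by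
        rw [h3]; exact norm_add_le _ _
    _ ≤ ε / 2 * 1 + 1 * ‖S‖ * 1 := by
        gcongr
        · exact (norm_mul_le _ _).trans (by gcongr)
        · exact (norm_mul_le _ _).trans (by gcongr; exact (norm_mul_le _ _).trans (by gcongr))
    _ ≤ ‖mk H (T * star T)‖ + ε := by linarith

/-- The Calkin algebra is a C⋆-algebra. -/
instance : CStarAlgebra (Calkin H) where
  norm_mul_self_le x := by
    obtain ⟨T, rfl⟩ := mk_surjective x
    have h1 := norm_sq_le (star T)
    rw [star_star, map_mul, map_star] at h1
    have h2 : ‖mk H T‖ ≤ ‖star (mk H T)‖ := by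
      rcases (norm_nonneg (mk H T)).eq_or_lt with h | h
      · rw [← h]; exact norm_nonneg _
      · have h3 := norm_sq_le T
        rw [map_mul, map_star] at h3
        exact le_of_mul_le_mul_left (h3.trans (norm_mul_le _ _)) h
    exact (mul_self_le_mul_self (norm_nonneg _) h2).trans h1

end Calkin
end Calkin

/-! ### The Fock space and its operators -/

section Fock

/-- The tensor power `(ℂᵈ)^{⊗ k}`, with its orthonormal basis indexed by words of length `k`. -/
abbrev TensorPow (d k : ℕ) : Type := EuclideanSpace ℂ (Word d k)

/-- The full Fock space `⨁ₖ (ℂᵈ)^{⊗ k}` (Hilbert space direct sum). -/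
abbrev Fock (d : ℕ) : Type := lp (fun k : ℕ => TensorPow d k) 2

variable {d : ℕ}

/-- The block diagonal operator `diag(T₀, T₁, …)` on the Fock space. -/
def diag (T : ∀ k, TensorPow d k →L[ℂ] TensorPow d k) (hT : ∃ C, ∀ k, ‖T k‖ ≤ C) :
    Fock d →L[ℂ] Fock d :=
  have bound : ∀ {C : ℝ} (_ : ∀ k, ‖T k‖ ≤ C) (x : Fock d) (k : ℕ),
      ‖T k (x k)‖ ≤ ‖((C : ℂ) • x : Fock d) k‖ := fun {C} hC x k => by
    have hC0 : 0 ≤ C := (norm_nonneg _).trans (hC 0)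
    rw [lp.coeFn_smul, Pi.smul_apply, norm_smul, Complex.norm_real, Real.norm_of_nonneg hC0]
    exact (ContinuousLinearMap.le_opNorm _ _).trans
      (mul_le_mul_of_nonneg_right (hC k) (norm_nonneg _))
  LinearMap.mkContinuousOfExistsBound
    { toFun := fun x => ⟨fun k => T k (x k), by
        obtain ⟨C, hC⟩ := hT
        exact (lp.memℓp ((C : ℂ) • x : Fock d)).mono' (bound hC x)⟩
      map_add' := fun x y => by ext k : 2; exact map_add (T k) _ _
      map_smul' := fun c x => by ext k : 2; exact map_smul (T k) _ _ }
    (by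
      obtain ⟨C, hC⟩ := hT
      have hC0 : 0 ≤ C := (norm_nonneg _).trans (hC 0)
      refine ⟨C, fun x => ?_⟩
      refine (lp.norm_mono (y := ((C : ℂ) • x : Fock d)) (by norm_num) (bound hC x)).trans_eq ?_
      rw [norm_smul, Complex.norm_real, Real.norm_of_nonneg hC0])

@[simp]
lemma diag_apply (T : ∀ k, TensorPow d k →L[ℂ] TensorPow d k) (hT : ∃ C, ∀ k, ‖T k‖ ≤ C)
    (x : Fock d) (k : ℕ) : diag T hT x k = T k (x k) := rfl

/-- The map `ξ ↦ eᵢ ⊗ ξ` from `(ℂᵈ)^{⊗ k}` to `(ℂᵈ)^{⊗ (k+1)}`. -/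
def tensorLeft (i : Fin d) (k : ℕ) : TensorPow d k →ₗ[ℂ] TensorPow d (k + 1) where
  toFun ξ := WithLp.toLp 2 fun w => if w 0 = i then ξ (Fin.tail w) else 0
  map_add' ξ η := by ext w; simp only [PiLp.add_apply]; split_ifs <;> simp
  map_smul' c ξ := by ext w; simp

lemma norm_tensorLeft (i : Fin d) (k : ℕ) (ξ : TensorPow d k) : ‖tensorLeft i k ξ‖ = ‖ξ‖ := by
  rw [EuclideanSpace.norm_eq, EuclideanSpace.norm_eq]
  congr 1
  rw [← (Fin.consEquiv fun _ : Fin (k + 1) => Fin d).sum_comp, Fintype.sum_prod_type,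
    Finset.sum_eq_single i]
  · simp [tensorLeft, Fin.consEquiv]
  · intro j _ hj
    simp [tensorLeft, Fin.consEquiv, hj]
  · simp

/-- The sequence `(0, eᵢ ⊗ x₀, eᵢ ⊗ x₁, …)`. -/
def creationSeq (i : Fin d) (x : ∀ k, TensorPow d k) : ∀ k, TensorPow d k
  | 0 => 0
  | k + 1 => tensorLeft i k (x k)

lemma hasSum_creationSeq (i : Fin d) (x : Fock d) :
    HasSum (fun k => ‖creationSeq i x k‖ ^ (2 : ENNReal).toReal) (‖x‖ ^ (2 : ENNReal).toReal) := by
  rw [← hasSum_nat_add_iff' 1]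
  simpa [creationSeq, norm_tensorLeft] using lp.hasSum_norm (p := 2) (by norm_num) x

/-- The creation operator `Sᵢ ξ = eᵢ ⊗ ξ` on the Fock space. -/
def creation (i : Fin d) : Fock d →L[ℂ] Fock d :=
  LinearMap.mkContinuous
    { toFun := fun x => ⟨creationSeq i x, memℓp_gen (hasSum_creationSeq i x).summable⟩
      map_add' := fun x y => by
        ext k : 2
        cases k with
        | zero => exact (add_zero 0).symm
        | succ k => exact map_add (tensorLeft i k) _ _
      map_smul' := fun c x => by
        ext k : 2
        cases k with
        | zero => exact (smul_zero c).symm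
        | succ k => exact map_smul (tensorLeft i k) _ _ }
    1 fun x => by
      rw [one_mul]
      exact lp.norm_le_of_tsum_le (by norm_num) (norm_nonneg x) (hasSum_creationSeq i x).tsum_eq.le

@[simp]
lemma creation_apply_zero (i : Fin d) (x : Fock d) : creation i x 0 = 0 := rfl

@[simp]
lemma creation_apply_succ (i : Fin d) (x : Fock d) (k : ℕ) :
    creation i x (k + 1) = tensorLeft i k (x k) := rfl

lemma star_creation_mul_self (i : Fin d) : star (creation i) * creation i = 1 := by
  refine (ContinuousLinearMap.norm_map_iff_adjoint_comp_self _).1 fun x => ?_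
  rw [lp.norm_eq_tsum_rpow (by norm_num), lp.norm_eq_tsum_rpow (by norm_num)]
  congr 1
  rw [← lp.norm_rpow_eq_tsum (by norm_num) x]
  exact (hasSum_creationSeq i x).tsum_eq

/-- The gauge unitary `W_t = ∑ₙ e^{int} Pₙ`, where `Pₙ` is the projection onto `(ℂᵈ)^{⊗ n}`. -/
def gaugeUnitary (d : ℕ) (t : ℝ) : Fock d →L[ℂ] Fock d :=
  diag (fun k => Complex.exp (Complex.I * k * t) • ContinuousLinearMap.id ℂ (TensorPow d k))
    ⟨1, fun k => by
      rw [norm_smul, show Complex.I * k * t = ((k * t : ℝ) : ℂ) * Complex.I by push_cast; ring,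
        Complex.norm_exp_ofReal_mul_I, one_mul]
      exact ContinuousLinearMap.norm_id_le⟩

lemma star_gaugeUnitary_mul_self (t : ℝ) : star (gaugeUnitary d t) * gaugeUnitary d t = 1 := by
  refine (ContinuousLinearMap.norm_map_iff_adjoint_comp_self _).1 fun x => ?_
  have h : ∀ k, ‖gaugeUnitary d t x k‖ = ‖x k‖ := fun k => by
    rw [gaugeUnitary, diag_apply, smul_apply, norm_smul,
      show Complex.I * k * t = ((k * t : ℝ) : ℂ) * Complex.I by push_cast; ring,
      Complex.norm_exp_ofReal_mul_I, one_mul]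
    rfl
  rw [lp.norm_eq_tsum_rpow (by norm_num), lp.norm_eq_tsum_rpow (by norm_num)]
  simp only [h]

/-- The gauge automorphism `γ_t = Ad W_t` of `B(F(ℂᵈ))`. -/
def gauge (t : ℝ) (X : Fock d →L[ℂ] Fock d) : Fock d →L[ℂ] Fock d :=
  gaugeUnitary d t * X * star (gaugeUnitary d t)

lemma gauge_mul (t : ℝ) (X Y : Fock d →L[ℂ] Fock d) :
    gauge t (X * Y) = gauge t X * gauge t Y := by
  have : gauge t X * gauge t Y = gaugeUnitary d t * X *
      (star (gaugeUnitary d t) * gaugeUnitary d t) * Y * star (gaugeUnitary d t) := by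
    simp only [gauge, mul_assoc]
  rw [this, star_gaugeUnitary_mul_self, mul_one, gauge, mul_assoc (gaugeUnitary d t) X Y]

/-- The fixed point algebra `{X ∈ T : γ_t(X) = X for all t}` of the gauge action on a
C⋆-subalgebra `T` of `B(F(ℂᵈ))`. -/
def gaugeFixed (T : NonUnitalStarSubalgebra ℂ (Fock d →L[ℂ] Fock d)) :
    NonUnitalStarSubalgebra ℂ (Fock d →L[ℂ] Fock d) where
  carrier := {X | X ∈ T ∧ ∀ t : ℝ, gauge t X = X}
  add_mem' hX hY := ⟨add_mem hX.1 hY.1, fun t => by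
    conv_rhs => rw [← hX.2 t, ← hY.2 t]
    simp only [gauge, mul_add, add_mul]⟩
  zero_mem' := ⟨zero_mem T, fun t => by simp [gauge]⟩
  mul_mem' hX hY := ⟨mul_mem hX.1 hY.1, fun t => by rw [gauge_mul, hX.2, hY.2]⟩
  smul_mem' c X hX := ⟨SMulMemClass.smul_mem c hX.1, fun t => by
    conv_rhs => rw [← hX.2 t]
    simp only [gauge, mul_smul_comm, smul_mul_assoc]⟩
  star_mem' {X} hX := ⟨star_mem hX.1, fun t => by
    conv_rhs => rw [← hX.2 t]
    simp only [gauge, star_mul, star_star, mul_assoc]⟩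

end Fock

/-- The C⋆-subalgebra generated by a subset of a C⋆-algebra. -/
def cstarGen {A : Type*} [NonUnitalCStarAlgebra A] (s : Set A) : NonUnitalStarSubalgebra ℂ A :=
  (NonUnitalStarAlgebra.adjoin ℂ s).topologicalClosure

lemma isClosed_cstarGen {A : Type*} [NonUnitalCStarAlgebra A] (s : Set A) :
    IsClosed (cstarGen s : Set A) :=
  NonUnitalStarSubalgebra.isClosed_topologicalClosure _

lemma subset_cstarGen {A : Type*} [NonUnitalCStarAlgebra A] (s : Set A) : s ⊆ cstarGen s :=
  (NonUnitalStarAlgebra.subset_adjoin ℂ s).trans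
    (NonUnitalStarSubalgebra.le_topologicalClosure _)

/-- The corner `e S e`, for a projection `e` in a C⋆-subalgebra `S`. -/
def corner {A : Type*} [NonUnitalCStarAlgebra A] (S : NonUnitalStarSubalgebra ℂ A) (e : A)
    (he : e ∈ S) (hstar : star e = e) : NonUnitalStarSubalgebra ℂ A where
  carrier := {x | ∃ y ∈ S, x = e * y * e}
  add_mem' := by
    rintro _ _ ⟨x, hx, rfl⟩ ⟨y, hy, rfl⟩
    exact ⟨x + y, add_mem hx hy, by rw [mul_add, add_mul]⟩
  zero_mem' := ⟨0, zero_mem S, by simp⟩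
  mul_mem' := by
    rintro _ _ ⟨x, hx, rfl⟩ ⟨y, hy, rfl⟩
    exact ⟨x * e * (e * y), mul_mem (mul_mem hx he) (mul_mem he hy), by simp only [mul_assoc]⟩
  smul_mem' := by
    rintro c _ ⟨x, hx, rfl⟩
    exact ⟨c • x, SMulMemClass.smul_mem c hx, by rw [mul_smul_comm, smul_mul_assoc]⟩
  star_mem' := by
    rintro _ ⟨x, hx, rfl⟩
    exact ⟨star x, star_mem hx, by rw [star_mul, star_mul, hstar, mul_assoc]⟩

lemma isClosed_corner {A : Type*} [NonUnitalCStarAlgebra A] (S : NonUnitalStarSubalgebra ℂ A)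
    (e : A) (he : e ∈ S) (hstar : star e = e) (hidem : e * e = e) (hS : IsClosed (S : Set A)) :
    IsClosed (corner S e he hstar : Set A) := by
  have : (corner S e he hstar : Set A) = (S : Set A) ∩ {x | e * x * e = x} := by
    ext x
    constructor
    · rintro ⟨y, hy, rfl⟩
      refine ⟨mul_mem (mul_mem he hy) he, ?_⟩
      change e * (e * y * e) * e = e * y * e
      rw [← mul_assoc, ← mul_assoc, hidem, mul_assoc, hidem]
    · rintro ⟨hx, h⟩
      exact ⟨x, hx, h.symm⟩
  rw [this]
  exact hS.inter (isClosed_eq (by fun_prop) continuous_id)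

/-! ### Weight sequences and the weighted algebras -/

/-- A weight sequence: operators `Zₖ` on `(ℂᵈ)^{⊗ k}` with `Z₀ = I`, `supₖ ‖Zₖ‖ < ∞` and
`|Zₖ| ≥ ε I` for all `k ≥ 1` and some `ε > 0`. -/
structure WeightSequence (d : ℕ) where
  weight : ∀ k, TensorPow d k →L[ℂ] TensorPow d k
  weight_zero : weight 0 = 1
  bounded : ∃ C, ∀ k, ‖weight k‖ ≤ C
  bounded_below : ∃ ε : ℝ, 0 < ε ∧ ∀ k, 1 ≤ k →
    algebraMap ℝ (TensorPow d k →L[ℂ] TensorPow d k) ε ≤ CFC.abs (weight k)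

/-- The operator `I_p ⊗ T` on `(ℂᵈ)^{⊗ (p+k)} = (ℂᵈ)^{⊗ p} ⊗ (ℂᵈ)^{⊗ k}`. -/
def ampliation {d k : ℕ} (p : ℕ) (T : TensorPow d k →L[ℂ] TensorPow d k) :
    TensorPow d (p + k) →L[ℂ] TensorPow d (p + k) :=
  Matrix.toEuclideanCLM (n := Word d (p + k)) (𝕜 := ℂ)
    (Matrix.reindex (Fin.appendEquiv p k) (Fin.appendEquiv p k)
      ((1 : Matrix (Word d p) (Word d p) ℂ) ⊗ₖ
        (Matrix.toEuclideanCLM (n := Word d k) (𝕜 := ℂ)).symm T))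

namespace WeightSequence

variable {d : ℕ} (Z : WeightSequence d)

/-- Condition A(p): `lim_k ‖I_p ⊗ Z_k - Z_{p+k}‖ = 0`. -/
def ConditionA (p : ℕ) : Prop :=
  Tendsto (fun k => ‖ampliation p (Z.weight k) - Z.weight (p + k)‖) atTop (𝓝 0)

/-- The weight operator `Z = diag(Z₀, Z₁, …)` on the Fock space. -/
def op : Fock d →L[ℂ] Fock d := diag Z.weight Z.bounded

/-- The weighted Toeplitz algebra, generated by the weighted shifts `Wᵢ = Z Sᵢ`. -/
def weightedToeplitz : NonUnitalStarSubalgebra ℂ (Fock d →L[ℂ] Fock d) :=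
  cstarGen (Set.range fun i : Fin d => Z.op * creation i)

/-- The C⋆-algebra generated by `I`, `Z` and the creation operators `Sᵢ`.  It coincides with the
weighted Toeplitz algebra as soon as the latter contains all `Sᵢ`, for instance when all weights
are positive. -/
def extendedToeplitz : NonUnitalStarSubalgebra ℂ (Fock d →L[ℂ] Fock d) :=
  cstarGen ({1, Z.op} ∪ Set.range (creation (d := d)))

/-- `q(D)`, where `D` is the gauge fixed point algebra of `T` and `q` is the quotient map onto the
Calkin algebra. -/
def qD (T : NonUnitalStarSubalgebra ℂ (Fock d →L[ℂ] Fock d)) :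
    NonUnitalStarSubalgebra ℂ (Calkin (Fock d)) :=
  (gaugeFixed T).map (Calkin.mk (Fock d) : _ →⋆ₙₐ[ℂ] _)

/-- `u_α = u_{α₁} ⋯ u_{αₙ}` for a word `α`, where `uᵢ = q(Sᵢ)`. -/
def u (α : List (Fin d)) : Calkin (Fock d) :=
  (α.map fun i => Calkin.mk (Fock d) (creation i)).prod

/-- `z = q(Z)`. -/
def z : Calkin (Fock d) := Calkin.mk (Fock d) Z.op

/-- The C⋆-algebra `C₀` generated by all `u_α z^l u_β^*` with `l ≥ 0` and `|α| = |β| < p`. -/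
def C0 (p : ℕ) : NonUnitalStarSubalgebra ℂ (Calkin (Fock d)) :=
  cstarGen {x | ∃ (α β : List (Fin d)) (l : ℕ), α.length = β.length ∧ α.length < p ∧
    x = u α * Z.z ^ l * star (u β)}

lemma star_u_mul_self (α : List (Fin d)) : star (u α) * u α = 1 := by
  induction α with
  | nil => simp [u]
  | cons i α ih =>
    have h : star (Calkin.mk (Fock d) (creation i)) * Calkin.mk (Fock d) (creation i) = 1 := by
      rw [← map_star, ← map_mul, star_creation_mul_self, map_one]
    have hu : u (i :: α) = Calkin.mk (Fock d) (creation i) * u α := by simp [u]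
    rw [hu, star_mul, mul_assoc, ← mul_assoc _ _ (u α), h, one_mul, ih]

/-- The word `ξ_m = 1 1 ⋯ 1` of length `m`; the first of the `d` letters is `0 : Fin d`. -/
def xi (d m : ℕ) [NeZero d] : List (Fin d) := List.replicate m 0

variable [NeZero d]

lemma range_proj_mem_C0 {p : ℕ} (hp : 0 < p) :
    u (xi d (p - 1)) * star (u (xi d (p - 1))) ∈ Z.C0 p :=
  subset_cstarGen _ ⟨xi d (p - 1), xi d (p - 1), 0, rfl, by
    rw [xi, List.length_replicate]; omega, by rw [pow_zero, mul_one]⟩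

/-- The corner `C₀₀ = u_{ξ_q} u_{ξ_q}^* C₀ u_{ξ_q} u_{ξ_q}^*` of `C₀`, where `q = p - 1`. -/
def C00 (p : ℕ) (hp : 0 < p) : NonUnitalStarSubalgebra ℂ (Calkin (Fock d)) :=
  corner (Z.C0 p) (u (xi d (p - 1)) * star (u (xi d (p - 1)))) (Z.range_proj_mem_C0 hp)
    (by rw [star_mul, star_star])

instance isClosed_C00 (p : ℕ) (hp : 0 < p) : IsClosed (Z.C00 p hp : Set (Calkin (Fock d))) :=
  isClosed_corner _ _ _ _
    (by rw [mul_assoc, ← mul_assoc _ (u _) _, star_u_mul_self, one_mul])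
    (isClosed_cstarGen _)

end WeightSequence

end WeightedCuntz

end

/-! Modulo compact operators the `u_i` satisfy the Cuntz relations, because `1 - ∑ S_i S_i⋆` is the
vacuum projection. The matrix units `u_α u_β⋆` with `|α| = |β| = n` therefore span compatible copies
of `M_{dⁿ}`, and together they give a copy of the UHF algebra (`uhfEmbedding`).

Let `Φ(x) = ∑ u_i x u_i⋆`, so that `Φ(x) u_i = u_i x`. Condition A(p) says that, up to block
diagonal operators whose norms tend to zero (hence compact ones), `Z` has the form `I_p ⊗ Z_k`. So
`z` commutes with `u_α` for `|α| = p` (`z_mul_wordProd`), which means `Φ^p(z) = z`. By periodicity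
every `Φ^r(z)` lies in the range of every `Φ^n`, and the range of `Φ^n` commutes with the matrix
units of length `n`. Hence all `Φ^r(z)` commute with the UHF algebra.

Let `ξ` be the word `1⋯1` of length `p - 1`. The map `c ↦ u_ξ⋆ c u_ξ` embeds the corner `C₀₀` so
that its image commutes with the UHF algebra and contains `1` and all `Φ^r(z)`
(`iterate_calkinEnd_mem_range`). Multiplying the two commuting copies gives a map on the tensor
product. It is isometric for the maximal norm (`norm_prodHom`): on `M_{dⁿ} ⊗ B = M_{dⁿ}(B)` the
product map is injective, hence isometric, while every C⋆-seminorm is dominated by the matrix norm;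
such elements are dense.

The image lies in `q(D)`. Conversely, polynomials in the generators are sums of gauge-homogeneous
elements, and modulo compacts those of degree zero are combinations of `u_α u_β⋆ b` with `|α| = |β|`
and `b` in the embedded corner. Averaging over roots of unity keeps the degree zero part, so the
image is dense in `q(D)`; being closed, it is everything (`qD_subset_range_tensorEmbedding`).

For positive weights the first algebra equals the second: `∑ W_i W_i⋆` is the square of `Z` with its
vacuum block removed, its square root stays in the algebra, and a Neumann series recovers each `S_i`
from `W_i` (`creation_mem_weightedToeplitz`). -/

noncomputable section
open scoped TensorProduct Kronecker ComplexOrder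
open UniformSpace Filter Topology

namespace WeightedCuntz

/-! ### Ranges of `*`-homomorphisms -/

section Range

variable {A B : Type*} [NonUnitalCStarAlgebra A] [NonUnitalCStarAlgebra B]

lemma continuous_starHom (φ : A →⋆ₙₐ[ℂ] B) : Continuous φ :=
  AddMonoidHomClass.continuous_of_bound φ 1 fun a => by
    rw [one_mul]; exact NonUnitalStarAlgHom.norm_apply_le φ a

/-- The lift is `a` truncated to `[-r, r]` by functional calculus, with `r = ‖φ a‖`. The spectrum of
`φ a` already lies in that interval, so the truncation does not change the image. -/
lemma exists_isSelfAdjoint_lift_norm_le (φ : A →⋆ₙₐ[ℂ] B) {a : A} (ha : IsSelfAdjoint a) :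
    ∃ a', φ a' = φ a ∧ ‖a'‖ ≤ ‖φ a‖ := by
  set r := ‖φ a‖ with hr
  have hr0 : 0 ≤ r := norm_nonneg _
  let f : ℝ → ℝ := fun t => max (-r) (min r t)
  have hf : Continuous f := by fun_prop
  have hf0 : f 0 = 0 := by simp [f, hr0]
  have hφ : Continuous φ := continuous_starHom φ
  refine ⟨cfcₙ f a, ?_, ?_⟩
  · rw [NonUnitalStarAlgHomClass.map_cfcₙ (R := ℝ) (S := ℂ) φ f a hf.continuousOn hf0 hφ ha
      (ha.map φ)]
    conv_rhs => rw [← cfcₙ_id ℝ (φ a) (ha.map φ)]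
    refine cfcₙ_congr fun t ht => ?_
    have : ‖t‖ ≤ r := by
      have h := norm_apply_le_norm_cfcₙ (fun x : ℝ => x) (φ a) ht continuousOn_id rfl (ha.map φ)
      rwa [cfcₙ_id' ℝ (φ a) (ha.map φ)] at h
    rw [Real.norm_eq_abs, abs_le] at this
    simp [f, this.1, this.2]
  · refine norm_cfcₙ_le fun t _ => ?_
    rw [Real.norm_eq_abs, abs_le]
    exact ⟨le_max_left _ _, max_le (by linarith) (min_le_left _ _)⟩

/-- The factor 2 comes from lifting real and imaginary parts separately. Any uniform constant
suffices for the closed range argument. -/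
lemma exists_lift_norm_le (φ : A →⋆ₙₐ[ℂ] B) (a : A) : ∃ a', φ a' = φ a ∧ ‖a'‖ ≤ 2 * ‖φ a‖ := by
  obtain ⟨b, hb, hbn⟩ := exists_isSelfAdjoint_lift_norm_le φ (realPart a).2
  obtain ⟨c, hc, hcn⟩ := exists_isSelfAdjoint_lift_norm_le φ (imaginaryPart a).2
  have hre : φ (realPart a) = realPart (φ a) := map_realPart φ a
  have him : φ (imaginaryPart a) = imaginaryPart (φ a) := map_imaginaryPart φ a
  refine ⟨b + Complex.I • c, ?_, ?_⟩
  · rw [map_add, map_smul, hb, hc, ← map_smul, ← map_add, realPart_add_I_smul_imaginaryPart]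
  · rw [hre] at hbn
    rw [him] at hcn
    have h1 := realPart.norm_le (φ a)
    have h2 := imaginaryPart.norm_le (φ a)
    calc ‖b + Complex.I • c‖ ≤ ‖b‖ + ‖Complex.I • c‖ := norm_add_le _ _
      _ = ‖b‖ + ‖c‖ := by rw [norm_smul, Complex.norm_I, one_mul]
      _ ≤ ‖φ a‖ + ‖φ a‖ := add_le_add (hbn.trans h1) (hcn.trans h2)
      _ = 2 * ‖φ a‖ := by ring

/-- The range of a `*`-homomorphism between C⋆-algebras is closed. -/
theorem isClosed_range_starHom (φ : A →⋆ₙₐ[ℂ] B) : IsClosed (Set.range φ) := by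
  let f : NormedAddGroupHom A B :=
    { toFun := φ
      map_add' := map_add φ
      bound' := ⟨1, fun a => by rw [one_mul]; exact NonUnitalStarAlgHom.norm_apply_le φ a⟩ }
  have hf : f.SurjectiveOnWith f.range 2 := by
    rintro _ ⟨a, rfl⟩
    exact exists_lift_norm_le φ a
  -- A norm-controlled lifting on the range extends, by successive approximation in the complete
  -- space `A`, to a lifting on its closure.
  have := controlled_closure_of_complete (f := f) two_pos one_pos hf
  refine closure_subset_iff_isClosed.1 fun x hx => ?_
  obtain ⟨g, hg, -⟩ := this x hx
  exact ⟨g, hg⟩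

end Range

/-! ### Extension of `*`-homomorphisms to completions -/

namespace CStarSeminorm

variable {X : Type*} [NonUnitalRing X] [StarRing X] [Module ℂ X] (N : CStarSeminorm X)

namespace Completion

/-- The canonical map into the completion as a `*`-homomorphism. -/
def ofHom : X →⋆ₙₐ[ℂ] N.Completion where
  toFun := of N
  map_add' := of_add N
  map_zero' := of_zero N
  map_mul' := of_mul N
  map_smul' := of_smul N
  map_star' := of_star N

end Completion

lemma Completion.exists_norm_sub_lt (a : N.Completion) {ε : ℝ} (hε : 0 < ε) :
    ∃ x : X, ‖a - of N x‖ < ε := by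
  obtain ⟨x, hx⟩ := Metric.denseRange_iff.1 (isDenseInducing_of N).dense a ε hε
  exact ⟨x, by rwa [dist_eq_norm] at hx⟩

variable {B : Type*} [NonUnitalCStarAlgebra B]

/-- The C⋆-seminorm `x ↦ ‖f x‖` given by a `*`-homomorphism into a C⋆-algebra. -/
def ofStarHom (f : X →⋆ₙₐ[ℂ] B) : CStarSeminorm X where
  toSeminorm := Seminorm.of (fun x => ‖f x‖) (fun x y => by rw [map_add]; exact norm_add_le _ _)
    (fun c x => by rw [map_smul, norm_smul])
  mul_le' x y := by
    change ‖f (x * y)‖ ≤ ‖f x‖ * ‖f y‖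
    rw [map_mul]; exact norm_mul_le _ _
  star_mul_self' x := by
    change ‖f (star x * x)‖ = ‖f x‖ * ‖f x‖
    rw [map_mul, StarHomClass.map_star f]; exact CStarRing.norm_star_mul_self

lemma ofStarHom_apply (f : X →⋆ₙₐ[ℂ] B) (x : X) : ofStarHom f x = ‖f x‖ := rfl

namespace Completion

variable {N} (f : X →⋆ₙₐ[ℂ] B) (hf : ∀ x, ‖f x‖ = N x)

include hf in
lemma isometry_of_norm_eq : Isometry (fun x : N.Carrier => f x) := by
  refine Isometry.of_dist_eq fun x y => ?_
  rw [dist_eq_norm, dist_eq_norm, norm_def, ← hf]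
  exact congrArg norm (map_sub f (show X from x) (show X from y)).symm

/-- The extension of a `*`-homomorphism that is isometric for `N` as a function. -/
def extFun : N.Completion → B :=
  UniformSpace.Completion.extension (fun x : N.Carrier => f x)

lemma continuous_extFun : Continuous (extFun (N := N) f) :=
  UniformSpace.Completion.continuous_extension

include hf in
lemma extFun_of (x : X) : extFun f (of N x) = f x :=
  UniformSpace.Completion.extension_coe (isometry_of_norm_eq f hf).uniformContinuous x

include hf in
lemma extFun_add (a b : N.Completion) : extFun f (a + b) = extFun f a + extFun f b := by
  have hc := continuous_extFun (N := N) f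
  refine induction_on₂ a b (isClosed_eq (hc.comp continuous_add)
    ((hc.comp continuous_fst).add (hc.comp continuous_snd))) fun x y => ?_
  rw [← of_add, extFun_of f hf, extFun_of f hf, extFun_of f hf, map_add]

include hf in
lemma extFun_mul (a b : N.Completion) : extFun f (a * b) = extFun f a * extFun f b := by
  have hc := continuous_extFun (N := N) f
  refine induction_on₂ a b (isClosed_eq (hc.comp continuous_mul)
    ((hc.comp continuous_fst).mul (hc.comp continuous_snd))) fun x y => ?_
  rw [← of_mul, extFun_of f hf, extFun_of f hf, extFun_of f hf, map_mul]

include hf in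
lemma extFun_smul (c : ℂ) (a : N.Completion) : extFun f (c • a) = c • extFun f a := by
  have hc := continuous_extFun (N := N) f
  refine induction_on a (isClosed_eq (hc.comp (continuous_const_smul c))
    (hc.const_smul c)) fun x => ?_
  rw [← of_smul, extFun_of f hf, extFun_of f hf, map_smul]

include hf in
lemma extFun_star (a : N.Completion) : extFun f (star a) = star (extFun f a) := by
  have hc := continuous_extFun (N := N) f
  refine induction_on a (isClosed_eq (hc.comp (continuous_star' N))
    hc.star) fun x => ?_
  rw [← of_star, extFun_of f hf, extFun_of f hf, StarHomClass.map_star f]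

/-- The extension to the completion of a `*`-homomorphism that is isometric for `N`. -/
def extend : N.Completion →⋆ₙₐ[ℂ] B where
  toFun := extFun f
  map_add' := extFun_add f hf
  map_zero' := by rw [← of_zero, extFun_of f hf, map_zero]
  map_mul' := extFun_mul f hf
  map_smul' := extFun_smul f hf
  map_star' := extFun_star f hf

lemma extend_of (x : X) : extend f hf (of N x) = f x := extFun_of f hf x

lemma continuous_extend : Continuous (extend f hf) := continuous_extFun f

lemma norm_extend (a : N.Completion) : ‖extend f hf a‖ = ‖a‖ :=
  induction_on a (isClosed_eq (continuous_extend f hf).norm continuous_norm)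
    fun x => by rw [extend_of, hf, norm_of]

lemma extend_injective : Function.Injective (extend f hf) :=
  (AddMonoidHomClass.isometry_of_norm (extend f hf) (norm_extend f hf)).injective

lemma isClosed_range_extend : IsClosed (Set.range (extend f hf)) :=
  (AddMonoidHomClass.isometry_of_norm (extend f hf)
    (norm_extend f hf)).isClosedEmbedding.isClosed_range

/-- The range of the extension as a linear subspace. -/
def extendRange : Submodule ℂ B where
  carrier := Set.range (extend f hf)
  add_mem' := by
    rintro _ _ ⟨a, rfl⟩ ⟨b, rfl⟩
    exact ⟨a + b, map_add _ a b⟩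
  zero_mem' := ⟨0, map_zero _⟩
  smul_mem' := by
    rintro c _ ⟨a, rfl⟩
    exact ⟨c • a, map_smul _ c a⟩

lemma extend_mem {S : Set B} (hS : IsClosed S) (h : ∀ x, f x ∈ S) (a : N.Completion) :
    extend f hf a ∈ S :=
  induction_on a (hS.preimage (continuous_extend f hf)) fun x => by
    rw [extend_of]; exact h x

end Completion
end CStarSeminorm

/-! ### Maximal tensor products with approximately finite-dimensional algebras -/

section TensorEmbedding

variable {A B C : Type*} [NonUnitalCStarAlgebra A] [NonUnitalCStarAlgebra B]
  [NonUnitalCStarAlgebra C]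

/-- The linear map `a ⊗ b ↦ ι a * ρ b`. -/
def prodLin (ι : A →⋆ₙₐ[ℂ] C) (ρ : B →⋆ₙₐ[ℂ] C) : A ⊗[ℂ] B →ₗ[ℂ] C :=
  TensorProduct.lift (LinearMap.mk₂ ℂ (fun a b => ι a * ρ b)
    (fun a a' b => by rw [map_add, add_mul]) (fun c a b => by rw [map_smul, smul_mul_assoc])
    (fun a b b' => by rw [map_add, mul_add]) (fun c a b => by rw [map_smul, mul_smul_comm]))

lemma prodLin_tmul (ι : A →⋆ₙₐ[ℂ] C) (ρ : B →⋆ₙₐ[ℂ] C) (a : A) (b : B) :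
    prodLin ι ρ (a ⊗ₜ b) = ι a * ρ b := by simp [prodLin]

/-- The `*`-homomorphism `a ⊗ b ↦ ι a * ρ b` given by two `*`-homomorphisms with commuting
ranges. -/
def prodHom (ι : A →⋆ₙₐ[ℂ] C) (ρ : B →⋆ₙₐ[ℂ] C) (h : ∀ a b, ι a * ρ b = ρ b * ι a) :
    A ⊗[ℂ] B →⋆ₙₐ[ℂ] C :=
  let f := prodLin ι ρ
  have hf := prodLin_tmul ι ρ
  { f with
    map_zero' := map_zero f
    map_mul' := fun x y => by
      change f (x * y) = f x * f y
      induction x with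
      | zero => simp
      | add x₁ x₂ h₁ h₂ => rw [add_mul, map_add, h₁, h₂, map_add, add_mul]
      | tmul a b =>
        induction y with
        | zero => simp
        | add y₁ y₂ h₁ h₂ => rw [mul_add, map_add, h₁, h₂, map_add, mul_add]
        | tmul c e =>
          rw [Algebra.TensorProduct.tmul_mul_tmul, hf, hf, hf, map_mul, map_mul, mul_assoc,
            mul_assoc, ← mul_assoc (ι c), h c b, mul_assoc]
    map_star' := fun x => by
      change f (star x) = star (f x)
      induction x with
      | zero => simp
      | add x₁ x₂ h₁ h₂ => rw [star_add, map_add, h₁, h₂, map_add, star_add]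
      | tmul a b =>
        rw [TensorProduct.star_tmul, hf, hf, star_mul, StarHomClass.map_star ι,
          StarHomClass.map_star ρ, ← StarHomClass.map_star ι, ← StarHomClass.map_star ρ, h] }

@[simp]
lemma prodHom_tmul (ι : A →⋆ₙₐ[ℂ] C) (ρ : B →⋆ₙₐ[ℂ] C) (h : ∀ a b, ι a * ρ b = ρ b * ι a)
    (a : A) (b : B) : prodHom ι ρ h (a ⊗ₜ b) = ι a * ρ b :=
  prodLin_tmul ι ρ a b

/-- A system of matrix units indexed by `W`. -/
structure IsMatrixUnits {W : Type*} [DecidableEq W] (E : W → W → A) : Prop where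
  mul : ∀ i j k l, E i j * E k l = if j = k then E i l else 0
  star : ∀ i j, star (E i j) = E j i

variable {W : Type*} [Fintype W] [DecidableEq W] {E : W → W → A}

/-- The `*`-homomorphism `(bᵢⱼ) ↦ ∑ Eᵢⱼ ⊗ bᵢⱼ`. -/
def matrixTensorHom (B : Type*) [NonUnitalCStarAlgebra B] (hE : IsMatrixUnits E) :
    CStarMatrix W W B →⋆ₙₐ[ℂ] A ⊗[ℂ] B where
  toFun m := ∑ i, ∑ j, E i j ⊗ₜ[ℂ] m i j
  map_smul' c m := by
    simp only [CStarMatrix.smul_apply, TensorProduct.tmul_smul, Finset.smul_sum]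
    rfl
  map_zero' := by simp
  map_add' m m' := by
    simp only [CStarMatrix.add_apply, TensorProduct.tmul_add, Finset.sum_add_distrib]
  map_mul' m m' := by
    have key : ∀ i k, (∑ j, E i j ⊗ₜ[ℂ] m i j) * (∑ j, E k j ⊗ₜ[ℂ] m' k j) =
        ∑ j, E i j ⊗ₜ[ℂ] (m i k * m' k j) := fun i k => by
      rw [Finset.sum_mul_sum, Finset.sum_eq_single k]
      · simp only [Algebra.TensorProduct.tmul_mul_tmul, hE.mul, if_true]
      · intro j _ hj
        simp only [Algebra.TensorProduct.tmul_mul_tmul, hE.mul, if_neg hj,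
          TensorProduct.zero_tmul, Finset.sum_const_zero]
      · simp
    rw [Finset.sum_mul_sum]
    simp only [key, CStarMatrix.mul_apply, TensorProduct.tmul_sum]
    exact Finset.sum_congr rfl fun i _ => Finset.sum_comm
  map_star' m := by
    simp only [star_sum, TensorProduct.star_tmul, hE.star, CStarMatrix.star_apply]
    rw [Finset.sum_comm]

lemma matrixTensorHom_apply (hE : IsMatrixUnits E) (m : CStarMatrix W W B) :
    matrixTensorHom B hE m = ∑ i, ∑ j, E i j ⊗ₜ[ℂ] m i j := rfl

/-- Sandwiching between `E k i` and `E j k` kills every term except the entry `(i, j)` and moves it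
to the diagonal place `k`; the factor from `ρ` passes through by commutation. Summing over `k`
isolates `ρ (m i j)` once the diagonal units add up to `1`. -/
lemma mul_prodHom_matrixTensorHom_mul {ι : A →⋆ₙₐ[ℂ] C} {ρ : B →⋆ₙₐ[ℂ] C}
    (h : ∀ a b, ι a * ρ b = ρ b * ι a) (hE : IsMatrixUnits E) (m : CStarMatrix W W B)
    (i j k : W) :
    ι (E k i) * prodHom ι ρ h (matrixTensorHom B hE m) * ι (E j k) = ι (E k k) * ρ (m i j) := by
  have key : ∀ i' j', ι (E k i) * (ι (E i' j') * ρ (m i' j')) * ι (E j k) =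
      if i = i' then if j' = j then ι (E k k) * ρ (m i' j') else 0 else 0 := fun i' j' => by
    rw [mul_assoc, mul_assoc (ι (E i' j')), ← h, ← mul_assoc (ι (E i' j')), ← map_mul,
      ← mul_assoc, ← map_mul, hE.mul]
    by_cases h1 : j' = j
    · rw [if_pos h1, if_pos h1, hE.mul]
      by_cases h2 : i = i'
      · rw [if_pos h2, if_pos h2]
      · rw [if_neg h2, if_neg h2, map_zero, zero_mul]
    · rw [if_neg h1, if_neg h1, mul_zero, map_zero, zero_mul, ite_self]
  rw [matrixTensorHom_apply, map_sum, Finset.mul_sum, Finset.sum_mul]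
  simp only [map_sum, prodHom_tmul, Finset.mul_sum, Finset.sum_mul, key]
  simp

end TensorEmbedding

/-! ### Isometry of the product map for the maximal C⋆-norm -/

section TensorIsometry

variable {A B C : Type*} [NonUnitalCStarAlgebra A] [NonUnitalCStarAlgebra B] [CStarAlgebra C]
  {ι : A →⋆ₙₐ[ℂ] C} {ρ : B →⋆ₙₐ[ℂ] C} (h : ∀ a b, ι a * ρ b = ρ b * ι a)

lemma prodHom_matrixTensorHom_injective {W : Type*} [Fintype W] [DecidableEq W] {E : W → W → A}
    (hE : IsMatrixUnits E) (hE1 : ∑ i, ι (E i i) = 1) (hρ : Function.Injective ρ) :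
    Function.Injective ((prodHom ι ρ h).comp (matrixTensorHom B hE)) := by
  rw [injective_iff_map_eq_zero]
  intro m hm
  refine CStarMatrix.ext fun i j => hρ ?_
  rw [CStarMatrix.zero_apply, map_zero, ← one_mul (ρ (m i j)), ← hE1, Finset.sum_mul]
  refine Finset.sum_eq_zero fun k _ => ?_
  rw [← mul_prodHom_matrixTensorHom_mul h hE m i j k]
  have : prodHom ι ρ h (matrixTensorHom B hE m) = 0 := hm
  rw [this, mul_zero, zero_mul]

attribute [local instance] CStarAlgebra.spectralOrder CStarAlgebra.spectralOrderedRing in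
/-- On matrices over `B` every C⋆-seminorm is dominated by the norm of `C`. -/
lemma seminorm_matrixTensorHom_le {W : Type*} [Fintype W] [DecidableEq W] {E : W → W → A}
    (hE : IsMatrixUnits E) (hE1 : ∑ i, ι (E i i) = 1) (hρ : Function.Injective ρ)
    (N : CStarSeminorm (A ⊗[ℂ] B)) (m : CStarMatrix W W B) :
    N (matrixTensorHom B hE m) ≤ ‖prodHom ι ρ h (matrixTensorHom B hE m)‖ := by
  -- Both sides are compared with the C⋆-norm of the matrix algebra over `B`: the injective map to
  -- `C` is isometric, and the map to the completion for `N` is contractive.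
  have h1 := NonUnitalStarAlgHom.norm_map _ (prodHom_matrixTensorHom_injective h hE hE1 hρ) m
  have h2 := NonUnitalStarAlgHom.norm_apply_le
    ((CStarSeminorm.Completion.ofHom N).comp (matrixTensorHom B hE)) m
  have h3 : ‖((CStarSeminorm.Completion.ofHom N).comp (matrixTensorHom B hE)) m‖ =
    N (matrixTensorHom B hE m) := CStarSeminorm.Completion.norm_of N _
  rw [h3, ← h1] at h2
  exact h2

variable {W : ℕ → Type*} [∀ n, Fintype (W n)] [∀ n, DecidableEq (W n)]
  {E : ∀ n, W n → W n → A}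

/-- The estimate is uniform in `N` because all members of `TensorSeminorm` obey the same cross-norm
bound. It is asked for all large `n` so that two summands can be approximated at a common level. -/
lemma exists_matrixTensorHom_approx (hE : ∀ n, IsMatrixUnits (E n))
    (hA : ∀ a : A, ∀ ε > 0, ∃ n₀, ∀ n ≥ n₀, ∃ c : W n → W n → ℂ,
      ‖a - ∑ i, ∑ j, c i j • E n i j‖ ≤ ε) (x : A ⊗[ℂ] B) :
    ∀ ε > 0, ∃ n₀, ∀ n ≥ n₀, ∃ m : CStarMatrix (W n) (W n) B,
      ∀ N : TensorSeminorm A B, N.1 (x - matrixTensorHom B (hE n) m) ≤ ε := by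
  induction x with
  | zero => exact fun ε hε => ⟨0, fun n _ => ⟨0, fun N => by simpa using hε.le⟩⟩
  | tmul a b =>
    intro ε hε
    obtain ⟨n₀, hn₀⟩ := hA a (ε / (‖b‖ + 1)) (by positivity)
    refine ⟨n₀, fun n hn => ?_⟩
    obtain ⟨c, hc⟩ := hn₀ n hn
    refine ⟨CStarMatrix.ofMatrix (Matrix.of fun i j => c i j • b), fun N => ?_⟩
    have : a ⊗ₜ[ℂ] b - matrixTensorHom B (hE n) (CStarMatrix.ofMatrix
        (Matrix.of fun i j => c i j • b)) = (a - ∑ i, ∑ j, c i j • E n i j) ⊗ₜ[ℂ] b := by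
      rw [matrixTensorHom_apply, TensorProduct.sub_tmul, TensorProduct.sum_tmul]
      simp only [TensorProduct.sum_tmul, CStarMatrix.ofMatrix_apply, Matrix.of_apply,
        TensorProduct.tmul_smul, TensorProduct.smul_tmul']
    rw [this]
    refine (N.2 _ _).trans ?_
    calc _ ≤ ε / (‖b‖ + 1) * (‖b‖ + 1) := by gcongr; linarith
      _ = ε := by field_simp
  | add x y hx hy =>
    intro ε hε
    obtain ⟨n₁, h₁⟩ := hx (ε / 2) (half_pos hε)
    obtain ⟨n₂, h₂⟩ := hy (ε / 2) (half_pos hε)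
    refine ⟨max n₁ n₂, fun n hn => ?_⟩
    obtain ⟨m, hm⟩ := h₁ n (le_of_max_le_left hn)
    obtain ⟨m', hm'⟩ := h₂ n (le_of_max_le_right hn)
    refine ⟨m + m', fun N => ?_⟩
    rw [map_add, add_sub_add_comm]
    exact (map_add_le_add N.1 _ _).trans ((add_le_add (hm N) (hm' N)).trans_eq (add_halves ε))

/-- If `A` is approximated by finite-dimensional matrix algebras, then `a ⊗ b ↦ ι a * ρ b` is
isometric for the maximal C⋆-norm. -/
theorem norm_prodHom (hE : ∀ n, IsMatrixUnits (E n)) (hE1 : ∀ n, ∑ i, ι (E n i i) = 1)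
    (hA : ∀ a : A, ∀ ε > 0, ∃ n₀, ∀ n ≥ n₀, ∃ c : W n → W n → ℂ,
      ‖a - ∑ i, ∑ j, c i j • E n i j‖ ≤ ε)
    (hρ : Function.Injective ρ) (x : A ⊗[ℂ] B) :
    ‖prodHom ι ρ h x‖ = maxCStarSeminorm A B x := by
  -- The norm pulled back from `C` is one of the seminorms in the supremum, which gives one
  -- inequality. It is also used below to control the approximation error in `C`.
  let M : TensorSeminorm A B := ⟨CStarSeminorm.ofStarHom (prodHom ι ρ h), fun a b => by
    rw [CStarSeminorm.ofStarHom_apply, prodHom_tmul]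
    exact (norm_mul_le _ _).trans (mul_le_mul (NonUnitalStarAlgHom.norm_apply_le ι a)
      (NonUnitalStarAlgHom.norm_apply_le ρ b) (norm_nonneg _) (norm_nonneg _))⟩
  refine le_antisymm (le_ciSup (TensorSeminorm.bddAbove x) M) (ciSup_le fun N => ?_)
  refine le_of_forall_pos_le_add fun ε hε => ?_
  obtain ⟨n, hn⟩ := exists_matrixTensorHom_approx hE hA x (ε / 2) (half_pos hε)
  obtain ⟨m, hm⟩ := hn n le_rfl
  set y := matrixTensorHom B (hE n) m with hy
  have h1 : N.1 x ≤ N.1 (x - y) + N.1 y := by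
    simpa using map_add_le_add N.1 (x - y) y
  have h2 : N.1 y ≤ ‖prodHom ι ρ h y‖ := seminorm_matrixTensorHom_le h (hE n) (hE1 n) hρ N.1 m
  have h3 : ‖prodHom ι ρ h y‖ ≤ ‖prodHom ι ρ h (x - y)‖ + ‖prodHom ι ρ h x‖ := by
    rw [map_sub, norm_sub_rev]
    simpa using norm_add_le (prodHom ι ρ h y - prodHom ι ρ h x) (prodHom ι ρ h x)
  have h4 : ‖prodHom ι ρ h (x - y)‖ ≤ ε / 2 := hm M
  have h5 := hm N
  linarith

end TensorIsometry

/-! ### Embeddings of inductive limits -/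

section InductiveLimitEmbedding

variable {A : ℕ → Type*} [∀ n, CStarAlgebra (A n)] {φ : ∀ n, A n →⋆ₐ[ℂ] A (n + 1)}
  {C : Type*} [NonUnitalCStarAlgebra C] {θ : ∀ n, A n →⋆ₙₐ[ℂ] C}

lemma eventually_apply_eq (hθ : ∀ n a, θ (n + 1) (φ n a) = θ n a) (a : eventuallyCoherent φ) :
    ∃ c, ∀ᶠ n in atTop, θ n ((a : ∀ n, A n) n) = c := by
  obtain ⟨N, hN⟩ := a.2
  refine ⟨θ N ((a : ∀ n, A n) N), eventually_atTop.2 ⟨N, fun n hn => ?_⟩⟩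
  induction n, hn using Nat.le_induction with
  | base => rfl
  | succ n hn ih => rw [hN n hn, hθ, ih]

/-- The eventual value of `θₙ(aₙ)`. -/
def limitFun (hθ : ∀ n a, θ (n + 1) (φ n a) = θ n a) (a : eventuallyCoherent φ) : C :=
  (eventually_apply_eq hθ a).choose

lemma eventually_eq_limitFun (hθ : ∀ n a, θ (n + 1) (φ n a) = θ n a) (a : eventuallyCoherent φ) :
    ∀ᶠ n in atTop, θ n ((a : ∀ n, A n) n) = limitFun hθ a :=
  (eventually_apply_eq hθ a).choose_spec

lemma limitFun_eq (hθ : ∀ n a, θ (n + 1) (φ n a) = θ n a) {a : eventuallyCoherent φ} {c : C}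
    (h : ∀ᶠ n in atTop, θ n ((a : ∀ n, A n) n) = c) : limitFun hθ a = c := by
  obtain ⟨n, h1, h2⟩ := (h.and (eventually_eq_limitFun hθ a)).exists
  rw [← h1, h2]

/-- The `*`-homomorphism on eventually coherent sequences induced by a compatible family. -/
def limitHom (hθ : ∀ n a, θ (n + 1) (φ n a) = θ n a) : eventuallyCoherent φ →⋆ₙₐ[ℂ] C where
  toFun := limitFun hθ
  map_smul' c a := limitFun_eq hθ <| (eventually_eq_limitFun hθ a).mono fun n hn => by
    rw [← hn]; exact map_smul (θ n) c _
  map_zero' := limitFun_eq hθ <| Eventually.of_forall fun n => map_zero (θ n)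
  map_add' a b := limitFun_eq hθ <|
    ((eventually_eq_limitFun hθ a).and (eventually_eq_limitFun hθ b)).mono fun n hn => by
      rw [← hn.1, ← hn.2]; exact map_add (θ n) _ _
  map_mul' a b := limitFun_eq hθ <|
    ((eventually_eq_limitFun hθ a).and (eventually_eq_limitFun hθ b)).mono fun n hn => by
      rw [← hn.1, ← hn.2]; exact map_mul (θ n) _ _
  map_star' a := limitFun_eq hθ <| (eventually_eq_limitFun hθ a).mono fun n hn => by
    rw [← hn]; exact map_star (θ n) _

/-- Each injective `θ n` is isometric and `θ n (a n)` is eventually constant, so the sequence of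
norms defining the limit seminorm is eventually constant too. -/
lemma norm_limitHom (hθ : ∀ n a, θ (n + 1) (φ n a) = θ n a)
    (hinj : ∀ n, Function.Injective (θ n)) (a : eventuallyCoherent φ) :
    ‖limitHom hθ a‖ = limitSeminorm φ a := by
  refine tendsto_nhds_unique (tendsto_const_nhds.congr' ?_) (tendsto_norm_eventuallyCoherent φ a)
  refine (eventually_eq_limitFun hθ a).mono fun n hn => ?_
  exact (congrArg norm hn).symm.trans (NonUnitalStarAlgHom.norm_map (θ n) (hinj n) _)

/-- The embedding of the inductive limit induced by a compatible family of embeddings. -/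
def limitEmbedding (hθ : ∀ n a, θ (n + 1) (φ n a) = θ n a)
    (hinj : ∀ n, Function.Injective (θ n)) : CStarInductiveLimit φ →⋆ₙₐ[ℂ] C :=
  CStarSeminorm.Completion.extend (limitHom hθ) (norm_limitHom hθ hinj)

lemma limitEmbedding_injective (hθ : ∀ n a, θ (n + 1) (φ n a) = θ n a)
    (hinj : ∀ n, Function.Injective (θ n)) : Function.Injective (limitEmbedding hθ hinj) :=
  CStarSeminorm.Completion.extend_injective _ _

lemma exists_limitEmbedding_eq (hθ : ∀ n a, θ (n + 1) (φ n a) = θ n a)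
    (hinj : ∀ n, Function.Injective (θ n)) (n : ℕ) (m : A n) :
    ∃ y, limitEmbedding hθ hinj y = θ n m := by
  -- The element `m` sits in place `n`, is pushed forward by the connecting maps afterwards, and is
  -- preceded by zeros; coherence is only required eventually.
  let s : ∀ k, A k := fun k =>
    if h : n ≤ k then Nat.leRec (motive := fun k _ => A k) m (fun k _ a => φ k a) h else 0
  have hs : ∀ k ≥ n, s (k + 1) = φ k (s k) := fun k hk => by
    simp only [s, dif_pos hk, dif_pos (Nat.le_succ_of_le hk)]
    exact Nat.leRec_succ _ _ hk
  have hsn : s n = m := by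
    simp only [s, dif_pos le_rfl]
    exact Nat.leRec_self _ _
  refine ⟨CStarSeminorm.Completion.of _ (⟨s, n, hs⟩ : eventuallyCoherent φ), ?_⟩
  refine (CStarSeminorm.Completion.extend_of _ _ _).trans (limitFun_eq hθ ?_)
  refine eventually_atTop.2 ⟨n, fun k hk => ?_⟩
  change θ k (s k) = θ n m
  induction k, hk using Nat.le_induction with
  | base => rw [hsn]
  | succ k hk ih => rw [hs k hk, hθ, ih]

lemma exists_limitEmbedding_approx (hθ : ∀ n a, θ (n + 1) (φ n a) = θ n a)
    (hinj : ∀ n, Function.Injective (θ n)) (y : CStarInductiveLimit φ) {ε : ℝ} (hε : 0 < ε) :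
    ∃ n₀, ∀ n ≥ n₀, ∃ m : A n, ‖limitEmbedding hθ hinj y - θ n m‖ ≤ ε := by
  obtain ⟨a, ha⟩ := CStarSeminorm.Completion.exists_norm_sub_lt _ y hε
  obtain ⟨n₀, hn₀⟩ := eventually_atTop.1 (eventually_eq_limitFun hθ a)
  refine ⟨n₀, fun n hn => ⟨(a : ∀ n, A n) n, ?_⟩⟩
  have h1 : limitFun hθ a = limitEmbedding hθ hinj (CStarSeminorm.Completion.of _ a) :=
    (CStarSeminorm.Completion.extend_of (limitHom hθ) (norm_limitHom hθ hinj) _).symm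
  rw [hn₀ n hn, h1, ← map_sub, limitEmbedding, CStarSeminorm.Completion.norm_extend]
  exact ha.le

end InductiveLimitEmbedding

/-! ### Cuntz families -/

/-- Isometries `vᵢ` with `∑ vᵢ vᵢ⋆ = 1`. -/
structure IsCuntzFamily {d : ℕ} {C : Type*} [Ring C] [StarRing C] (v : Fin d → C) : Prop where
  star_mul_eq : ∀ i j, star (v i) * v j = if i = j then 1 else 0
  sum_mul_star : ∑ i, v i * star (v i) = 1

section Cuntz

variable {d : ℕ} {C : Type*} [CStarAlgebra C] {v : Fin d → C}

variable (v) in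
/-- The product `v_α` along a word. -/
def wordProd (α : List (Fin d)) : C := (α.map v).prod

@[simp] lemma wordProd_nil : wordProd v [] = 1 := by simp [wordProd]

lemma wordProd_cons (i : Fin d) (α : List (Fin d)) :
    wordProd v (i :: α) = v i * wordProd v α := by simp [wordProd]

lemma wordProd_append (α β : List (Fin d)) :
    wordProd v (α ++ β) = wordProd v α * wordProd v β := by simp [wordProd]

lemma IsCuntzFamily.star_wordProd_mul (hv : IsCuntzFamily v) :
    ∀ {α β : List (Fin d)}, α.length = β.length →
      star (wordProd v α) * wordProd v β = if α = β then 1 else 0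
  | [], [], _ => by simp
  | i :: α, j :: β, h => by
    have ih := hv.star_wordProd_mul (α := α) (β := β) (by simpa using h)
    rw [wordProd_cons, wordProd_cons, star_mul, mul_assoc, ← mul_assoc (star (v i)),
      hv.star_mul_eq]
    by_cases hij : i = j
    · simp [hij, ih]
    · simp [hij]

/-- The matrix unit `v_α v_β⋆`. -/
def matUnit (v : Fin d → C) (n : ℕ) (α β : Word d n) : C :=
  wordProd v (List.ofFn α) * star (wordProd v (List.ofFn β))

lemma IsCuntzFamily.isMatrixUnits (hv : IsCuntzFamily v) (n : ℕ) :
    IsMatrixUnits (matUnit v n) where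
  mul i j k l := by
    simp only [matUnit]
    rw [mul_assoc, ← mul_assoc (star _) _ (star _), hv.star_wordProd_mul (by simp)]
    simp only [List.ofFn_inj]
    split_ifs <;> simp
  star i j := by simp [matUnit]

lemma IsCuntzFamily.sum_matUnit (hv : IsCuntzFamily v) :
    ∀ n, ∑ α, matUnit v n α α = 1
  | 0 => by simp [matUnit]
  | n + 1 => by
    rw [← (Fin.consEquiv fun _ : Fin (n + 1) => Fin d).sum_comp, Fintype.sum_prod_type,
      ← hv.sum_mul_star]
    refine Finset.sum_congr rfl fun i _ => ?_
    have : ∀ α : Word d n, matUnit v (n + 1) (Fin.cons i α) (Fin.cons i α) =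
        v i * matUnit v n α α * star (v i) := fun α => by
      simp [matUnit, wordProd_cons, mul_assoc]
    simp only [Fin.consEquiv, Equiv.coe_fn_mk, this]
    rw [← Finset.sum_mul, ← Finset.mul_sum, hv.sum_matUnit n, mul_one]

/-- The representation of `M_{dⁿ}` given by a Cuntz family. -/
def matrixRep (hv : IsCuntzFamily v) (n : ℕ) :
    CStarMatrix (Word d n) (Word d n) ℂ →⋆ₙₐ[ℂ] C :=
  (prodHom (NonUnitalStarAlgHom.id ℂ C) ((StarAlgHom.ofId ℂ C : ℂ →⋆ₐ[ℂ] C) : ℂ →⋆ₙₐ[ℂ] C)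
    (fun a b => (Algebra.commutes b a).symm)).comp (matrixTensorHom ℂ (hv.isMatrixUnits n))

lemma matrixRep_apply (hv : IsCuntzFamily v) (n : ℕ) (m : CStarMatrix (Word d n) (Word d n) ℂ) :
    matrixRep hv n m = ∑ α, ∑ β, m α β • matUnit v n α β := by
  change prodHom _ _ (fun a b => (Algebra.commutes b a).symm)
    (matrixTensorHom ℂ (hv.isMatrixUnits n) m) = _
  rw [matrixTensorHom_apply, map_sum]
  refine Finset.sum_congr rfl fun α _ => ?_
  rw [map_sum]
  refine Finset.sum_congr rfl fun β _ => ?_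
  refine (prodHom_tmul _ _ _ _ _).trans ?_
  rw [Algebra.smul_def, Algebra.commutes]
  rfl

lemma matrixRep_injective [Nontrivial C] (hv : IsCuntzFamily v) (n : ℕ) :
    Function.Injective (matrixRep hv n) :=
  prodHom_matrixTensorHom_injective _ (hv.isMatrixUnits n) (hv.sum_matUnit n)
    (algebraMap ℂ C).injective

lemma matUnit_append (n k : ℕ) (α α' : Word d n) (β β' : Word d k) :
    matUnit v (n + k) (Fin.append α β) (Fin.append α' β') =
      wordProd v (List.ofFn α) * matUnit v k β β' * star (wordProd v (List.ofFn α')) := by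
  simp [matUnit, wordProd_append, mul_assoc]

lemma uhfMap_apply_append (n : ℕ) (m : CStarMatrix (Word d n) (Word d n) ℂ) (α α' : Word d n)
    (β β' : Word d 1) : uhfMap d n m (Fin.append α β) (Fin.append α' β') =
      m α α' * if β = β' then 1 else 0 := by
  have h1 : ∀ (α : Word d n) (β : Word d 1),
      (Fin.appendEquiv n 1).symm (Fin.append α β) = (α, β) := fun α β =>
    (Fin.appendEquiv n 1).symm_apply_apply (α, β)
  change (m ⊗ₖ (1 : Matrix (Word d 1) (Word d 1) ℂ)) ((Fin.appendEquiv n 1).symm (Fin.append α β))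
    ((Fin.appendEquiv n 1).symm (Fin.append α' β')) = _
  rw [h1, h1]
  rfl

/-- The extra letter introduced by `a ↦ a ⊗ 1` runs over diagonal matrix units only, and these sum
to `1`. -/
lemma matrixRep_uhfMap (hv : IsCuntzFamily v) (n : ℕ)
    (m : CStarMatrix (Word d n) (Word d n) ℂ) :
    matrixRep hv (n + 1) (uhfMap d n m) = matrixRep hv n m := by
  have hsum : ∀ f : Word d (n + 1) → C,
      ∑ w, f w = ∑ α : Word d n, ∑ β : Word d 1, f (Fin.append α β) := fun f => by
    rw [← (Fin.appendEquiv n 1).sum_comp, Fintype.sum_prod_type]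
    rfl
  rw [matrixRep_apply, matrixRep_apply, hsum]
  refine Finset.sum_congr rfl fun α _ => ?_
  simp only [hsum, uhfMap_apply_append, matUnit_append]
  rw [Finset.sum_comm]
  refine Finset.sum_congr rfl fun α' _ => ?_
  simp only [mul_ite, mul_one, mul_zero, ite_smul, zero_smul, Finset.sum_ite_eq,
    Finset.mem_univ, if_true]
  rw [← Finset.smul_sum, ← Finset.sum_mul, ← Finset.mul_sum, hv.sum_matUnit, mul_one]
  rfl

variable [Nontrivial C]

/-- The embedding of the UHF algebra given by a Cuntz family. -/
def uhfEmbedding (hv : IsCuntzFamily v) : UHF d →⋆ₙₐ[ℂ] C :=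
  limitEmbedding (matrixRep_uhfMap hv) (matrixRep_injective hv)

lemma uhfEmbedding_injective (hv : IsCuntzFamily v) : Function.Injective (uhfEmbedding hv) :=
  limitEmbedding_injective _ _

/-- Matrix units of the UHF algebra are obtained as preimages under the injective embedding, so
their relations can be checked in `C`. -/
lemma exists_uhfEmbedding_eq (hv : IsCuntzFamily v) (n : ℕ) (α β : Word d n) :
    ∃ y, uhfEmbedding hv y = matUnit v n α β := by
  obtain ⟨y, hy⟩ := exists_limitEmbedding_eq (matrixRep_uhfMap hv) (matrixRep_injective hv) n
    (CStarMatrix.ofMatrix (Matrix.single α β 1))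
  refine ⟨y, hy.trans ?_⟩
  rw [matrixRep_apply, Finset.sum_eq_single α, Finset.sum_eq_single β]
  · simp
  · intro b _ hb; simp [hb.symm]
  · simp
  · intro a _ ha; simp [ha.symm]
  · simp

/-- The matrix units of the UHF algebra. -/
def uhfUnit (hv : IsCuntzFamily v) (n : ℕ) (α β : Word d n) : UHF d :=
  (exists_uhfEmbedding_eq hv n α β).choose

lemma uhfEmbedding_uhfUnit (hv : IsCuntzFamily v) (n : ℕ) (α β : Word d n) :
    uhfEmbedding hv (uhfUnit hv n α β) = matUnit v n α β :=
  (exists_uhfEmbedding_eq hv n α β).choose_spec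

lemma isMatrixUnits_uhfUnit (hv : IsCuntzFamily v) (n : ℕ) : IsMatrixUnits (uhfUnit hv n) where
  mul i j k l := uhfEmbedding_injective hv <| by
    rw [map_mul, uhfEmbedding_uhfUnit, uhfEmbedding_uhfUnit, (hv.isMatrixUnits n).mul]
    split_ifs
    · rw [uhfEmbedding_uhfUnit]
    · rw [map_zero]
  star i j := uhfEmbedding_injective hv <| by
    rw [StarHomClass.map_star (uhfEmbedding hv), uhfEmbedding_uhfUnit, uhfEmbedding_uhfUnit,
      (hv.isMatrixUnits n).star]

lemma exists_uhfUnit_approx (hv : IsCuntzFamily v) (a : UHF d) (ε : ℝ) (hε : ε > 0) :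
    ∃ n₀, ∀ n ≥ n₀, ∃ c : Word d n → Word d n → ℂ,
      ‖a - ∑ i, ∑ j, c i j • uhfUnit hv n i j‖ ≤ ε := by
  obtain ⟨n₀, h⟩ := exists_limitEmbedding_approx (matrixRep_uhfMap hv) (matrixRep_injective hv)
    a hε
  refine ⟨n₀, fun n hn => ?_⟩
  obtain ⟨m, hm⟩ := h n hn
  refine ⟨fun i j => m i j, ?_⟩
  rw [← NonUnitalStarAlgHom.norm_map _ (uhfEmbedding_injective hv), map_sub]
  rw [matrixRep_apply] at hm
  simp only [map_sum, map_smul, uhfEmbedding_uhfUnit]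
  exact hm

/-- A set that contains all matrix units contains the UHF algebra. -/
lemma uhfEmbedding_mem (hv : IsCuntzFamily v) {S : NonUnitalStarSubalgebra ℂ C}
    (hS : IsClosed (S : Set C)) (h : ∀ n α β, matUnit v n α β ∈ S) (a : UHF d) :
    uhfEmbedding hv a ∈ S := by
  rw [← SetLike.mem_coe, ← hS.closure_eq]
  refine Metric.mem_closure_iff.2 fun ε hε => ?_
  obtain ⟨n, hn⟩ := exists_limitEmbedding_approx (matrixRep_uhfMap hv) (matrixRep_injective hv)
    a (half_pos hε)
  obtain ⟨m, hm⟩ := hn n le_rfl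
  refine ⟨matrixRep hv n m, ?_, ?_⟩
  · rw [matrixRep_apply]
    exact sum_mem fun α _ => sum_mem fun β _ => SMulMemClass.smul_mem _ (h n α β)
  · rw [dist_eq_norm]
    exact hm.trans_lt (half_lt_self hε)

/-! ### The tensor product with the UHF algebra inside an algebra with a Cuntz family -/

section Tensor

variable (hv : IsCuntzFamily v) {B : Type*} [NonUnitalCStarAlgebra B] {ρ : B →⋆ₙₐ[ℂ] C}
  (hρ : Function.Injective ρ) (hc : ∀ a b, uhfEmbedding hv a * ρ b = ρ b * uhfEmbedding hv a)

include hρ in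
lemma norm_prodHom_uhfEmbedding (x : UHF d ⊗[ℂ] B) :
    ‖prodHom (A := UHF d) (uhfEmbedding hv) ρ hc x‖ = maxCStarSeminorm (UHF d) B x :=
  norm_prodHom (A := UHF d) (W := Word d) (E := uhfUnit hv) hc (isMatrixUnits_uhfUnit hv)
    (fun n => by simp only [uhfEmbedding_uhfUnit, hv.sum_matUnit]) (exists_uhfUnit_approx hv) hρ x

/-- If `ρ` is an embedding whose range commutes with all matrix units of a Cuntz family, then the
maximal tensor product `M_{d^∞} ⊗ B` embeds. -/
def uhfTensorEmbedding : CStarTensor (UHF d) B →⋆ₙₐ[ℂ] C :=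
  CStarSeminorm.Completion.extend (prodHom (A := UHF d) (uhfEmbedding hv) ρ hc)
    (norm_prodHom_uhfEmbedding hv hρ hc)

lemma uhfTensorEmbedding_injective : Function.Injective (uhfTensorEmbedding hv hρ hc) :=
  CStarSeminorm.Completion.extend_injective _ (norm_prodHom_uhfEmbedding hv hρ hc)

lemma matUnit_mul_mem_range_uhfTensorEmbedding (n : ℕ) (α β : Word d n) (b : B) :
    matUnit v n α β * ρ b ∈ Set.range (uhfTensorEmbedding hv hρ hc) := by
  refine ⟨CStarSeminorm.Completion.of _ (uhfUnit hv n α β ⊗ₜ[ℂ] b), ?_⟩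
  rw [uhfTensorEmbedding, CStarSeminorm.Completion.extend_of, prodHom_tmul, uhfEmbedding_uhfUnit]

lemma isClosed_range_uhfTensorEmbedding : IsClosed (Set.range (uhfTensorEmbedding hv hρ hc)) :=
  CStarSeminorm.Completion.isClosed_range_extend _ (norm_prodHom_uhfEmbedding hv hρ hc)

/-- The range of the embedding of `M_{d^∞} ⊗ B` as a linear subspace. -/
def uhfTensorRange : Submodule ℂ C :=
  CStarSeminorm.Completion.extendRange (X := UHF d ⊗[ℂ] B) (N := maxCStarSeminorm (UHF d) B) _
    (norm_prodHom_uhfEmbedding hv hρ hc)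

lemma mem_uhfTensorRange {x : C} :
    x ∈ uhfTensorRange hv hρ hc ↔ x ∈ Set.range (uhfTensorEmbedding hv hρ hc) := Iff.rfl

lemma uhfTensorEmbedding_mem {S : NonUnitalStarSubalgebra ℂ C} (hS : IsClosed (S : Set C))
    (h1 : ∀ n α β, matUnit v n α β ∈ S) (h2 : ∀ b, ρ b ∈ S) (x : CStarTensor (UHF d) B) :
    uhfTensorEmbedding hv hρ hc x ∈ S := by
  refine CStarSeminorm.Completion.extend_mem _ (norm_prodHom_uhfEmbedding hv hρ hc) hS
    (fun x => ?_) x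
  induction x with
  | zero => rw [map_zero]; exact zero_mem S
  | add x y hx hy => rw [map_add]; exact add_mem hx hy
  | tmul a c =>
    rw [prodHom_tmul]
    exact mul_mem (uhfEmbedding_mem _ hS h1 a) (h2 c)

end Tensor

end Cuntz

/-! ### Operators on the Fock space in coordinates -/

section FockOperators

variable {d : ℕ}

/-- The coordinate of a Fock space vector at a word. -/
def coord (x : Fock d) (l : List (Fin d)) : ℂ := x l.length l.get

/-- Indexing coordinates by lists lets words be concatenated without transporting along equalities
of lengths. The auxiliary claim keeps `k` variable so that the equality with the list length can be
substituted. -/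
lemma apply_eq_coord (x : Fock d) (k : ℕ) (w : Word d k) : x k w = coord x (List.ofFn w) := by
  have : ∀ (l : List (Fin d)) (h : k = l.length), (∀ i, w i = l.get (i.cast h)) →
      x k w = coord x l := by
    rintro l rfl hw
    rw [coord, show w = l.get from funext hw]
  exact this _ (by simp) fun i => by simp

lemma coord_creation_cons (i j : Fin d) (x : Fock d) (l : List (Fin d)) :
    coord (creation i x) (j :: l) = if j = i then coord x l else 0 := rfl

lemma coord_wordProd_append (x : Fock d) (l : List (Fin d)) :
    ∀ {α β : List (Fin d)}, β.length = α.length →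
      coord (wordProd creation α x) (β ++ l) = if β = α then coord x l else 0
  | [], [], _ => by simp
  | i :: α, j :: β, h => by
    rw [wordProd_cons, List.cons_append]
    change coord (creation i (wordProd creation α x)) (j :: (β ++ l)) = _
    rw [coord_creation_cons, coord_wordProd_append x l (by simpa using h)]
    by_cases hij : j = i <;> simp [hij]

lemma coord_wordProd_eq_zero (x : Fock d) :
    ∀ {α l : List (Fin d)}, l.length < α.length → coord (wordProd creation α x) l = 0
  | i :: α, [], _ => by
    rw [wordProd_cons]; rfl
  | i :: α, j :: l, h => by
    rw [wordProd_cons]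
    change coord (creation i (wordProd creation α x)) (j :: l) = _
    rw [coord_creation_cons, coord_wordProd_eq_zero x (by simpa using h), ite_self]

lemma wordProd_creation_apply_append {p m : ℕ} {α : List (Fin d)} (hα : α.length = p) (x : Fock d)
    (a : Word d p) (b : Word d m) :
    wordProd creation α x (p + m) (Fin.append a b) = if List.ofFn a = α then x m b else 0 := by
  rw [apply_eq_coord, List.ofFn_fin_append, coord_wordProd_append _ _ (by simp [hα]),
    apply_eq_coord]

lemma wordProd_creation_apply_eq_zero {k : ℕ} {α : List (Fin d)} (hα : k < α.length)
    (x : Fock d) : wordProd creation α x k = 0 := by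
  ext w
  rw [apply_eq_coord, coord_wordProd_eq_zero _ (by simpa using hα)]
  rfl

/-- The basis vector of the Fock space at a word. -/
def basisVec {k : ℕ} (w : Word d k) : Fock d := lp.single 2 k (EuclideanSpace.single w 1)

lemma inner_basisVec {k : ℕ} (w : Word d k) (x : Fock d) :
    inner ℂ (basisVec w) x = x k w := by
  rw [basisVec, lp.inner_single_left, EuclideanSpace.inner_single_left]
  simp

lemma creation_basisVec (i : Fin d) {k : ℕ} (w : Word d k) :
    creation i (basisVec w) = basisVec (Fin.cons i w : Word d (k + 1)) := by
  ext m : 2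
  cases m with
  | zero => exact (lp.single_apply_ne _ _ _ (Nat.succ_ne_zero k).symm).symm
  | succ m =>
    rw [creation_apply_succ]
    by_cases h : m = k
    · subst h
      simp only [basisVec, lp.single_apply_self]
      ext w'
      obtain ⟨j, w'', rfl⟩ : ∃ j w'', w' = Fin.cons j w'' := ⟨_, _, (Fin.cons_self_tail w').symm⟩
      simp only [tensorLeft, LinearMap.coe_mk, AddHom.coe_mk, Fin.cons_zero, Fin.tail_cons,
        PiLp.single_apply, Fin.cons_inj]
      by_cases h1 : j = i <;> by_cases h2 : w'' = w <;> simp [h1, h2]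
    · rw [basisVec, basisVec, lp.single_apply_ne _ _ _ h, map_zero,
        lp.single_apply_ne _ _ _ (by omega)]

lemma star_creation_apply (i : Fin d) (x : Fock d) (k : ℕ) (w : Word d k) :
    star (creation i) x k w = x (k + 1) (Fin.cons i w) := by
  rw [← inner_basisVec, ContinuousLinearMap.star_eq_adjoint, ContinuousLinearMap.adjoint_inner_right,
    creation_basisVec, inner_basisVec]

lemma star_creation_mul (i j : Fin d) :
    star (creation i) * creation j = if i = j then (1 : Fock d →L[ℂ] Fock d) else 0 := by
  ext x k w
  change star (creation i) (creation j x) k w = _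
  rw [star_creation_apply, creation_apply_succ]
  split_ifs with h
  · simp [tensorLeft, h]
  · simp [tensorLeft, h]

/-- The projection onto the vacuum. -/
def vacuumProj (d : ℕ) : Fock d →L[ℂ] Fock d :=
  diag (fun k => if k = 0 then 1 else 0) ⟨1, fun k => by
    split_ifs
    · exact ContinuousLinearMap.norm_id_le
    · simp⟩

/-- `S_i S_i⋆` projects onto the words beginning with `i`; every nonempty word has exactly one first
letter, so only the vacuum is missed. -/
lemma sum_creation_mul_star_add_vacuumProj :
    ∑ i : Fin d, creation i * star (creation i) + vacuumProj d = 1 := by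
  ext x k w
  rw [add_apply, sum_apply, lp.coeFn_add, Pi.add_apply,
    lp.coeFn_sum, Finset.sum_apply]
  cases k with
  | zero =>
    simp [vacuumProj]
  | succ k =>
    have : ∀ i : Fin d, (creation i * star (creation i)) x (k + 1) w =
        if w 0 = i then x (k + 1) w else 0 := fun i => by
      change (if w 0 = i then star (creation i) x k (Fin.tail w) else 0) = _
      split_ifs with h
      · rw [star_creation_apply, ← h, Fin.cons_self_tail]
      · rfl
    simp only [PiLp.add_apply, WithLp.ofLp_sum, Finset.sum_apply, this]
    simp [vacuumProj]

/-! ### Block diagonal compact operators -/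

lemma norm_diag_le {T : ∀ k, TensorPow d k →L[ℂ] TensorPow d k} (hT : ∃ C, ∀ k, ‖T k‖ ≤ C)
    {C : ℝ} (hC : ∀ k, ‖T k‖ ≤ C) : ‖diag T hT‖ ≤ C := by
  have hC0 : 0 ≤ C := (norm_nonneg _).trans (hC 0)
  refine ContinuousLinearMap.opNorm_le_bound _ hC0 fun x => ?_
  refine (lp.norm_mono (y := ((C : ℂ) • x : Fock d)) (by norm_num) fun k => ?_).trans_eq ?_
  · rw [diag_apply, lp.coeFn_smul, Pi.smul_apply, norm_smul, Complex.norm_real,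
      Real.norm_of_nonneg hC0]
    exact (T k).le_of_opNorm_le (hC k) _
  · rw [norm_smul, Complex.norm_real, Real.norm_of_nonneg hC0]

/-- The operator `T` on the summand `(ℂᵈ)^{⊗ k}` of the Fock space. -/
def blockOp {k : ℕ} (T : TensorPow d k →L[ℂ] TensorPow d k) : Fock d →L[ℂ] Fock d :=
  (lp.singleContinuousLinearMap ℂ (fun k => TensorPow d k) 2 k).comp
    (T.comp (lp.evalCLM ℂ (fun k => TensorPow d k) 2 k))

lemma blockOp_apply {k : ℕ} (T : TensorPow d k →L[ℂ] TensorPow d k) (x : Fock d) :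
    blockOp T x = lp.single 2 k (T (x k)) := rfl

lemma isCompactOperator_blockOp {k : ℕ} (T : TensorPow d k →L[ℂ] TensorPow d k) :
    IsCompactOperator (blockOp T) := by
  have : IsCompactOperator (T.comp (lp.evalCLM ℂ (fun k => TensorPow d k) 2 k)) :=
    isCompactOperator_of_locallyCompactSpace_dom _
  exact this.clm_comp (lp.singleContinuousLinearMap ℂ (fun k => TensorPow d k) 2 k)

/-- A block diagonal operator is compact if the norms of the blocks tend to zero. -/
lemma isCompactOperator_diag {T : ∀ k, TensorPow d k →L[ℂ] TensorPow d k}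
    (hT : ∃ C, ∀ k, ‖T k‖ ≤ C) (h : Tendsto (fun k => ‖T k‖) atTop (𝓝 0)) :
    IsCompactOperator (diag T hT) := by
  have hcl : diag T hT ∈ closure (compactIdeal (Fock d) : Set (Fock d →L[ℂ] Fock d)) := by
    refine Metric.mem_closure_iff.2 fun ε hε => ?_
    obtain ⟨n, hn⟩ := eventually_atTop.1 (h.eventually_le_const (half_pos hε))
    -- The first `n` blocks form a compact operator, since each factors through a finite-dimensional
    -- space; the remaining blocks all have norm at most `ε / 2`.
    refine ⟨∑ k ∈ Finset.range n, blockOp (T k),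
      sum_mem fun k _ => isCompactOperator_blockOp (T k), ?_⟩
    have hb : ∀ k, ‖(if k < n then 0 else T k : TensorPow d k →L[ℂ] TensorPow d k)‖ ≤ ε / 2 :=
      fun k => by
        split_ifs with hk
        · simpa using (half_pos hε).le
        · exact hn k (not_lt.1 hk)
    have : diag T hT - ∑ k ∈ Finset.range n, blockOp (T k) =
        diag (fun k => if k < n then 0 else T k) ⟨_, hb⟩ := by
      ext x k : 3
      rw [sub_apply, sum_apply, lp.coeFn_sub, Pi.sub_apply,
        lp.coeFn_sum, Finset.sum_apply, diag_apply, diag_apply]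
      simp only [blockOp_apply]
      by_cases hk : k < n
      · rw [if_pos hk, Finset.sum_eq_single k (fun j _ hj => lp.single_apply_ne _ _ _ hj.symm)
          (fun h => absurd (Finset.mem_range.2 hk) h), lp.single_apply_self, sub_self]
        rfl
      · rw [if_neg hk, Finset.sum_eq_zero, sub_zero]
        intro j hj
        exact lp.single_apply_ne _ _ _ (by have := Finset.mem_range.1 hj; omega)
    rw [dist_eq_norm, this]
    exact (norm_diag_le _ hb).trans_lt (half_lt_self hε)
  rwa [(isClosed_compactIdeal (Fock d)).closure_eq] at hcl

lemma isCompactOperator_vacuumProj : IsCompactOperator (vacuumProj d) := by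
  refine isCompactOperator_diag _ (tendsto_const_nhds.congr' ?_)
  filter_upwards [eventually_ge_atTop 1] with k hk
  rw [if_neg (by omega), norm_zero]

/-- The images of the creation operators in the Calkin algebra. -/
def cuntzGen (i : Fin d) : Calkin (Fock d) := Calkin.mk (Fock d) (creation i)

/-- The only defect in the Cuntz relations on the Fock space is the vacuum projection, which is
compact. -/
lemma isCuntzFamily_cuntzGen : IsCuntzFamily (cuntzGen (d := d)) where
  star_mul_eq i j := by
    rw [cuntzGen, cuntzGen, ← map_star, ← map_mul, star_creation_mul]
    split_ifs
    · rw [map_one]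
    · rw [map_zero]
  sum_mul_star := by
    have h := congrArg (Calkin.mk (Fock d)) (sum_creation_mul_star_add_vacuumProj (d := d))
    rw [map_add, Calkin.mk_eq_zero.2 isCompactOperator_vacuumProj, add_zero, map_sum, map_one] at h
    simp only [map_mul, map_star] at h
    exact h

lemma map_wordProd_creation (α : List (Fin d)) :
    Calkin.mk (Fock d) (wordProd creation α) = wordProd cuntzGen α := by
  rw [wordProd, wordProd, map_list_prod, List.map_map]
  rfl

/-- If the quotient were trivial, the identity would be compact and the Fock space
finite-dimensional. The isometry `S_1` would then be surjective, but its range misses the vacuum. -/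
instance [NeZero d] : Nontrivial (Calkin (Fock d)) := by
  refine ⟨1, 0, fun h => ?_⟩
  rw [← map_one (Calkin.mk (Fock d)), Calkin.mk_eq_zero] at h
  have hfin : FiniteDimensional ℂ (Fock d) := by
    exact (isCompactOperator_id_iff_finiteDimensional (𝕜 := ℂ)).1 h
  have hinj : Function.Injective (creation (0 : Fin d) : Fock d →ₗ[ℂ] Fock d) := fun x y hxy => by
    have : (star (creation (0 : Fin d)) * creation 0 : Fock d →L[ℂ] Fock d) x =
        (star (creation (0 : Fin d)) * creation 0 : Fock d →L[ℂ] Fock d) y :=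
      congrArg (fun z => (star (creation (0 : Fin d)) : Fock d →L[ℂ] Fock d) z) hxy
    rwa [star_creation_mul_self] at this
  obtain ⟨x, hx⟩ := (LinearMap.injective_iff_surjective.1 hinj) (basisVec (Fin.elim0 : Word d 0))
  have h0 : (basisVec (Fin.elim0 : Word d 0) : Fock d) 0 Fin.elim0 = 0 := by
    rw [← hx]; rfl
  simp [basisVec] at h0

end FockOperators

/-! ### The asymptotic commutation relation -/

section ConditionA

variable {d : ℕ}

/-- This replaces the Kronecker matrix by a coordinate formula: the first `p` letters are frozen and
`T` acts on the last `k`. -/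
lemma ampliation_apply_append {k : ℕ} (p : ℕ) (T : TensorPow d k →L[ℂ] TensorPow d k)
    (ξ : TensorPow d (p + k)) (a : Word d p) (b : Word d k) :
    ampliation p T ξ (Fin.append a b) = T (WithLp.toLp 2 fun b' => ξ (Fin.append a b')) b := by
  set M := (Matrix.toEuclideanCLM (n := Word d k) (𝕜 := ℂ)).symm T with hM
  have hT : T = Matrix.toEuclideanCLM (n := Word d k) (𝕜 := ℂ) M :=
    ((Matrix.toEuclideanCLM (n := Word d k) (𝕜 := ℂ)).apply_symm_apply T).symm
  have h1 : ∀ (a : Word d p) (b : Word d k),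
      (Fin.appendEquiv p k).symm (Fin.append a b) = (a, b) := fun a b =>
    (Fin.appendEquiv p k).symm_apply_apply (a, b)
  have hsum : ∀ f : Word d (p + k) → ℂ,
      ∑ w, f w = ∑ a : Word d p, ∑ b : Word d k, f (Fin.append a b) := fun f => by
    rw [← (Fin.appendEquiv p k).sum_comp, Fintype.sum_prod_type]
    rfl
  rw [ampliation, ← hM, hT, Matrix.ofLp_toEuclideanCLM, Matrix.ofLp_toEuclideanCLM]
  simp only [Matrix.mulVec, dotProduct, hsum, Matrix.reindex_apply, Matrix.submatrix_apply, h1,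
    Matrix.kroneckerMap_apply, Matrix.one_apply]
  rw [Finset.sum_eq_single a]
  · simp
  · intro a' _ ha'
    simp [ha'.symm]
  · simp

/-- Condition A(p) involves blocks of degree `p + k`, whereas `diag` needs a family over all
degrees. The transport along `p + (n - p) = n` is confined to this lemma. -/
lemma exists_shifted_family {F : ℕ → Type*} [∀ n, Zero (F n)] (p : ℕ) (f : ∀ k, F (p + k)) :
    ∃ g : ∀ n, F n, (∀ k, g (p + k) = f k) ∧ ∀ n < p, g n = 0 := by
  refine ⟨fun n => if h : p ≤ n then Nat.add_sub_of_le h ▸ f (n - p) else 0, fun k => ?_,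
    fun n hn => dif_neg (by omega)⟩
  have : ∀ m (_ : m = k) (h : p + m = p + k), (h ▸ f m : F (p + k)) = f k := by
    rintro m rfl h; rfl
  exact (dif_pos (Nat.le_add_right p k)).trans (this _ (by omega) _)

variable (Z : WeightSequence d)

/-- Under Condition A(p) the class of `Z` commutes with products of `p` creation operators. -/
lemma z_mul_wordProd {p : ℕ} (hA : Z.ConditionA p) {α : List (Fin d)} (hα : α.length = p) :
    Z.z * wordProd cuntzGen α = wordProd cuntzGen α * Z.z := by
  -- `R` collects the errors `Z_{p+k} - I_p ⊗ Z_k`; Condition A(p) makes `diag R` compact.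
  obtain ⟨R, hR, -⟩ := exists_shifted_family (F := fun n => TensorPow d n →L[ℂ] TensorPow d n) p
    (fun k => Z.weight (p + k) - ampliation p (Z.weight k))
  have hlim : Tendsto (fun n => ‖R n‖) atTop (𝓝 0) := by
    have h1 : Tendsto (fun k => ‖R (p + k)‖) atTop (𝓝 0) := by
      simp only [hR]
      exact (tendsto_congr fun k => norm_sub_rev _ _).1 hA
    have h2 : ∀ f : ℕ → ℝ, Tendsto (fun k => f (p + k)) atTop (𝓝 0) → Tendsto f atTop (𝓝 0) :=
      fun f hf => (tendsto_add_atTop_iff_nat p).1 (by simpa only [add_comm] using hf)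
    exact h2 _ h1
  have hb : ∃ C, ∀ n, ‖R n‖ ≤ C := by
    obtain ⟨C, hC⟩ := hlim.bddAbove_range
    exact ⟨C, fun n => hC ⟨n, rfl⟩⟩
  -- After the error is removed, the blocks in degrees at least `p` are `I_p ⊗ Z_m`, which commute
  -- exactly with prepending a word of length `p`. In degrees below `p` both sides vanish.
  have key : (Z.op - diag R hb) * wordProd creation α = wordProd creation α * Z.op := by
    ext x k : 3
    change (Z.op - diag R hb) (wordProd creation α x) k = wordProd creation α (Z.op x) k
    rw [sub_apply, lp.coeFn_sub, Pi.sub_apply, WeightSequence.op, diag_apply,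
      diag_apply]
    rcases lt_or_ge k p with hk | hk
    · rw [wordProd_creation_apply_eq_zero (hα ▸ hk), wordProd_creation_apply_eq_zero (hα ▸ hk),
        map_zero, map_zero, sub_zero]
    · obtain ⟨m, rfl⟩ := Nat.exists_eq_add_of_le hk
      rw [hR, sub_apply, sub_sub_cancel]
      ext w
      obtain ⟨⟨a, b⟩, rfl⟩ := (Fin.appendEquiv p m).surjective w
      change ampliation p (Z.weight m) _ (Fin.append a b) =
        wordProd creation α (diag Z.weight Z.bounded x) (p + m) (Fin.append a b)
      simp only [ampliation_apply_append, wordProd_creation_apply_append hα, diag_apply]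
      split_ifs
      · rfl
      · change Z.weight m 0 b = 0
        rw [map_zero]; rfl
  have h := congrArg (Calkin.mk (Fock d)) key
  rw [map_mul, map_mul, map_sub, Calkin.mk_eq_zero.2 (isCompactOperator_diag hb hlim), sub_zero,
    map_wordProd_creation] at h
  exact h

end ConditionA

/-! ### The canonical endomorphism of a Cuntz family -/

section CuntzEnd

variable {d : ℕ} {C : Type*} [CStarAlgebra C] {v : Fin d → C}

/-- The canonical endomorphism `x ↦ ∑ vᵢ x vᵢ⋆`. -/
def cuntzEnd (hv : IsCuntzFamily v) : C →⋆ₐ[ℂ] C where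
  toFun x := ∑ i, v i * x * star (v i)
  map_one' := by simpa using hv.sum_mul_star
  map_mul' x y := by
    rw [Finset.sum_mul_sum]
    refine Finset.sum_congr rfl fun i _ => ?_
    have : ∀ j, v i * x * star (v i) * (v j * y * star (v j)) =
        v i * x * (star (v i) * v j) * y * star (v j) := fun j => by simp only [mul_assoc]
    simp only [this, hv.star_mul_eq]
    simp [mul_assoc]
  map_zero' := by simp
  map_add' x y := by simp only [mul_add, add_mul, Finset.sum_add_distrib]
  commutes' c := by
    simp only [Algebra.algebraMap_eq_smul_one, mul_smul_comm, smul_mul_assoc, mul_one,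
      ← Finset.smul_sum, hv.sum_mul_star]
  map_star' x := by simp [star_sum, mul_assoc]

variable (hv : IsCuntzFamily v)

lemma cuntzEnd_apply (x : C) : cuntzEnd hv x = ∑ i, v i * x * star (v i) := rfl

/-- Orthogonality of the ranges leaves only the term `i = j`. This intertwining relation is the
source of the commutation rules with words below. -/
lemma cuntzEnd_mul_gen (x : C) (j : Fin d) : cuntzEnd hv x * v j = v j * x := by
  simp only [cuntzEnd_apply, Finset.sum_mul, mul_assoc, hv.star_mul_eq]
  simp

lemma iterate_cuntzEnd_mul_wordProd (α : List (Fin d)) :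
    ∀ x : C, (cuntzEnd hv)^[α.length] x * wordProd v α = wordProd v α * x := by
  induction α with
  | nil => simp
  | cons i α ih =>
    intro x
    rw [List.length_cons, Function.iterate_succ_apply', wordProd_cons, ← mul_assoc,
      cuntzEnd_mul_gen, mul_assoc, ih, mul_assoc]

lemma iterate_cuntzEnd_star (n : ℕ) (x : C) :
    (cuntzEnd hv)^[n] (star x) = star ((cuntzEnd hv)^[n] x) := by
  induction n with
  | zero => rfl
  | succ n ih => rw [Function.iterate_succ_apply', Function.iterate_succ_apply', ih, map_star]

lemma iterate_cuntzEnd_mul (n : ℕ) (x y : C) :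
    (cuntzEnd hv)^[n] (x * y) = (cuntzEnd hv)^[n] x * (cuntzEnd hv)^[n] y := by
  induction n with
  | zero => rfl
  | succ n ih => simp only [Function.iterate_succ_apply', ih, map_mul]

lemma star_wordProd_mul_iterate_cuntzEnd (α : List (Fin d)) (x : C) :
    star (wordProd v α) * (cuntzEnd hv)^[α.length] x = x * star (wordProd v α) := by
  have h := congrArg star (iterate_cuntzEnd_mul_wordProd hv α (star x))
  rwa [star_mul, star_mul, star_star, iterate_cuntzEnd_star, star_star] at h

-- Words of a fixed length separate elements, because `∑ v_α v_α⋆ = 1` over them.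
include hv in
lemma eq_of_forall_mul_wordProd {n : ℕ} {x y : C}
    (h : ∀ α : List (Fin d), α.length = n → x * wordProd v α = y * wordProd v α) : x = y := by
  rw [← mul_one x, ← mul_one y, ← hv.sum_matUnit n, Finset.mul_sum, Finset.mul_sum]
  refine Finset.sum_congr rfl fun α _ => ?_
  rw [matUnit, ← mul_assoc, ← mul_assoc, h _ (by simp)]

lemma iterate_cuntzEnd_eq_sum (n : ℕ) (x : C) :
    (cuntzEnd hv)^[n] x = ∑ α : Word d n,
      wordProd v (List.ofFn α) * x * star (wordProd v (List.ofFn α)) := by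
  conv_lhs => rw [← mul_one ((cuntzEnd hv)^[n] x), ← hv.sum_matUnit n, Finset.mul_sum]
  refine Finset.sum_congr rfl fun α _ => ?_
  have h := iterate_cuntzEnd_mul_wordProd hv (List.ofFn α) x
  rw [List.length_ofFn] at h
  rw [matUnit, ← mul_assoc, h]

/-- Passing `v_α` strips off `n` iterates and passing `v_β⋆` restores them; the two effects cancel
because the words have the same length. -/
lemma iterate_cuntzEnd_commute_matUnit (n : ℕ) (x : C) (α β : Word d n) :
    (cuntzEnd hv)^[n] x * matUnit v n α β = matUnit v n α β * (cuntzEnd hv)^[n] x := by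
  have h1 := iterate_cuntzEnd_mul_wordProd hv (List.ofFn α) x
  have h2 := star_wordProd_mul_iterate_cuntzEnd hv (List.ofFn β) x
  rw [List.length_ofFn] at h1 h2
  rw [matUnit, ← mul_assoc, h1, mul_assoc, mul_assoc, h2]

/-! ### Elements fixed by a power of the canonical endomorphism -/

section Periodic

variable {p : ℕ} {z : C}

lemma iterate_cuntzEnd_period
    (hz : ∀ α : List (Fin d), α.length = p → z * wordProd v α = wordProd v α * z) :
    (cuntzEnd hv)^[p] z = z :=
  eq_of_forall_mul_wordProd hv (n := p) fun α hα => by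
    rw [hz α hα, ← hα, iterate_cuntzEnd_mul_wordProd]

variable (hp : 0 < p) (hz : (cuntzEnd hv)^[p] z = z)
include hp hz

/-- Adding `p * n` iterates changes nothing, and `p * n ≥ n` since `p > 0`; so `s = (p * n - n) + r`
works. Thus orbit elements can be viewed as values of any prescribed iterate. -/
lemma exists_iterate_cuntzEnd_eq (n r : ℕ) :
    ∃ s, (cuntzEnd hv)^[r] z = (cuntzEnd hv)^[n] ((cuntzEnd hv)^[s] z) := by
  have h : ∀ m, (cuntzEnd hv)^[p * m] z = z := fun m => by
    rw [Function.iterate_mul]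
    exact Function.iterate_fixed hz m
  obtain ⟨k, hk⟩ : ∃ k, p * n = n + k := Nat.exists_eq_add_of_le (Nat.le_mul_of_pos_left n hp)
  refine ⟨k + r, ?_⟩
  rw [← Function.iterate_add_apply, ← add_assoc, ← hk, add_comm, Function.iterate_add_apply, h]

lemma iterate_commute_matUnit (r n : ℕ) (α β : Word d n) :
    (cuntzEnd hv)^[r] z * matUnit v n α β = matUnit v n α β * (cuntzEnd hv)^[r] z := by
  obtain ⟨s, hs⟩ := exists_iterate_cuntzEnd_eq hv hp hz n r
  rw [hs, iterate_cuntzEnd_commute_matUnit]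

/-- Writing `z` as the `k`-th iterate of another orbit element reduces the claim, by
multiplicativity, to `iterate_commute_matUnit`. -/
lemma commute_iterate_matUnit (k n : ℕ) (α β : Word d n) :
    z * (cuntzEnd hv)^[k] (matUnit v n α β) = (cuntzEnd hv)^[k] (matUnit v n α β) * z := by
  obtain ⟨s, hs⟩ := exists_iterate_cuntzEnd_eq hv hp hz k 0
  rw [Function.iterate_zero, id] at hs
  rw [hs, ← iterate_cuntzEnd_mul, iterate_commute_matUnit hv hp hz, iterate_cuntzEnd_mul]

/-- The two words may have different lengths, so the exponent changes: it is first rewritten to be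
at least `|α|`, then drops by `|α|` and rises by `|β|`. -/
lemma iterate_mul_wordProd_mul_star (r : ℕ) (α β : List (Fin d)) :
    ∃ s, (cuntzEnd hv)^[r] z * (wordProd v α * star (wordProd v β)) =
        wordProd v α * star (wordProd v β) * (cuntzEnd hv)^[s] z ∧
      star ((cuntzEnd hv)^[r] z) * (wordProd v α * star (wordProd v β)) =
        wordProd v α * star (wordProd v β) * star ((cuntzEnd hv)^[s] z) := by
  obtain ⟨s, hs⟩ := exists_iterate_cuntzEnd_eq hv hp hz α.length r
  refine ⟨β.length + s, ?_, ?_⟩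
  · rw [hs, ← mul_assoc, iterate_cuntzEnd_mul_wordProd, mul_assoc,
      ← star_wordProd_mul_iterate_cuntzEnd, ← Function.iterate_add_apply, mul_assoc]
  · rw [hs, ← iterate_cuntzEnd_star, ← mul_assoc, iterate_cuntzEnd_mul_wordProd, mul_assoc,
      ← star_wordProd_mul_iterate_cuntzEnd, iterate_cuntzEnd_star, ← Function.iterate_add_apply,
      mul_assoc]

end Periodic

/-! ### Graded subspaces -/

/-- The span of all `v_α v_β⋆ b` with `|α| - |β| = n` and `b ∈ B`. -/
def gradedSpan (v : Fin d → C) (B : Set C) (n : ℤ) : Submodule ℂ C :=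
  Submodule.span ℂ {x | ∃ α β : List (Fin d), ∃ b ∈ B, (α.length : ℤ) - β.length = n ∧
    x = wordProd v α * star (wordProd v β) * b}

variable {B : Set C} {n m : ℤ}

lemma mul_mem_gradedSpan {y : C} (h : ∀ α β : List (Fin d), ∀ b ∈ B, (α.length : ℤ) - β.length = n →
    y * (wordProd v α * star (wordProd v β) * b) ∈ gradedSpan v B m) {x : C}
    (hx : x ∈ gradedSpan v B n) : y * x ∈ gradedSpan v B m := by
  induction hx using Submodule.span_induction with
  | mem x hx =>
    obtain ⟨α, β, b, hb, hn, rfl⟩ := hx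
    exact h α β b hb hn
  | zero => rw [mul_zero]; exact zero_mem _
  | add x y _ _ hx hy => rw [mul_add]; exact add_mem hx hy
  | smul c x _ hx => rw [mul_smul_comm]; exact Submodule.smul_mem _ c hx

lemma gen_mul_mem_gradedSpan (i : Fin d) {x : C} (hx : x ∈ gradedSpan v B n) :
    v i * x ∈ gradedSpan v B (n + 1) := by
  refine mul_mem_gradedSpan (fun α β b hb hn => Submodule.subset_span ?_) hx
  refine ⟨i :: α, β, b, hb, ?_, ?_⟩
  · rw [List.length_cons]; push_cast; omega
  · simp only [wordProd_cons, mul_assoc]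

include hv in
lemma star_gen_mul_mem_gradedSpan (i : Fin d) {x : C} (hx : x ∈ gradedSpan v B n) :
    star (v i) * x ∈ gradedSpan v B (n - 1) := by
  refine mul_mem_gradedSpan (fun α β b hb hn => ?_) hx
  -- If `α` is empty, `v_i⋆ v_β⋆ = (v_β v_i)⋆` appends the letter `i` to `β`. Otherwise `v_i⋆`
  -- either cancels the first letter of `α` or annihilates the element; each time the degree drops
  -- by one.
  cases α with
  | nil =>
    refine Submodule.subset_span ⟨[], β ++ [i], b, hb, ?_, ?_⟩
    · simp only [List.length_append, List.length_nil, List.length_singleton] at hn ⊢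
      push_cast at hn ⊢; omega
    · simp [wordProd_append, wordProd_cons, mul_assoc]
  | cons j α =>
    have : star (v i) * (wordProd v (j :: α) * star (wordProd v β) * b) =
        star (v i) * v j * (wordProd v α * star (wordProd v β) * b) := by
      simp only [wordProd_cons, mul_assoc]
    rw [this, hv.star_mul_eq]
    split_ifs
    · rw [one_mul]
      refine Submodule.subset_span ⟨α, β, b, hb, ?_, rfl⟩
      rw [List.length_cons] at hn
      push_cast at hn; omega
    · rw [zero_mul]; exact zero_mem _

/-- The weight moves to the right of `v_α v_β⋆` as another iterate, which the coefficient set `B`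
absorbs. This is why `B` must be stable under all iterates and their adjoints, not only under `z`.
-/
lemma weight_mul_mem_gradedSpan {p : ℕ} {z : C} (hp : 0 < p) (hz : (cuntzEnd hv)^[p] z = z)
    (hB : ∀ r, ∀ b ∈ B, (cuntzEnd hv)^[r] z * b ∈ B ∧ star ((cuntzEnd hv)^[r] z) * b ∈ B)
    {x : C} (hx : x ∈ gradedSpan v B n) :
    z * x ∈ gradedSpan v B n ∧ star z * x ∈ gradedSpan v B n := by
  constructor
  · refine mul_mem_gradedSpan (fun α β b hb hn => ?_) hx
    obtain ⟨s, hs, -⟩ := iterate_mul_wordProd_mul_star hv hp hz 0 α β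
    rw [Function.iterate_zero, id] at hs
    rw [← mul_assoc, hs, mul_assoc _ _ b]
    exact Submodule.subset_span ⟨α, β, _, (hB s b hb).1, hn, rfl⟩
  · refine mul_mem_gradedSpan (fun α β b hb hn => ?_) hx
    obtain ⟨s, -, hs⟩ := iterate_mul_wordProd_mul_star hv hp hz 0 α β
    rw [Function.iterate_zero, id] at hs
    rw [← mul_assoc, hs, mul_assoc _ _ b]
    exact Submodule.subset_span ⟨α, β, _, (hB s b hb).2, hn, rfl⟩

lemma gradedSpan_zero_le {S : Submodule ℂ C}
    (h : ∀ (n : ℕ) (α β : Word d n), ∀ b ∈ B, matUnit v n α β * b ∈ S) :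
    gradedSpan v B 0 ≤ S := by
  refine Submodule.span_le.2 ?_
  rintro _ ⟨α, β, b, hb, hn, rfl⟩
  have hlen : β.length = α.length := by omega
  obtain ⟨k, hk⟩ : ∃ k, α.length = k := ⟨_, rfl⟩
  have h' := h k (fun i => α.get (i.cast hk.symm)) (fun i => β.get (i.cast (by omega))) b hb
  have h1 : List.ofFn (fun i : Fin k => α.get (i.cast hk.symm)) = α := by
    subst hk; simp
  have h2 : List.ofFn (fun i : Fin k => β.get (i.cast (by omega))) = β := by
    obtain rfl : β.length = k := by omega
    simp
  rwa [matUnit, h1, h2] at h'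

end CuntzEnd

/-! ### Generated C⋆-subalgebras and commutants -/

section CStarGen

variable {A : Type*} [NonUnitalCStarAlgebra A]

lemma cstarGen_le {s : Set A} {S : NonUnitalStarSubalgebra ℂ A} (hS : IsClosed (S : Set A))
    (h : s ⊆ S) : cstarGen s ≤ S :=
  NonUnitalStarSubalgebra.topologicalClosure_minimal _ (NonUnitalStarAlgebra.adjoin_le h) hS

/-- The commutant of a `*`-closed set. -/
def starCommutant (s : Set A) (hs : ∀ x ∈ s, star x ∈ s) : NonUnitalStarSubalgebra ℂ A where
  carrier := {y | ∀ x ∈ s, x * y = y * x}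
  add_mem' hy hy' x hx := by rw [mul_add, add_mul, hy x hx, hy' x hx]
  zero_mem' x _ := by rw [mul_zero, zero_mul]
  mul_mem' {y y'} hy hy' x hx := by rw [← mul_assoc, hy x hx, mul_assoc, hy' x hx, mul_assoc]
  smul_mem' c y hy x hx := by rw [mul_smul_comm, smul_mul_assoc, hy x hx]
  star_mem' {y} hy x hx := by
    have h := congrArg star (hy (star x) (hs x hx))
    rw [star_mul, star_mul, star_star] at h
    exact h.symm

lemma isClosed_starCommutant (s : Set A) (hs : ∀ x ∈ s, star x ∈ s) :
    IsClosed (starCommutant s hs : Set A) := by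
  have : (starCommutant s hs : Set A) = ⋂ x ∈ s, {y | x * y = y * x} := by
    ext y
    simp only [Set.mem_iInter]
    rfl
  rw [this]
  exact isClosed_biInter fun x _ => isClosed_eq (by fun_prop) (by fun_prop)

end CStarGen

/-! ### The corner `C₀₀` -/

namespace WeightSequence

variable {d : ℕ} (Z : WeightSequence d)

/-- The canonical endomorphism of the Calkin algebra. -/
abbrev calkinEnd (d : ℕ) : Calkin (Fock d) →⋆ₐ[ℂ] Calkin (Fock d) := cuntzEnd isCuntzFamily_cuntzGen

lemma u_eq_wordProd (α : List (Fin d)) : u α = wordProd cuntzGen α := rfl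

variable {Z} {p : ℕ}

lemma iterate_calkinEnd_z (hA : Z.ConditionA p) : (calkinEnd d)^[p] Z.z = Z.z :=
  iterate_cuntzEnd_period _ fun _ hα => z_mul_wordProd Z hA hα

/-- Moving `Φ^{p-1}(E)` past a generator `u_γ z^l u_δ⋆` removes `|γ|` iterates, then crosses `z^l`
by periodicity, then regains `|δ| = |γ|` iterates. The exponent `p - 1` is the longest word length
allowed in `C₀`; the commutant being a closed `*`-subalgebra gives the rest. -/
lemma mul_iterate_matUnit_of_mem_C0 (hp : 0 < p) (hA : Z.ConditionA p) {y : Calkin (Fock d)}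
    (hy : y ∈ Z.C0 p) (n : ℕ) (α β : Word d n) :
    (calkinEnd d)^[p - 1] (matUnit cuntzGen n α β) * y =
      y * (calkinEnd d)^[p - 1] (matUnit cuntzGen n α β) := by
  let s : Set (Calkin (Fock d)) :=
    {x | ∃ α β : Word d n, x = (calkinEnd d)^[p - 1] (matUnit cuntzGen n α β)}
  have hs : ∀ x ∈ s, star x ∈ s := by
    rintro _ ⟨α, β, rfl⟩
    exact ⟨β, α, by rw [← iterate_cuntzEnd_star, (isCuntzFamily_cuntzGen.isMatrixUnits n).star]⟩
  have hle : Z.C0 p ≤ starCommutant s hs := by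
    refine cstarGen_le (isClosed_starCommutant s hs) ?_
    rintro _ ⟨γ, δ, l, hlen, hlt, rfl⟩ _ ⟨α, β, rfl⟩
    obtain ⟨k, hk⟩ : ∃ k, p - 1 = γ.length + k := Nat.exists_eq_add_of_le (by omega)
    have hc : Commute (Z.z ^ l) ((calkinEnd d)^[k] (matUnit cuntzGen n α β)) :=
      Commute.pow_left (commute_iterate_matUnit _ hp (iterate_calkinEnd_z hA) k n α β) l
    rw [hk, Function.iterate_add_apply, u_eq_wordProd, u_eq_wordProd, ← mul_assoc, ← mul_assoc,
      iterate_cuntzEnd_mul_wordProd, mul_assoc _ (star _), hlen,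
      star_wordProd_mul_iterate_cuntzEnd, mul_assoc, mul_assoc, ← mul_assoc _ (Z.z ^ l), ← hc.eq,
      mul_assoc, mul_assoc]
  exact hle hy _ ⟨α, β, rfl⟩

/-- The bound `r < p` enters because `Φ^r(z)` is the sum of the generators `u_α z u_α⋆` with `|α| =
r`. -/
lemma iterate_calkinEnd_mem_C0 {r : ℕ} (hr : r < p) : (calkinEnd d)^[r] Z.z ∈ Z.C0 p := by
  rw [iterate_cuntzEnd_eq_sum]
  refine sum_mem fun α _ => subset_cstarGen _ ⟨List.ofFn α, List.ofFn α, 1, rfl, by simpa, ?_⟩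
  rw [pow_one]; rfl

variable [NeZero d]

/-- The isometry `u_ξ` for `ξ = 1 1 ⋯ 1` of length `p - 1`. -/
abbrev cornerIso (d p : ℕ) [NeZero d] : Calkin (Fock d) := u (xi d (p - 1))

lemma mul_cornerIso_of_mem_C00 {hp : 0 < p} {c : Calkin (Fock d)} (hc : c ∈ Z.C00 p hp) :
    c * cornerIso d p * star (cornerIso d p) = c ∧ cornerIso d p * star (cornerIso d p) * c = c := by
  obtain ⟨y, -, rfl⟩ := hc
  have h := star_u_mul_self (xi d (p - 1))
  constructor
  · simp only [mul_assoc]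
    rw [← mul_assoc (star _) (u _) (star _), h, one_mul]
  · simp only [mul_assoc]
    rw [← mul_assoc (star _) (u _) (star _ * _), h, one_mul]

/-- The embedding `c ↦ u_ξ⋆ c u_ξ` of the corner `C₀₀`. -/
def cornerEmbedding (Z : WeightSequence d) (p : ℕ) (hp : 0 < p) :
    Z.C00 p hp →⋆ₙₐ[ℂ] Calkin (Fock d) where
  toFun c := star (cornerIso d p) * c * cornerIso d p
  map_smul' r c := by simp
  map_zero' := by simp
  map_add' a b := by simp [mul_add, add_mul]
  map_mul' a b := by
    conv_lhs => rw [NonUnitalStarSubalgebra.coe_mul, ← (mul_cornerIso_of_mem_C00 a.2).1]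
    simp only [mul_assoc]
  map_star' c := by simp [mul_assoc]

lemma cornerEmbedding_apply {hp : 0 < p} (c : Z.C00 p hp) :
    cornerEmbedding Z p hp c = star (cornerIso d p) * c * cornerIso d p := rfl

/-- Conjugating back by `u_ξ` recovers `c`, as `u_ξ u_ξ⋆` is the unit of the corner. -/
lemma cornerEmbedding_injective {hp : 0 < p} : Function.Injective (cornerEmbedding Z p hp) := by
  have h : ∀ c : Z.C00 p hp,
      cornerIso d p * cornerEmbedding Z p hp c * star (cornerIso d p) = c := fun c => by
    have h1 := mul_cornerIso_of_mem_C00 c.2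
    rw [cornerEmbedding_apply, ← mul_assoc, ← mul_assoc, h1.2, h1.1]
  intro a b hab
  exact Subtype.ext (by rw [← h a, hab, h b])

/-- Elements of `C₀` commute with `Φ^{p-1}` of a matrix unit, and `u_ξ`, whose word has length
exactly `p - 1`, turns this into commutation with the matrix unit itself. -/
lemma cornerEmbedding_commute_matUnit (hp : 0 < p) (hA : Z.ConditionA p) (c : Z.C00 p hp) (n : ℕ)
    (α β : Word d n) : cornerEmbedding Z p hp c * matUnit cuntzGen n α β =
      matUnit cuntzGen n α β * cornerEmbedding Z p hp c := by
  have hc : (c : Calkin (Fock d)) ∈ Z.C0 p := by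
    obtain ⟨y, hy, h⟩ := c.2
    rw [h]
    exact mul_mem (mul_mem (Z.range_proj_mem_C0 hp) hy) (Z.range_proj_mem_C0 hp)
  have hlen : (xi d (p - 1)).length = p - 1 := List.length_replicate
  have h1 := iterate_cuntzEnd_mul_wordProd isCuntzFamily_cuntzGen (xi d (p - 1))
    (matUnit cuntzGen n α β)
  have h2 := star_wordProd_mul_iterate_cuntzEnd isCuntzFamily_cuntzGen (xi d (p - 1))
    (matUnit cuntzGen n α β)
  rw [hlen, ← u_eq_wordProd] at h1 h2
  rw [cornerEmbedding_apply, mul_assoc, ← h1, ← mul_assoc, mul_assoc (star _),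
    ← mul_iterate_matUnit_of_mem_C0 hp hA hc, ← mul_assoc, h2]
  simp only [mul_assoc]

lemma uhfEmbedding_mul_cornerEmbedding (hp : 0 < p) (hA : Z.ConditionA p) (a : UHF d)
    (c : Z.C00 p hp) :
    uhfEmbedding isCuntzFamily_cuntzGen a * cornerEmbedding Z p hp c =
      cornerEmbedding Z p hp c * uhfEmbedding isCuntzFamily_cuntzGen a := by
  have hs : ∀ x ∈ Set.range (cornerEmbedding Z p hp), star x ∈ Set.range (cornerEmbedding Z p hp) := by
    rintro _ ⟨c, rfl⟩
    exact ⟨star c, map_star _ c⟩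
  refine (uhfEmbedding_mem isCuntzFamily_cuntzGen (S := starCommutant _ hs)
    (isClosed_starCommutant _ hs) ?_ a _ ⟨c, rfl⟩).symm
  rintro n α β _ ⟨c, rfl⟩
  exact cornerEmbedding_commute_matUnit hp hA c n α β

lemma iterate_calkinEnd_mem_range (hp : 0 < p) (hA : Z.ConditionA p) (r : ℕ) :
    (calkinEnd d)^[r] Z.z ∈ Set.range (cornerEmbedding Z p hp) := by
  have hz := iterate_calkinEnd_z hA
  have hlen : (xi d (p - 1)).length = p - 1 := List.length_replicate
  -- The preimage of `Φ^{r+1}(z)` is `e Φ^r(z) e`. Indeed `Φ^r(z) = Φ^{p-1}(Φ^{r+1}(z))` by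
  -- periodicity, and `u_ξ⋆ · u_ξ` removes `p - 1` iterates.
  have main : ∀ r < p, (calkinEnd d)^[r + 1] Z.z ∈ Set.range (cornerEmbedding Z p hp) := by
    intro r hr
    refine ⟨⟨_, _, iterate_calkinEnd_mem_C0 hr, rfl⟩, ?_⟩
    have h1 := star_u_mul_self (xi d (p - 1))
    have h2 := iterate_cuntzEnd_mul_wordProd isCuntzFamily_cuntzGen (xi d (p - 1))
      ((calkinEnd d)^[r + 1] Z.z)
    rw [hlen, ← Function.iterate_add_apply, show p - 1 + (r + 1) = r + p by omega,
      Function.iterate_add_apply, hz, ← u_eq_wordProd] at h2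
    change star (u (xi d (p - 1))) * (u (xi d (p - 1)) * star (u (xi d (p - 1))) *
      (calkinEnd d)^[r] Z.z * (u (xi d (p - 1)) * star (u (xi d (p - 1))))) * u (xi d (p - 1)) = _
    simp only [mul_assoc]
    rw [h1, mul_one, h2, ← mul_assoc (star _) (u _) (star _ * _), h1, one_mul, ← mul_assoc, h1,
      one_mul]
  -- The previous claim covers exponents `1, …, p`. Exponent `0` is the same as `p`, and larger
  -- exponents are reduced by `p`.
  induction r using Nat.strong_induction_on with
  | _ r ih =>
    rcases Nat.eq_zero_or_pos r with rfl | hr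
    · have h := main (p - 1) (by omega)
      rwa [Nat.sub_add_cancel hp, hz] at h
    · by_cases hrp : r ≤ p
      · have h := main (r - 1) (by omega)
        rwa [Nat.sub_add_cancel hr] at h
      · have h := ih (r - p) (by omega)
        rwa [← hz, ← Function.iterate_add_apply, Nat.sub_add_cancel (by omega)] at h

lemma one_mem_range_cornerEmbedding (Z : WeightSequence d) (hp : 0 < p) :
    (1 : Calkin (Fock d)) ∈ Set.range (cornerEmbedding Z p hp) := by
  refine ⟨⟨_, _, Z.range_proj_mem_C0 hp, rfl⟩, ?_⟩
  have h1 := star_u_mul_self (xi d (p - 1))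
  change star (u (xi d (p - 1))) * (u (xi d (p - 1)) * star (u (xi d (p - 1))) *
    (u (xi d (p - 1)) * star (u (xi d (p - 1)))) *
    (u (xi d (p - 1)) * star (u (xi d (p - 1))))) * u (xi d (p - 1)) = _
  simp only [mul_assoc, h1, mul_one]

/-- The embedding of `M_{d^∞} ⊗ C₀₀` into the Calkin algebra. -/
def tensorEmbedding (Z : WeightSequence d) (hp : 0 < p) (hA : Z.ConditionA p) :
    CStarTensor (UHF d) (Z.C00 p hp) →⋆ₙₐ[ℂ] Calkin (Fock d) :=
  uhfTensorEmbedding isCuntzFamily_cuntzGen cornerEmbedding_injective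
    (uhfEmbedding_mul_cornerEmbedding hp hA)

lemma tensorEmbedding_injective (hp : 0 < p) (hA : Z.ConditionA p) :
    Function.Injective (tensorEmbedding Z hp hA) :=
  uhfTensorEmbedding_injective _ _ _

end WeightSequence

/-! ### The gauge action -/

section Gauge

variable {d : ℕ}

lemma gaugeUnitary_apply (t : ℝ) (x : Fock d) (k : ℕ) :
    gaugeUnitary d t x k = Complex.exp (Complex.I * k * t) • x k := rfl

lemma gaugeUnitary_mul_star_self (t : ℝ) : gaugeUnitary d t * star (gaugeUnitary d t) = 1 := by
  have h : gaugeUnitary d t * gaugeUnitary d (-t) = 1 := by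
    ext x k : 3
    change gaugeUnitary d t (gaugeUnitary d (-t) x) k = x k
    rw [gaugeUnitary_apply, gaugeUnitary_apply, smul_smul, ← Complex.exp_add]
    simp
  have h2 : star (gaugeUnitary d t) = gaugeUnitary d (-t) := by
    rw [← mul_one (star _), ← h, ← mul_assoc, star_gaugeUnitary_mul_self, one_mul]
  rw [h2, h]

lemma gauge_eq_of_mul_eq {t : ℝ} {X Y : Fock d →L[ℂ] Fock d}
    (h : gaugeUnitary d t * X = Y * gaugeUnitary d t) : gauge t X = Y := by
  rw [gauge, h, mul_assoc, gaugeUnitary_mul_star_self, mul_one]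

lemma gauge_add (t : ℝ) (X Y : Fock d →L[ℂ] Fock d) :
    gauge t (X + Y) = gauge t X + gauge t Y := by
  simp only [gauge, mul_add, add_mul]

lemma gauge_sub (t : ℝ) (X Y : Fock d →L[ℂ] Fock d) :
    gauge t (X - Y) = gauge t X - gauge t Y := by
  simp only [gauge, mul_sub, sub_mul]

lemma gauge_smul (t : ℝ) (c : ℂ) (X : Fock d →L[ℂ] Fock d) :
    gauge t (c • X) = c • gauge t X := by
  simp only [gauge, mul_smul_comm, smul_mul_assoc]

lemma gauge_star (t : ℝ) (X : Fock d →L[ℂ] Fock d) : gauge t (star X) = star (gauge t X) := by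
  simp only [gauge, star_mul, star_star, mul_assoc]

lemma continuous_gauge (t : ℝ) : Continuous (gauge (d := d) t) := by
  unfold gauge; fun_prop

lemma norm_gauge_le (t : ℝ) (X : Fock d →L[ℂ] Fock d) : ‖gauge t X‖ ≤ ‖X‖ := by
  have h : ‖gaugeUnitary d t‖ ≤ 1 := norm_diag_le _ fun k => by
    rw [norm_smul, show Complex.I * k * t = ((k * t : ℝ) : ℂ) * Complex.I by push_cast; ring,
      Complex.norm_exp_ofReal_mul_I, one_mul]
    exact ContinuousLinearMap.norm_id_le
  calc ‖gauge t X‖ ≤ ‖gaugeUnitary d t * X‖ * ‖star (gaugeUnitary d t)‖ := norm_mul_le _ _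
    _ ≤ ‖gaugeUnitary d t‖ * ‖X‖ * ‖star (gaugeUnitary d t)‖ := by gcongr; exact norm_mul_le _ _
    _ ≤ 1 * ‖X‖ * 1 := by
      have h' : ‖star (gaugeUnitary d t)‖ ≤ 1 :=
        (ContinuousLinearMap.adjoint.norm_map (gaugeUnitary d t)).trans_le h
      gcongr
    _ = ‖X‖ := by ring

/-- `X` is homogeneous of degree `n` for the gauge action. -/
def IsHomogeneous (n : ℤ) (X : Fock d →L[ℂ] Fock d) : Prop :=
  ∀ t : ℝ, gauge t X = Complex.exp (Complex.I * n * t) • X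

lemma isHomogeneous_zero_iff {X : Fock d →L[ℂ] Fock d} :
    IsHomogeneous 0 X ↔ ∀ t : ℝ, gauge t X = X := by
  simp [IsHomogeneous]

lemma IsHomogeneous.mul {n m : ℤ} {X Y : Fock d →L[ℂ] Fock d} (hX : IsHomogeneous n X)
    (hY : IsHomogeneous m Y) : IsHomogeneous (n + m) (X * Y) := fun t => by
  rw [gauge_mul, hX, hY, smul_mul_smul_comm, ← Complex.exp_add]
  congr 2
  push_cast; ring

lemma IsHomogeneous.star {n : ℤ} {X : Fock d →L[ℂ] Fock d} (hX : IsHomogeneous n X) :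
    IsHomogeneous (-n) (star X) := fun t => by
  rw [gauge_star, hX, star_smul, Complex.star_def, ← Complex.exp_conj]
  congr 2
  simp

lemma isHomogeneous_diag {T : ∀ k, TensorPow d k →L[ℂ] TensorPow d k} (hT : ∃ C, ∀ k, ‖T k‖ ≤ C) :
    IsHomogeneous 0 (diag T hT) := by
  refine isHomogeneous_zero_iff.2 fun t => gauge_eq_of_mul_eq ?_
  ext x k : 3
  change gaugeUnitary d t (diag T hT x) k = diag T hT (gaugeUnitary d t x) k
  rw [gaugeUnitary_apply, diag_apply, diag_apply, gaugeUnitary_apply, map_smul]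

lemma isHomogeneous_one : IsHomogeneous 0 (1 : Fock d →L[ℂ] Fock d) :=
  isHomogeneous_zero_iff.2 fun t => gauge_eq_of_mul_eq (by rw [mul_one, one_mul])

lemma isHomogeneous_creation (i : Fin d) : IsHomogeneous 1 (creation i) := fun t => by
  refine gauge_eq_of_mul_eq ?_
  ext x k : 3
  change gaugeUnitary d t (creation i x) k =
    Complex.exp (Complex.I * (1 : ℤ) * t) • creation i (gaugeUnitary d t x) k
  cases k with
  | zero =>
    rw [gaugeUnitary_apply, creation_apply_zero, creation_apply_zero, smul_zero, smul_zero]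
  | succ k =>
    rw [gaugeUnitary_apply, creation_apply_succ, creation_apply_succ, gaugeUnitary_apply, map_smul,
      smul_smul, ← Complex.exp_add]
    congr 2
    push_cast; ring

lemma isHomogeneous_wordProd (α : List (Fin d)) :
    IsHomogeneous α.length (wordProd creation α) := by
  induction α with
  | nil => exact isHomogeneous_one
  | cons i α ih =>
    rw [wordProd_cons, List.length_cons]
    have := (isHomogeneous_creation i).mul ih
    rwa [add_comm] at this

/-- The mean of the gauge action over the `N`-th roots of unity. -/
def gaugeMean (N : ℕ) (X : Fock d →L[ℂ] Fock d) : Fock d →L[ℂ] Fock d :=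
  (N : ℂ)⁻¹ • ∑ k ∈ Finset.range N, gauge (2 * Real.pi * k / N) X

lemma gaugeMean_add (N : ℕ) (X Y : Fock d →L[ℂ] Fock d) :
    gaugeMean N (X + Y) = gaugeMean N X + gaugeMean N Y := by
  simp only [gaugeMean, gauge_add, Finset.sum_add_distrib, smul_add]

lemma gaugeMean_sub (N : ℕ) (X Y : Fock d →L[ℂ] Fock d) :
    gaugeMean N (X - Y) = gaugeMean N X - gaugeMean N Y := by
  simp only [gaugeMean, gauge_sub, Finset.sum_sub_distrib, smul_sub]

lemma gaugeMean_smul (N : ℕ) (c : ℂ) (X : Fock d →L[ℂ] Fock d) :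
    gaugeMean N (c • X) = c • gaugeMean N X := by
  simp only [gaugeMean, gauge_smul, ← Finset.smul_sum, smul_comm c]

lemma norm_gaugeMean_le {N : ℕ} (hN : 0 < N) (X : Fock d →L[ℂ] Fock d) :
    ‖gaugeMean N X‖ ≤ ‖X‖ := by
  have hN' : (0 : ℝ) < N := by exact_mod_cast hN
  calc ‖gaugeMean N X‖ ≤ ‖(N : ℂ)⁻¹‖ * ∑ k ∈ Finset.range N, ‖X‖ := by
        rw [gaugeMean, norm_smul]
        gcongr
        exact norm_sum_le_of_le _ fun k _ => norm_gauge_le _ X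
    _ = ‖X‖ := by
        rw [norm_inv, Complex.norm_natCast, Finset.sum_const, Finset.card_range, nsmul_eq_mul]
        field_simp

lemma gaugeMean_of_fixed {N : ℕ} (hN : 0 < N) {X : Fock d →L[ℂ] Fock d}
    (hX : IsHomogeneous 0 X) : gaugeMean N X = X := by
  have hN' : (N : ℂ) ≠ 0 := by exact_mod_cast hN.ne'
  rw [gaugeMean]
  simp only [isHomogeneous_zero_iff.1 hX, Finset.sum_const, Finset.card_range]
  rw [← Nat.cast_smul_eq_nsmul ℂ, smul_smul, inv_mul_cancel₀ hN', one_smul]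

/-- In degree `n` the mean is a geometric sum of `ζ = exp(2πi n / N)`, an `N`-th root of unity
different from `1` because `0 < |n| < N`. A finite mean can replace the integral over the circle
since it is applied to elements with finitely many degrees. -/
lemma gaugeMean_eq_zero {N : ℕ} {n : ℤ} (hn : n ≠ 0) (hnN : n.natAbs < N)
    {X : Fock d →L[ℂ] Fock d} (hX : IsHomogeneous n X) : gaugeMean N X = 0 := by
  have hN : (N : ℂ) ≠ 0 := by exact_mod_cast (show N ≠ 0 by omega)
  set ζ : ℂ := Complex.exp (2 * Real.pi * Complex.I * (n / N)) with hζ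
  have h1 : ζ ≠ 1 := fun h => by
    obtain ⟨m, hm⟩ := Complex.exp_eq_one_iff.1 h
    have h2 : (2 * Real.pi * Complex.I : ℂ) ≠ 0 := Complex.two_pi_I_ne_zero
    have h3 : (n : ℂ) = m * N := by
      field_simp at hm
      linear_combination hm
    have h4 : n = m * N := by exact_mod_cast h3
    rcases eq_or_ne m 0 with rfl | hm0
    · simp at h4; exact hn h4
    · have : n.natAbs = m.natAbs * N := by rw [h4, Int.natAbs_mul, Int.natAbs_natCast]
      have h5 : 1 ≤ m.natAbs := by omega
      nlinarith
  have h2 : ζ ^ N = 1 := by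
    rw [hζ, ← Complex.exp_nat_mul]
    refine Complex.exp_eq_one_iff.2 ⟨n, ?_⟩
    field_simp
  have h3 : ∀ k : ℕ, gauge (2 * Real.pi * k / N) X = ζ ^ k • X := fun k => by
    rw [hX, hζ, ← Complex.exp_nat_mul]
    congr 2
    push_cast
    field_simp
  have h4 : ∑ k ∈ Finset.range N, ζ ^ k = 0 := by
    have := geom_sum_mul ζ N
    rw [h2, sub_self] at this
    exact (mul_eq_zero.1 this).resolve_right (sub_ne_zero.2 h1)
  rw [gaugeMean]
  simp only [h3, ← Finset.sum_smul, h4, zero_smul, smul_zero]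

lemma isClosed_gaugeFixed {T : NonUnitalStarSubalgebra ℂ (Fock d →L[ℂ] Fock d)}
    (hT : IsClosed (T : Set (Fock d →L[ℂ] Fock d))) :
    IsClosed (gaugeFixed T : Set (Fock d →L[ℂ] Fock d)) := by
  have : (gaugeFixed T : Set (Fock d →L[ℂ] Fock d)) =
      (T : Set (Fock d →L[ℂ] Fock d)) ∩ ⋂ t : ℝ, {X | gauge t X = X} := by
    ext X
    simp only [Set.mem_inter_iff, Set.mem_iInter]
    rfl
  rw [this]
  exact hT.inter (isClosed_iInter fun t => isClosed_eq (continuous_gauge t) continuous_id)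

/-- The gauge fixed point algebra is closed, hence a C⋆-algebra, and its image is the range of a
`*`-homomorphism of C⋆-algebras. -/
lemma isClosed_qD {T : NonUnitalStarSubalgebra ℂ (Fock d →L[ℂ] Fock d)}
    (hT : IsClosed (T : Set (Fock d →L[ℂ] Fock d))) :
    IsClosed (WeightSequence.qD T : Set (Calkin (Fock d))) := by
  have := isClosed_gaugeFixed hT
  let f : gaugeFixed T →⋆ₙₐ[ℂ] Calkin (Fock d) :=
    ((Calkin.mk (Fock d) : (Fock d →L[ℂ] Fock d) →⋆ₙₐ[ℂ] Calkin (Fock d))).comp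
      (NonUnitalStarSubalgebraClass.subtype (gaugeFixed T))
  have h : (WeightSequence.qD T : Set (Calkin (Fock d))) = Set.range f := by
    ext y
    constructor
    · rintro ⟨X, hX, rfl⟩
      exact ⟨⟨X, hX⟩, rfl⟩
    · rintro ⟨X, rfl⟩
      exact ⟨X, X.2, rfl⟩
  rw [h]
  exact isClosed_range_starHom f

lemma mk_mem_qD {T : NonUnitalStarSubalgebra ℂ (Fock d →L[ℂ] Fock d)} {X : Fock d →L[ℂ] Fock d}
    (hX : X ∈ T) (h : IsHomogeneous 0 X) : Calkin.mk (Fock d) X ∈ WeightSequence.qD T :=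
  ⟨X, ⟨hX, isHomogeneous_zero_iff.1 h⟩, rfl⟩

/-- The homogeneous operators of degree `n` whose class lies in the graded span of degree `n`. -/
def homogeneousPart (B : Set (Calkin (Fock d))) (n : ℤ) : Submodule ℂ (Fock d →L[ℂ] Fock d) where
  carrier := {X | IsHomogeneous n X ∧ Calkin.mk (Fock d) X ∈ gradedSpan cuntzGen B n}
  add_mem' hX hY := ⟨fun t => by rw [gauge_add, hX.1, hY.1, smul_add], by
    rw [map_add]; exact add_mem hX.2 hY.2⟩
  zero_mem' := ⟨fun t => by simp [gauge], by rw [map_zero]; exact zero_mem _⟩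
  smul_mem' c X hX := ⟨fun t => by rw [gauge_smul, hX.1, smul_comm], by
    rw [map_smul]; exact Submodule.smul_mem _ c hX.2⟩

/-- If multiplication by each generator and its adjoint preserves homogeneous parts, then elements
of the generated `*`-algebra are sums of elements of the homogeneous parts. -/
lemma mem_span_homogeneousPart {B : Set (Calkin (Fock d))} (h1 : 1 ∈ B)
    {s : Set (Fock d →L[ℂ] Fock d)}
    (hs : ∀ X ∈ s ∪ star s, ∀ n, ∃ m, ∀ Y ∈ homogeneousPart B n, X * Y ∈ homogeneousPart B m)
    {X : Fock d →L[ℂ] Fock d} (hX : X ∈ NonUnitalStarAlgebra.adjoin ℂ s) :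
    X ∈ Submodule.span ℂ (⋃ n, (homogeneousPart B n : Set (Fock d →L[ℂ] Fock d))) := by
  have hX' : X ∈ (NonUnitalStarAlgebra.adjoin ℂ s).toSubmodule := hX
  rw [NonUnitalStarAlgebra.adjoin_eq_span] at hX'
  refine Submodule.span_mono ?_ hX'
  intro Y hY
  -- Being a graded multiplier passes from generators to products. Applied to `1`, which has degree
  -- zero, it places `Y` itself in one homogeneous part.
  have key : ∀ n, ∃ m, ∀ W ∈ homogeneousPart B n, Y * W ∈ homogeneousPart B m := by
    induction hY using Subsemigroup.closure_induction with
    | mem Y hY => exact hs Y hY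
    | mul Y Y' _ _ h h' =>
      intro n
      obtain ⟨m, hm⟩ := h' n
      obtain ⟨k, hk⟩ := h m
      exact ⟨k, fun W hW => by rw [mul_assoc]; exact hk _ (hm _ hW)⟩
  obtain ⟨m, hm⟩ := key 0
  have hone : (1 : Fock d →L[ℂ] Fock d) ∈ homogeneousPart B 0 :=
    ⟨isHomogeneous_one, Submodule.subset_span ⟨[], [], 1, h1, by simp, by simp⟩⟩
  exact Set.mem_iUnion.2 ⟨m, by simpa using hm 1 hone⟩

/-- Only finitely many degrees occur, so for large `N` the mean kills every nonzero degree and fixes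
degree zero. -/
lemma exists_mk_gaugeMean_mem {B : Set (Calkin (Fock d))} {X : Fock d →L[ℂ] Fock d}
    (hX : X ∈ Submodule.span ℂ (⋃ n, (homogeneousPart B n : Set (Fock d →L[ℂ] Fock d)))) :
    ∃ N₀, ∀ N ≥ N₀, Calkin.mk (Fock d) (gaugeMean N X) ∈ gradedSpan cuntzGen B 0 := by
  induction hX using Submodule.span_induction with
  | mem X hX =>
    obtain ⟨n, hn⟩ := Set.mem_iUnion.1 hX
    refine ⟨n.natAbs + 1, fun N hN => ?_⟩
    rcases eq_or_ne n 0 with rfl | h0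
    · rw [gaugeMean_of_fixed (by omega) hn.1]
      exact hn.2
    · rw [gaugeMean_eq_zero h0 (by omega) hn.1, map_zero]
      exact zero_mem _
  | zero => exact ⟨0, fun N _ => by simp [gaugeMean, gauge]⟩
  | add X Y _ _ hX hY =>
    obtain ⟨N₁, h₁⟩ := hX
    obtain ⟨N₂, h₂⟩ := hY
    refine ⟨max N₁ N₂, fun N hN => ?_⟩
    rw [gaugeMean_add, map_add]
    exact add_mem (h₁ N (le_of_max_le_left hN)) (h₂ N (le_of_max_le_right hN))
  | smul c X _ hX =>
    obtain ⟨N₁, h₁⟩ := hX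
    refine ⟨N₁, fun N hN => ?_⟩
    rw [gaugeMean_smul, map_smul]
    exact Submodule.smul_mem _ c (h₁ N hN)

end Gauge

/-! ### Identification of `q(D)` for the algebra generated by `I`, `Z` and the creation operators -/

namespace WeightSequence

variable {d : ℕ} {Z : WeightSequence d} {p : ℕ}

lemma one_mem_extendedToeplitz : 1 ∈ Z.extendedToeplitz :=
  subset_cstarGen _ (Or.inl (Or.inl rfl))

lemma op_mem_extendedToeplitz : Z.op ∈ Z.extendedToeplitz :=
  subset_cstarGen _ (Or.inl (Or.inr rfl))

lemma creation_mem_extendedToeplitz (i : Fin d) : creation i ∈ Z.extendedToeplitz :=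
  subset_cstarGen _ (Or.inr ⟨i, rfl⟩)

lemma isHomogeneous_op : IsHomogeneous 0 Z.op := isHomogeneous_diag Z.bounded

lemma wordProd_mem_extendedToeplitz (α : List (Fin d)) :
    wordProd creation α ∈ Z.extendedToeplitz := by
  induction α with
  | nil => rw [wordProd_nil]; exact one_mem_extendedToeplitz
  | cons i α ih => rw [wordProd_cons]; exact mul_mem (creation_mem_extendedToeplitz i) ih

lemma op_pow_mem_extendedToeplitz (l : ℕ) : Z.op ^ l ∈ Z.extendedToeplitz := by
  induction l with
  | zero => rw [pow_zero]; exact one_mem_extendedToeplitz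
  | succ l ih => rw [pow_succ]; exact mul_mem ih op_mem_extendedToeplitz

lemma isHomogeneous_op_pow (l : ℕ) : IsHomogeneous 0 (Z.op ^ l) := by
  induction l with
  | zero => rw [pow_zero]; exact isHomogeneous_one
  | succ l ih => rw [pow_succ]; simpa using ih.mul isHomogeneous_op

lemma isClosed_qD_extendedToeplitz :
    IsClosed (qD Z.extendedToeplitz : Set (Calkin (Fock d))) :=
  isClosed_qD (isClosed_cstarGen _)

lemma wordProd_mul_pow_mul_star_mem_qD {α β : List (Fin d)} (h : α.length = β.length) (l : ℕ) :
    wordProd cuntzGen α * Z.z ^ l * star (wordProd cuntzGen β) ∈ qD Z.extendedToeplitz := by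
  have hmk : wordProd cuntzGen α * Z.z ^ l * star (wordProd cuntzGen β) =
      Calkin.mk (Fock d) (wordProd creation α * Z.op ^ l * star (wordProd creation β)) := by
    rw [map_mul, map_mul, map_pow, map_star, map_wordProd_creation, map_wordProd_creation]
    rfl
  rw [hmk]
  refine mk_mem_qD (mul_mem (mul_mem (wordProd_mem_extendedToeplitz α)
    (op_pow_mem_extendedToeplitz l)) (star_mem (wordProd_mem_extendedToeplitz β))) ?_
  have := ((isHomogeneous_wordProd α).mul (isHomogeneous_op_pow (Z := Z) l)).mul
    (isHomogeneous_wordProd β).star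
  rwa [h, add_zero, add_neg_cancel] at this

variable [NeZero d]

/-- `C₀` lies in the closed algebra `q(D)` because its generators do. Since `u_ξ` has degree `p -
1`, the conjugation is carried out on a gauge-invariant lift, where the degrees cancel. -/
lemma cornerEmbedding_mem_qD (hp : 0 < p) (c : Z.C00 p hp) :
    cornerEmbedding Z p hp c ∈ qD Z.extendedToeplitz := by
  have h0 : Z.C0 p ≤ qD Z.extendedToeplitz := by
    refine cstarGen_le isClosed_qD_extendedToeplitz ?_
    rintro _ ⟨α, β, l, h, -, rfl⟩
    exact wordProd_mul_pow_mul_star_mem_qD h l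
  obtain ⟨y, hy, hc⟩ := c.2
  have hcm : (c : Calkin (Fock d)) ∈ qD Z.extendedToeplitz := by
    rw [hc]
    exact h0 (mul_mem (mul_mem (Z.range_proj_mem_C0 hp) hy) (Z.range_proj_mem_C0 hp))
  obtain ⟨X, hX, hXc⟩ := hcm
  have h1 : cornerEmbedding Z p hp c = Calkin.mk (Fock d)
      (star (wordProd creation (xi d (p - 1))) * X * wordProd creation (xi d (p - 1))) := by
    rw [cornerEmbedding_apply, ← hXc, map_mul, map_mul, map_star, map_wordProd_creation]
    rfl
  rw [h1]
  refine mk_mem_qD (mul_mem (mul_mem (star_mem (wordProd_mem_extendedToeplitz _)) hX.1)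
    (wordProd_mem_extendedToeplitz _)) ?_
  have := ((isHomogeneous_wordProd (xi d (p - 1))).star.mul (isHomogeneous_zero_iff.2 hX.2)).mul
    (isHomogeneous_wordProd (xi d (p - 1)))
  rwa [add_zero, neg_add_cancel] at this

lemma tensorEmbedding_mem_qD (hp : 0 < p) (hA : Z.ConditionA p)
    (x : CStarTensor (UHF d) (Z.C00 p hp)) : tensorEmbedding Z hp hA x ∈ qD Z.extendedToeplitz := by
  refine uhfTensorEmbedding_mem _ _ _ isClosed_qD_extendedToeplitz (fun n α β => ?_)
    (cornerEmbedding_mem_qD hp) x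
  have h := wordProd_mul_pow_mul_star_mem_qD (Z := Z) (α := List.ofFn α) (β := List.ofFn β)
    (by simp) 0
  rwa [pow_zero, mul_one] at h

lemma generator_mul_mem_homogeneousPart (hp : 0 < p) (hA : Z.ConditionA p)
    {X : Fock d →L[ℂ] Fock d}
    (hX : X ∈ ({1, Z.op} ∪ Set.range creation) ∪
      star ({1, Z.op} ∪ Set.range (creation (d := d)))) (n : ℤ) :
    ∃ m, ∀ Y ∈ homogeneousPart (Set.range (cornerEmbedding Z p hp)) n,
      X * Y ∈ homogeneousPart (Set.range (cornerEmbedding Z p hp)) m := by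
  set B := Set.range (cornerEmbedding Z p hp) with hBdef
  -- The embedded corner is a `*`-algebra containing all iterates of `z`, so it can serve as the
  -- coefficient set.
  have hB : ∀ r, ∀ b ∈ B, (calkinEnd d)^[r] Z.z * b ∈ B ∧ star ((calkinEnd d)^[r] Z.z) * b ∈ B := by
    rintro r _ ⟨b, rfl⟩
    obtain ⟨c, hc⟩ := iterate_calkinEnd_mem_range hp hA r
    rw [← hc]
    exact ⟨⟨c * b, map_mul _ c b⟩, ⟨star c * b, by
      rw [map_mul, StarHomClass.map_star (cornerEmbedding Z p hp)]⟩⟩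
  have hone : ∀ Y ∈ homogeneousPart B n, 1 * Y ∈ homogeneousPart B n := fun Y hY => by
    rwa [one_mul]
  have hop : ∀ Y ∈ homogeneousPart B n, Z.op * Y ∈ homogeneousPart B n := fun Y hY => by
    refine ⟨by simpa using (isHomogeneous_op (Z := Z)).mul hY.1, ?_⟩
    rw [map_mul]
    exact (weight_mul_mem_gradedSpan isCuntzFamily_cuntzGen hp (iterate_calkinEnd_z hA) hB hY.2).1
  have hop' : ∀ Y ∈ homogeneousPart B n, star Z.op * Y ∈ homogeneousPart B n := fun Y hY => by
    refine ⟨by simpa using (isHomogeneous_op (Z := Z)).star.mul hY.1, ?_⟩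
    rw [map_mul, map_star]
    exact (weight_mul_mem_gradedSpan isCuntzFamily_cuntzGen hp (iterate_calkinEnd_z hA) hB hY.2).2
  have hcr : ∀ i, ∀ Y ∈ homogeneousPart B n, creation i * Y ∈ homogeneousPart B (n + 1) :=
    fun i Y hY => by
      refine ⟨by rw [add_comm]; exact (isHomogeneous_creation i).mul hY.1, ?_⟩
      rw [map_mul]
      exact gen_mul_mem_gradedSpan i hY.2
  have hcr' : ∀ i, ∀ Y ∈ homogeneousPart B n, star (creation i) * Y ∈ homogeneousPart B (n - 1) :=
    fun i Y hY => by
      refine ⟨by rw [sub_eq_neg_add]; exact (isHomogeneous_creation i).star.mul hY.1, ?_⟩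
      rw [map_mul, map_star]
      exact star_gen_mul_mem_gradedSpan isCuntzFamily_cuntzGen i hY.2
  rcases hX with ((rfl | rfl) | ⟨i, rfl⟩) | h
  · exact ⟨n, hone⟩
  · exact ⟨n, hop⟩
  · exact ⟨n + 1, hcr i⟩
  · obtain ⟨X', hX'⟩ : ∃ X', X' = star X := ⟨_, rfl⟩
    have hXs : X = star X' := by rw [hX', star_star]
    rw [Set.mem_star, ← hX'] at h
    subst hXs
    rcases h with (rfl | rfl) | ⟨i, rfl⟩
    · exact ⟨n, by rwa [star_one]⟩
    · exact ⟨n, hop'⟩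
    · exact ⟨n - 1, hcr' i⟩

lemma qD_subset_range_tensorEmbedding (hp : 0 < p) (hA : Z.ConditionA p) {y : Calkin (Fock d)}
    (hy : y ∈ qD Z.extendedToeplitz) : y ∈ Set.range (tensorEmbedding Z hp hA) := by
  obtain ⟨X, ⟨hX, hXf⟩, rfl⟩ := hy
  have hc := uhfEmbedding_mul_cornerEmbedding hp hA
  have hcl := isClosed_range_uhfTensorEmbedding isCuntzFamily_cuntzGen cornerEmbedding_injective hc
  change _ ∈ Set.range (uhfTensorEmbedding isCuntzFamily_cuntzGen cornerEmbedding_injective hc)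
  rw [← hcl.closure_eq]
  refine Metric.mem_closure_iff.2 fun ε hε => ?_
  -- The approximant `Y` need not be gauge invariant. The mean is contractive and fixes `X`, so
  -- averaging `Y` preserves the estimate and moves its class into degree zero.
  obtain ⟨Y, hY, hXY⟩ := Metric.mem_closure_iff.1 (show X ∈ closure _ from hX) ε hε
  obtain ⟨N₀, hN₀⟩ := exists_mk_gaugeMean_mem (mem_span_homogeneousPart
    (one_mem_range_cornerEmbedding Z hp) (fun X hX => generator_mul_mem_homogeneousPart hp hA hX) hY)
  have hmem := hN₀ (N₀ + 1) (Nat.le_succ _)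
  refine ⟨_, (mem_uhfTensorRange _ _ _).1 (gradedSpan_zero_le ?_ hmem), ?_⟩
  · rintro n α β _ ⟨c, rfl⟩
    exact (mem_uhfTensorRange _ _ _).2 (matUnit_mul_mem_range_uhfTensorEmbedding _ _ _ n α β c)
  · have h1 : X - gaugeMean (N₀ + 1) Y = gaugeMean (N₀ + 1) (X - Y) := by
      rw [gaugeMean_sub, gaugeMean_of_fixed (Nat.succ_pos _) (isHomogeneous_zero_iff.2 hXf)]
    rw [dist_eq_norm] at hXY ⊢
    change ‖Calkin.mk (Fock d) X - Calkin.mk (Fock d) _‖ < ε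
    rw [← map_sub, h1]
    refine (Calkin.norm_mk_le _).trans_lt ?_
    exact (norm_gaugeMean_le (Nat.succ_pos _) _).trans_lt hXY

theorem nonempty_qD_extendedToeplitz_equiv (hp : 0 < p) (hA : Z.ConditionA p) :
    Nonempty (qD Z.extendedToeplitz ≃⋆ₐ[ℂ] CStarTensor (UHF d) (Z.C00 p hp)) := by
  let f : CStarTensor (UHF d) (Z.C00 p hp) →⋆ₙₐ[ℂ] qD Z.extendedToeplitz :=
    NonUnitalStarAlgHom.codRestrict (tensorEmbedding Z hp hA) _ (tensorEmbedding_mem_qD hp hA)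
  have hf : Function.Bijective f := by
    refine ⟨fun a b hab => tensorEmbedding_injective hp hA (congrArg Subtype.val hab), ?_⟩
    rintro ⟨y, hy⟩
    obtain ⟨x, hx⟩ := qD_subset_range_tensorEmbedding hp hA hy
    exact ⟨x, Subtype.ext hx⟩
  exact ⟨(StarAlgEquiv.ofBijective f hf).symm⟩

end WeightSequence

/-! ### Positive weights -/

section PositiveWeights

variable {d : ℕ}

lemma diag_nonneg {T : ∀ k, TensorPow d k →L[ℂ] TensorPow d k} (hT : ∃ C, ∀ k, ‖T k‖ ≤ C)
    (h : ∀ k, (T k).IsPositive) : 0 ≤ diag T hT := by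
  rw [ContinuousLinearMap.nonneg_iff_isPositive, ContinuousLinearMap.isPositive_iff_complex]
  intro x
  have h0 : 0 ≤ inner ℂ (diag T hT x) x := by
    rw [lp.inner_eq_tsum]
    exact tsum_nonneg fun k => (h k).inner_nonneg_left (x k)
  obtain ⟨h1, h2⟩ := Complex.nonneg_iff.1 h0
  exact ⟨Complex.ext rfl h2, h1⟩

lemma vacuumProj_mul_creation (i : Fin d) : vacuumProj d * creation i = 0 := by
  ext x k : 3
  change vacuumProj d (creation i x) k = 0
  cases k with
  | zero => rw [vacuumProj, diag_apply, creation_apply_zero, map_zero]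
  | succ k => rw [vacuumProj, diag_apply, if_neg (Nat.succ_ne_zero k)]; rfl

lemma diag_mul_vacuumProj {T : ∀ k, TensorPow d k →L[ℂ] TensorPow d k}
    (hT : ∃ C, ∀ k, ‖T k‖ ≤ C) (h0 : T 0 = 0) : diag T hT * vacuumProj d = 0 := by
  ext x k : 3
  change T k ((if k = 0 then 1 else 0 : TensorPow d k →L[ℂ] TensorPow d k) (x k)) = 0
  split_ifs with hk
  · subst hk; rw [h0]; rfl
  · exact map_zero (T k)

lemma vacuumProj_mul_diag {T : ∀ k, TensorPow d k →L[ℂ] TensorPow d k}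
    (hT : ∃ C, ∀ k, ‖T k‖ ≤ C) (h0 : T 0 = 0) : vacuumProj d * diag T hT = 0 := by
  ext x k : 3
  change (if k = 0 then 1 else 0 : TensorPow d k →L[ℂ] TensorPow d k) (T k (x k)) = 0
  split_ifs with hk
  · subst hk; rw [h0]; rfl
  · rfl

lemma vacuumProj_mul_self : vacuumProj d * vacuumProj d = vacuumProj d := by
  ext x k : 3
  change (if k = 0 then 1 else 0 : TensorPow d k →L[ℂ] TensorPow d k)
    ((if k = 0 then 1 else 0 : TensorPow d k →L[ℂ] TensorPow d k) (x k)) =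
      (if k = 0 then 1 else 0 : TensorPow d k →L[ℂ] TensorPow d k) (x k)
  split_ifs <;> rfl

/-- The square root vanishes at `0`, so the non-unital functional calculus stays inside `S`, which
need not contain `1`. -/
lemma mem_of_mul_self_mem {A : Type*} [CStarAlgebra A] [PartialOrder A]
    [StarOrderedRing A] {S : NonUnitalStarSubalgebra ℂ A} (hS : IsClosed (S : Set A)) {a : A}
    (ha : 0 ≤ a) (haS : a * a ∈ S) : a ∈ S := by
  have h : 0 ≤ a * a := by
    have := star_mul_self_nonneg a
    rwa [(IsSelfAdjoint.of_nonneg ha).star_eq] at this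
  have := hS
  rw [← CFC.sqrt_mul_self a ha, CFC.sqrt_eq_real_sqrt _ h]
  exact cfcₙ_mem (𝕜' := ℂ) (s := S) _ haS

/-- From `ε ≤ a ≤ M` one gets `0 ≤ 1 - a / (M + ε) ≤ 1 - ε / (M + ε)`. The denominator `M + ε` is
positive without any argument that `M` is. -/
lemma norm_one_sub_smul_le {A : Type*} [CStarAlgebra A] [PartialOrder A] [StarOrderedRing A]
    {a : A} {ε M : ℝ} (hε : 0 < ε) (hM : ‖a‖ ≤ M) (ha : 0 ≤ a) (h : algebraMap ℝ A ε ≤ a) :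
    ‖1 - (M + ε)⁻¹ • a‖ ≤ 1 - (M + ε)⁻¹ * ε := by
  have hM0 : 0 ≤ M := (norm_nonneg a).trans hM
  have hc : 0 ≤ (M + ε)⁻¹ := by positivity
  have hc1 : (M + ε)⁻¹ * M ≤ 1 := by
    rw [inv_mul_le_iff₀ (by positivity)]; linarith
  have hc2 : (M + ε)⁻¹ * ε ≤ 1 := by
    rw [inv_mul_le_iff₀ (by positivity)]; linarith
  have h1 : (M + ε)⁻¹ • a ≤ 1 := by
    have h2 : a ≤ algebraMap ℝ A M := (IsSelfAdjoint.le_algebraMap_norm_self (.of_nonneg ha)).trans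
      (algebraMap_mono A hM)
    refine (smul_le_smul_of_nonneg_left h2 hc).trans ?_
    rw [Algebra.algebraMap_eq_smul_one, smul_smul]
    simpa only [one_smul] using smul_le_smul_of_nonneg_right hc1 (zero_le_one (α := A))
  rw [CStarAlgebra.norm_le_iff_le_algebraMap _ (by linarith) (sub_nonneg.2 h1), map_sub, map_one]
  refine sub_le_sub_left ?_ 1
  have h3 := smul_le_smul_of_nonneg_left h hc
  rwa [Algebra.algebraMap_eq_smul_one, smul_smul, ← Algebra.algebraMap_eq_smul_one] at h3

end PositiveWeights

/-! ### Recovering the creation operators from the weighted shifts -/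

namespace WeightSequence

variable {d : ℕ} {Z : WeightSequence d}

lemma exists_bound_off_vacuum (T : ∀ k, TensorPow d k →L[ℂ] TensorPow d k)
    (hT : ∃ C, ∀ k, k ≠ 0 → ‖T k‖ ≤ C) :
    ∃ C, ∀ k, ‖(if k = 0 then 0 else T k : TensorPow d k →L[ℂ] TensorPow d k)‖ ≤ C := by
  obtain ⟨C, hC⟩ := hT
  refine ⟨max C 0, fun k => ?_⟩
  split_ifs with h
  · rw [norm_zero]; exact le_max_right _ _
  · exact (hC k h).trans (le_max_left _ _)

/-- The weight operator with its block of degree zero replaced by zero. -/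
def reducedOp (Z : WeightSequence d) : Fock d →L[ℂ] Fock d :=
  diag (fun k => if k = 0 then 0 else Z.weight k)
    (exists_bound_off_vacuum Z.weight (Z.bounded.imp fun _ h k _ => h k))

lemma reducedOp_add_vacuumProj : Z.reducedOp + vacuumProj d = Z.op := by
  ext x k : 3
  change (if k = 0 then 0 else Z.weight k : TensorPow d k →L[ℂ] TensorPow d k) (x k) +
    (if k = 0 then 1 else 0 : TensorPow d k →L[ℂ] TensorPow d k) (x k) = Z.weight k (x k)
  split_ifs with h
  · subst h; rw [Z.weight_zero]; exact zero_add _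
  · exact add_zero _

lemma op_mul_creation (i : Fin d) : Z.op * creation i = Z.reducedOp * creation i := by
  rw [← reducedOp_add_vacuumProj, add_mul, vacuumProj_mul_creation, add_zero]

section Positive

variable (hZ : ∀ k, (Z.weight k).IsPositive)
include hZ

lemma reducedOp_nonneg : 0 ≤ Z.reducedOp := diag_nonneg _ fun k => by
  split_ifs
  · exact ContinuousLinearMap.isPositive_zero
  · exact hZ k

/-- The sum equals `Z (1 - P) Z` with `P` the vacuum projection. The ranges of the shifts miss the
vacuum, so only the square of the reduced weight is directly available. -/
lemma sum_weightedShift_mul_star :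
    ∑ i, Z.op * creation i * star (Z.op * creation i) = Z.reducedOp * Z.reducedOp := by
  have h1 : star Z.op = Z.op := (IsSelfAdjoint.of_nonneg (diag_nonneg Z.bounded hZ)).star_eq
  have h2 : ∑ i : Fin d, creation i * star (creation i) = 1 - vacuumProj d :=
    eq_sub_of_add_eq sum_creation_mul_star_add_vacuumProj
  have h3 : ∀ i, Z.op * creation i * star (Z.op * creation i) =
      Z.op * (creation i * star (creation i)) * Z.op := fun i => by
    rw [star_mul, h1]; simp only [mul_assoc]
  have h4 : Z.reducedOp * vacuumProj d = 0 := diag_mul_vacuumProj _ rfl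
  have h5 : Z.op * (1 - vacuumProj d) = Z.reducedOp := by
    rw [← reducedOp_add_vacuumProj, mul_sub, mul_one, add_mul, h4, vacuumProj_mul_self, zero_add,
      add_sub_cancel_right]
  simp only [h3]
  rw [← Finset.sum_mul, ← Finset.mul_sum, h2, h5, ← reducedOp_add_vacuumProj, mul_add, h4, add_zero]

lemma reducedOp_mem_weightedToeplitz : Z.reducedOp ∈ Z.weightedToeplitz := by
  have h : Z.reducedOp * Z.reducedOp ∈ Z.weightedToeplitz := by
    rw [← sum_weightedShift_mul_star hZ]
    have hW : ∀ i, Z.op * creation i ∈ Z.weightedToeplitz := fun i => subset_cstarGen _ ⟨i, rfl⟩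
    exact sum_mem fun i _ => mul_mem (hW i) (star_mem (hW i))
  exact mem_of_mul_self_mem (isClosed_cstarGen _) (reducedOp_nonneg hZ) h

/-- This is a Neumann series for inverting the reduced weight `Z'` off the vacuum: with `E = 1 - c
Z'` there and `‖E‖ < 1`, the elements `S_i - E^n S_i` converge to `S_i`. Each is built from `Z'` and
`W_i` only, as membership of `1` is not yet available. -/
lemma creation_mem_weightedToeplitz (i : Fin d) : creation i ∈ Z.weightedToeplitz := by
  obtain ⟨M, hM⟩ := Z.bounded
  obtain ⟨ε, hε, hbelow⟩ := Z.bounded_below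
  set c : ℝ := (M + ε)⁻¹ with hc
  have hM0 : 0 ≤ M := (norm_nonneg _).trans (hM 0)
  have hcpos : 0 < c := by positivity
  have hcε : c * ε ≤ 1 := by
    rw [hc, inv_mul_le_iff₀ (by positivity)]; linarith
  have hEn : ∀ k, ‖(if k = 0 then 0 else 1 - c • Z.weight k :
      TensorPow d k →L[ℂ] TensorPow d k)‖ ≤ 1 - c * ε := fun k => by
    split_ifs with hk
    · rw [norm_zero]; linarith
    · have h0 : 0 ≤ Z.weight k := (ContinuousLinearMap.nonneg_iff_isPositive _).2 (hZ k)
      refine norm_one_sub_smul_le hε (hM k) h0 ?_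
      have := hbelow k (by omega)
      rwa [CFC.abs_of_nonneg _ h0] at this
  let E : Fock d →L[ℂ] Fock d := diag _ ⟨_, hEn⟩
  have hE : ‖E‖ < 1 := (norm_diag_le _ hEn).trans_lt (by nlinarith)
  have hEsum : E + vacuumProj d = 1 - c • Z.reducedOp := by
    ext x k : 3
    change (if k = 0 then 0 else 1 - c • Z.weight k : TensorPow d k →L[ℂ] TensorPow d k) (x k) +
      (if k = 0 then 1 else 0 : TensorPow d k →L[ℂ] TensorPow d k) (x k) =
      x k - c • (if k = 0 then 0 else Z.weight k : TensorPow d k →L[ℂ] TensorPow d k) (x k)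
    split_ifs with hk
    · simp
    · simp
  -- `E^n S_i` has no vacuum component, so the identity `E + P = 1 - c Z'` lets `E` act on it as `1
  -- - c Z'`.
  have hPE : ∀ n, vacuumProj d * (E ^ n * creation i) = 0 := fun n => by
    cases n with
    | zero => rw [pow_zero, one_mul, vacuumProj_mul_creation]
    | succ n =>
      have : vacuumProj d * E = 0 := vacuumProj_mul_diag _ rfl
      rw [pow_succ', mul_assoc, ← mul_assoc, this, zero_mul]
  have happrox : ∀ n : ℕ, creation i - E ^ n * creation i ∈ Z.weightedToeplitz := by
    intro n
    induction n with
    | zero => rw [pow_zero, one_mul, sub_self]; exact zero_mem _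
    | succ n ih =>
      -- With `x_n = S_i - E^n S_i` the recursion is `x_{n+1} = x_n - c Z' x_n + c W_i`, whose terms
      -- all stay in the algebra.
      have hstep : creation i - E ^ (n + 1) * creation i =
          (creation i - E ^ n * creation i) -
            (c : ℂ) • (Z.reducedOp * (creation i - E ^ n * creation i)) +
            (c : ℂ) • (Z.op * creation i) := by
        have hk : E * (E ^ n * creation i) =
            E ^ n * creation i - c • (Z.reducedOp * (E ^ n * creation i)) := by
          have := congrArg (· * (E ^ n * creation i)) hEsum
          simpa only [add_mul, hPE n, add_zero, sub_mul, one_mul, smul_mul_assoc] using this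
        rw [op_mul_creation, pow_succ', mul_assoc, hk, mul_sub, smul_sub, Complex.coe_smul,
          Complex.coe_smul]
        abel
      rw [hstep]
      exact add_mem (sub_mem ih (SMulMemClass.smul_mem _
        (mul_mem (reducedOp_mem_weightedToeplitz hZ) ih)))
        (SMulMemClass.smul_mem _ (subset_cstarGen _ ⟨i, rfl⟩))
  have hlim : Tendsto (fun n : ℕ => creation i - E ^ n * creation i) atTop (𝓝 (creation i)) := by
    have := (tendsto_pow_atTop_nhds_zero_of_norm_lt_one hE).mul_const (creation i)
    simpa using (tendsto_const_nhds (x := creation i)).sub this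
  exact (isClosed_cstarGen _).mem_of_tendsto hlim (Eventually.of_forall happrox)

/-- For positive weights the weighted Toeplitz algebra contains `I`, `Z` and all `Sᵢ`. -/
theorem weightedToeplitz_eq_extendedToeplitz [NeZero d] :
    Z.weightedToeplitz = Z.extendedToeplitz := by
  have hS := creation_mem_weightedToeplitz hZ
  have h1 : (1 : Fock d →L[ℂ] Fock d) ∈ Z.weightedToeplitz := by
    rw [← star_creation_mul_self (0 : Fin d)]
    exact mul_mem (star_mem (hS 0)) (hS 0)
  refine le_antisymm (cstarGen_le (isClosed_cstarGen _) ?_) (cstarGen_le (isClosed_cstarGen _) ?_)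
  · rintro _ ⟨i, rfl⟩
    exact mul_mem op_mem_extendedToeplitz (creation_mem_extendedToeplitz i)
  · rintro _ ((rfl | rfl) | ⟨i, rfl⟩)
    · exact h1
    -- The full weight differs from the reduced one by the vacuum projection, which belongs to the
    -- algebra once `1` and all `S_i` do.
    · have h2 : vacuumProj d = 1 - ∑ i : Fin d, creation i * star (creation i) :=
        eq_sub_of_add_eq' sum_creation_mul_star_add_vacuumProj
      change Z.op ∈ Z.weightedToeplitz
      rw [← reducedOp_add_vacuumProj, h2]
      exact add_mem (reducedOp_mem_weightedToeplitz hZ)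
        (sub_mem h1 (sum_mem fun i _ => mul_mem (hS i) (star_mem (hS i))))
    · exact hS i

end Positive
end WeightSequence

end WeightedCuntz

end

theorem mainTheorem3 (d : ℕ) [NeZero d] (Z : WeightedCuntz.WeightSequence d)
    (p : ℕ) (hp : 0 < p) (hA : Z.ConditionA p) :
    ((∀ k, (Z.weight k).IsPositive) →
      Nonempty (WeightedCuntz.WeightSequence.qD Z.weightedToeplitz ≃⋆ₐ[ℂ]
        WeightedCuntz.CStarTensor (WeightedCuntz.UHF d) (Z.C00 p hp))) ∧
    Nonempty (WeightedCuntz.WeightSequence.qD Z.extendedToeplitz ≃⋆ₐ[ℂ]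
      WeightedCuntz.CStarTensor (WeightedCuntz.UHF d) (Z.C00 p hp)) := by
  refine ⟨fun hZ => ?_, WeightedCuntz.WeightSequence.nonempty_qD_extendedToeplitz_equiv hp hA⟩
  rw [WeightedCuntz.WeightSequence.weightedToeplitz_eq_extendedToeplitz hZ]
  exact WeightedCuntz.WeightSequence.nonempty_qD_extendedToeplitz_equiv hp hA
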